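/- **Notation.** For $\tau\in\mathbb H$ let $\Lambda_\tau=\mathbb Z+\mathbb Z\tau$, and let $\wp(z)=\wp(z;\tau)$, $\zeta(z)=\zeta(z;\tau)$, $g_2=g_2(\tau)$, $g_3=g_3(\tau)$ be the Weierstrass functions and invariants of $\Lambda_\tau$, $\eta_1=2\zeta(\tfrac12;\tau)$ and $\eta_2=2\zeta(\tfrac\tau2;\tau)$. Let $E_6$ be the normalized Eisenstein series of weight $6$. Put $$F_0=\{\tau\in\mathbb H: 0\le\operatorname{Re}\tau\le1,\ |\tau-\tfrac12|\ge\tfrac12\},\qquad F=\{\tau\in\mathbb H: 0\le\operatorname{Re}\tau\le1,\ |\tau|\ge1,\ |\tau-1|\ge1\},$$ let $\mathring F_0$ be the interior of $F_0$, and $F_0^{<}=\{\tau\in\mathring F_0:\operatorname{Re}\tau<\tfrac12\}$, $F_0^{>}=\{\tau\in\mathring F_0:\operatorname{Re}\tau>\tfrac12\}$. For $C\in\mathbb R$ put $$f_C(\tau)=(C-\tau)g_2^2-18(C\eta_1-\eta_2)g_3,\qquad \phi(\tau)=\tau+\frac{36\pi i\,g_3}{g_2^2-18\eta_1g_3}\in\mathbb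 C\cup\{\infty\},$$ with $\phi(\tau)=\infty$ where the denominator vanishes. **The curves.** Let $\tau_\infty$ be the zero of $E_6'$ in $F_0$. For $C\in\mathbb R\setminus\{0,1\}$ let $\tau_<(C)$ and $\tau_>(C)$ be the zeros of $f_C$ in $F_0^{<}$ and in $F_0^{>}$; put $\tau_<(1)=\frac{\tau_\infty-1}{\tau_\infty}$ and $\tau_>(0)=\frac1{1-\tau_\infty}$. (Each of the zeros named here exists and is unique; this is part of the assertion.) Let $$\mathcal C_1=\{\tau_<(C):C<0\}\cup\{\tau_\infty\}\cup\{\tau_>(C):C>1\},\quad \mathcal C_2=\{\tau_<(C):C>0\},\quad \mathcal C_3=\{\tau_>(C):C<1\},$$ $\mathcal C_<=\mathcal C_2\cap F$ and $\mathcal C_>=\mathcal C_3\cap F$. **The equation.** For $\tau\in F_0\setminus\{e^{\pi i/3}\}$ choose $q_1,q_2\in\mathbb C\setminus\Lambda_\tau$ with $\wp(q_1)=\sqrt{g_2/12}$ and $\wp(q_2)=-\sqrt{g_2/12}$ (this is possible), and consider $$y''(z)=I(z;\tau)\,y(z),\qquad I(z;\tau)=12\wp(z)+2\sum_{j=1}^2\bigl(\wp(z-q_j)+\wp(z+q_j)\bigr)+\sum_{j=1}^2\frac{\wp'(q_j)^2}{\wp(q_j)\,(\wp(z)-\wp(q_j))},$$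 with singular points $0,\pm q_1,\pm q_2$ modulo $\Lambda_\tau$. Let $y_1=1/\wp''$ and $y_2=y_1\chi$, where $\chi(z)=18\wp(z)^2\wp'(z)+\tfrac12g_2\wp'(z)+2g_2^2z-36g_3\zeta(z)$, and let $\chi_1=2(g_2^2-18\eta_1g_3)$, $\chi_2=2(g_2^2\tau-18\eta_2g_3)$. An element $D\in\mathbb C\cup\{\infty\}$ is called *monodromy data* of the equation if, in some fundamental system of solutions at some non-singular base point, analytic continuation along all loops of $\mathbb C/\Lambda_\tau$ that avoid the singular points depends only on the class of the loop in $\pi_1(\mathbb C/\Lambda_\tau)=\Lambda_\tau$ and defines a homomorphism $\Lambda_\tau\to SL(2,\mathbb C)$ with $$1\mapsto\begin{pmatrix}1&0\\1&1\end{pmatrix},\quad \tau\mapsto\begin{pmatrix}1&0\\D&1\end{pmatrix}\quad(D\ne\infty),\qquad\text{resp.}\qquad 1\mapsto\begin{pmatrix}1&0\\0&1\end{pmatrix},\quad \tau\mapsto\begin{pmatrix}1&0\\1&1\end{pmatrix}\quad(D=\infty).$$ **Theorem 5.1 (Monodromy interpretation).** (0) For every $\tau\in F_0\setminus\{e^{\pi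 i/3}\}$, the functions $y_1,y_2$ are meromorphic on $\mathbb C$ and form a fundamental system of holomorphic solutions of $y''=I(z;\tau)y$ near every non-singular point. At every non-singular base point, the monodromy with respect to $(\chi_1y_1,y_2)$ (with respect to $(\chi_2y_1,y_2)$ if $\chi_1=0$) depends only on the class in $\Lambda_\tau$, is given by the above matrices with $D=\phi(\tau)$, all its matrices are unipotent, and the two matrices above generate the monodromy group. The equation has exactly one monodromy data, namely $D=\phi(\tau)$. (1) Let $L$ be the set of all $\tau\in F_0\setminus\{e^{\pi i/3}\}$ such that the monodromy data $D$ of the equation lies in $\mathbb R\cup\{\infty\}$. Then $L=\mathcal C_1\cup\mathcal C_2\cup\mathcal C_3$ and $L\cap F=\mathcal C_<\cup\mathcal C_>$. (2) Let $\gamma=\begin{pmatrix}a&b\\c&d\end{pmatrix}\in\Gamma_0(2)$ and let $\tilde\tau\in F_0$ be such that $\gamma\cdot\tilde\tau=\frac{a\tilde\tau+b}{c\tilde\tau+d}$ is a zero of $E_6'$. Then $\tilde\tau\ne e^{\pi i/3}$, and the monodromy data of the equation with $\tau=\tilde\tau$ is precisely $D=-\frac dc$ (which is $\infty$ if $c=0$).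 -/

import Mathlib

namespace E6Monodromy

open UpperHalfPlane Topology PeriodPair
open scoped MatrixGroups

noncomputable section

/-! ### Elliptic functions with periods `1` and `τ` -/

/-- The pair of periods `(1, τ)`, spanning `Λ_τ = ℤ + ℤ τ`. -/
def periods (τ : UpperHalfPlane) : PeriodPair where
  ω₁ := 1
  ω₂ := τ
  indep := by
    rw [LinearIndependent.pair_iff]
    intro s t h
    have him := congrArg Complex.im h
    have hre := congrArg Complex.re h
    have ht : t = 0 := by
      have h0 : τ.im ≠ 0 := τ.im_ne_zero
      simpa [h0] using him
    subst ht
    exact ⟨by simpa using hre, rfl⟩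

/-- The Weierstrass function `℘(z; τ)`. -/
def wp (τ : UpperHalfPlane) (z : ℂ) : ℂ := (periods τ).weierstrassP z

/-- The derivative `℘'(z; τ)`. -/
def wpDeriv (τ : UpperHalfPlane) (z : ℂ) : ℂ := (periods τ).derivWeierstrassP z

/-- The invariant `g₂(τ) = 60 G₄(τ)`. -/
def g2 (τ : UpperHalfPlane) : ℂ := (periods τ).g₂

/-- The invariant `g₃(τ) = 140 G₆(τ)`. -/
def g3 (τ : UpperHalfPlane) : ℂ := (periods τ).g₃

/-- The Weierstrass zeta function
`ζ(z; τ) = 1/z + ∑_{ω ≠ 0} (1/(z - ω) + 1/ω + z/ω²)`, the odd primitive of `-℘`. Since `1 / 0 = 0`,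
the summand at `ω = 0` below is exactly the leading term `1/z`. -/
def zeta (τ : UpperHalfPlane) (z : ℂ) : ℂ :=
  ∑' ω : (periods τ).lattice, (1 / (z - ω) + 1 / (ω : ℂ) + z / (ω : ℂ) ^ 2)

/-- The quasi-period `η₁(τ) = 2 ζ(1/2; τ)`. -/
def eta1 (τ : UpperHalfPlane) : ℂ := 2 * zeta τ (1 / 2)

/-- The quasi-period `η₂(τ) = 2 ζ(τ/2; τ)`. -/
def eta2 (τ : UpperHalfPlane) : ℂ := 2 * zeta τ ((τ : ℂ) / 2)

/-- The derivative `E₆'(τ)` of the normalized Eisenstein series of weight six. -/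
def E6Deriv (τ : UpperHalfPlane) : ℂ :=
  deriv (fun z : ℂ => ModularForm.E₆ (UpperHalfPlane.ofComplex z)) τ

/-! ### Fundamental domains -/

/-- The basic fundamental domain of `Γ₀(2)`. -/
def F0 : Set UpperHalfPlane :=
  {τ | 0 ≤ τ.re ∧ τ.re ≤ 1 ∧ 1 / 2 ≤ ‖(τ : ℂ) - 1 / 2‖}

/-- The basic fundamental domain of `SL(2, ℤ)`. -/
def F : Set UpperHalfPlane :=
  {τ | 0 ≤ τ.re ∧ τ.re ≤ 1 ∧ 1 ≤ ‖(τ : ℂ)‖ ∧ 1 ≤ ‖(τ : ℂ) - 1‖}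

/-- The part of the interior of `F0` to the left of `Re τ = 1/2`. -/
def F0Left : Set UpperHalfPlane := {τ | τ ∈ interior F0 ∧ τ.re < 1 / 2}

/-- The part of the interior of `F0` to the right of `Re τ = 1/2`. -/
def F0Right : Set UpperHalfPlane := {τ | τ ∈ interior F0 ∧ 1 / 2 < τ.re}

/-- `F0` without the point `e^{πi/3}`. -/
def F0Punctured : Set UpperHalfPlane :=
  {τ | τ ∈ F0 ∧ (τ : ℂ) ≠ Complex.exp (Real.pi * Complex.I / 3)}

/-! ### The functions `f_C` and `φ`, and the three curves -/

/-- `f_C(τ) = (C - τ) g₂² - 18 (C η₁ - η₂) g₃`. -/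
def fC (C : ℝ) (τ : UpperHalfPlane) : ℂ :=
  (C - τ) * g2 τ ^ 2 - 18 * (C * eta1 τ - eta2 τ) * g3 τ

open Classical in
/-- `φ(τ) = τ + 36 π i g₃ / (g₂² - 18 η₁ g₃)`, equal to `∞` where the denominator vanishes. -/
def phi (τ : UpperHalfPlane) : OnePoint ℂ :=
  if g2 τ ^ 2 - 18 * eta1 τ * g3 τ = 0 then OnePoint.infty
  else ((τ + 36 * Real.pi * Complex.I * g3 τ / (g2 τ ^ 2 - 18 * eta1 τ * g3 τ) : ℂ) : OnePoint ℂ)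

/-- `τ_∞`, the zero of `E₆'` in `F0`. -/
def tauInfty : UpperHalfPlane := Classical.epsilon fun τ => τ ∈ F0 ∧ E6Deriv τ = 0

/-- `γ₁ · τ = 1 / (1 - τ)`. -/
def gamma1 : SL(2, ℤ) := ⟨!![0, 1; -1, 1], by simp [Matrix.det_fin_two]⟩

/-- `γ₂ · τ = (τ - 1) / τ`. -/
def gamma2 : SL(2, ℤ) := ⟨!![1, -1; 1, 0], by simp [Matrix.det_fin_two]⟩

open Classical in
/-- `τ_<(C)`: the zero of `f_C` in `F0Left` for `C ≠ 0, 1`, and `τ_<(1) = (τ_∞ - 1) / τ_∞`. -/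
def tauLess (C : ℝ) : UpperHalfPlane :=
  if C = 1 then gamma2 • tauInfty else Classical.epsilon fun τ => τ ∈ F0Left ∧ fC C τ = 0

open Classical in
/-- `τ_>(C)`: the zero of `f_C` in `F0Right` for `C ≠ 0, 1`, and `τ_>(0) = 1 / (1 - τ_∞)`. -/
def tauGreater (C : ℝ) : UpperHalfPlane :=
  if C = 0 then gamma1 • tauInfty else Classical.epsilon fun τ => τ ∈ F0Right ∧ fC C τ = 0

/-- The curve `𝒞₁`. -/
def curve1 : Set UpperHalfPlane := tauLess '' Set.Iio 0 ∪ {tauInfty} ∪ tauGreater '' Set.Ioi 1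

/-- The curve `𝒞₂`. -/
def curve2 : Set UpperHalfPlane := tauLess '' Set.Ioi 0

/-- The curve `𝒞₃`. -/
def curve3 : Set UpperHalfPlane := tauGreater '' Set.Iio 1

/-- `𝒞_< = 𝒞₂ ∩ F`. -/
def curveLess : Set UpperHalfPlane := curve2 ∩ F

/-- `𝒞_> = 𝒞₃ ∩ F`. -/
def curveGreater : Set UpperHalfPlane := curve3 ∩ F

/-! ### The differential equation `y'' = I(z; τ) y` -/

/-- The values `℘(q₁) = √(g₂/12)` and `℘(q₂) = -√(g₂/12)`. -/
def qValue (τ : UpperHalfPlane) : Fin 2 → ℂ :=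
  ![(g2 τ / 12) ^ (1 / 2 : ℂ), -(g2 τ / 12) ^ (1 / 2 : ℂ)]

/-- The points `q₁, q₂`, each one well defined up to sign and modulo `Λ_τ`. -/
def q (τ : UpperHalfPlane) (j : Fin 2) : ℂ :=
  Classical.epsilon fun z => z ∉ (periods τ).lattice ∧ wp τ z = qValue τ j

/-- The coefficient `I(z; τ)`. -/
def coeffI (τ : UpperHalfPlane) (z : ℂ) : ℂ :=
  12 * wp τ z + 2 * ∑ j, (wp τ (z - q τ j) + wp τ (z + q τ j))
    + ∑ j, wpDeriv τ (q τ j) ^ 2 / (wp τ (q τ j) * (wp τ z - wp τ (q τ j)))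

/-- The singular points `0, ±q₁, ±q₂` modulo `Λ_τ` of the differential equation. -/
def singular (τ : UpperHalfPlane) : Set ℂ :=
  {z | z ∈ (periods τ).lattice ∨
    ∃ j, z - q τ j ∈ (periods τ).lattice ∨ z + q τ j ∈ (periods τ).lattice}

/-- `y` is a holomorphic solution of `y'' = I(z; τ) y` in a neighbourhood of `b`. -/
def IsSolutionAt (τ : UpperHalfPlane) (b : ℂ) (y : ℂ → ℂ) : Prop :=
  AnalyticAt ℂ y b ∧ ∀ᶠ z in 𝓝 b, deriv (deriv y) z = coeffI τ z * y z

/-- `y 0, y 1` are linearly independent holomorphic solutions of `y'' = I(z; τ) y` near `b`. -/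
def IsFundamentalSystem (τ : UpperHalfPlane) (b : ℂ) (y : Fin 2 → ℂ → ℂ) : Prop :=
  (∀ i, IsSolutionAt τ b (y i)) ∧
    ∀ c : Fin 2 → ℂ, (∀ᶠ z in 𝓝 b, ∑ i, c i * y i z = 0) → c = 0

/-- `y₁ = 1 / ℘''`. -/
def y1 (τ : UpperHalfPlane) (z : ℂ) : ℂ := 1 / deriv (wpDeriv τ) z

/-- `χ = 18 ℘² ℘' + (1/2) g₂ ℘' + 2 g₂² z - 36 g₃ ζ`. -/
def chi (τ : UpperHalfPlane) (z : ℂ) : ℂ :=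
  18 * wp τ z ^ 2 * wpDeriv τ z + 1 / 2 * g2 τ * wpDeriv τ z + 2 * g2 τ ^ 2 * z
    - 36 * g3 τ * zeta τ z

/-- `y₂ = y₁ χ`. -/
def y2 (τ : UpperHalfPlane) (z : ℂ) : ℂ := y1 τ z * chi τ z

/-- The quasi-period `χ₁ = χ(z + 1) - χ(z) = 2 (g₂² - 18 η₁ g₃)`. -/
def chi1 (τ : UpperHalfPlane) : ℂ := 2 * (g2 τ ^ 2 - 18 * eta1 τ * g3 τ)

/-- The quasi-period `χ₂ = χ(z + τ) - χ(z) = 2 (g₂² τ - 18 η₂ g₃)`. -/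
def chi2 (τ : UpperHalfPlane) : ℂ := 2 * (g2 τ ^ 2 * τ - 18 * eta2 τ * g3 τ)

open Classical in
/-- The fundamental system `(χ₁ y₁, y₂)`, respectively `(χ₂ y₁, y₂)` if `χ₁ = 0`. -/
def fundSystem (τ : UpperHalfPlane) : Fin 2 → ℂ → ℂ :=
  ![fun z => (if chi1 τ = 0 then chi2 τ else chi1 τ) * y1 τ z, y2 τ]

/-! ### Monodromy -/

/-- The germ `g` at the end of the path `γ` is obtained from the germ `f` at its beginning by
analytic continuation along `γ`: there is a family of germs `Y t` at `γ t`, locally given by one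
and the same holomorphic function, that starts at `f` and ends at `g`. -/
def IsContinuation {a b : ℂ} (γ : Path a b) (f g : ℂ → ℂ) : Prop :=
  ∃ Y : unitInterval → ℂ → ℂ, Y 0 =ᶠ[𝓝 a] f ∧ Y 1 =ᶠ[𝓝 b] g ∧
    ∀ t, AnalyticAt ℂ (Y t) (γ t) ∧ ∀ᶠ s in 𝓝 t, Y s =ᶠ[𝓝 (γ s)] Y t

/-- `M` is the monodromy matrix, with respect to the system `y` of germs at `b`, of the loop in
`ℂ / Λ_τ` which is the image of the path `γ` from `b` to `b + ω`: the continuation of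
`(y 0, y 1)ᵀ` along `γ`, read off at `z + ω`, is `M (y 0, y 1)ᵀ`. -/
def IsMonodromyMatrix {b ω : ℂ} (γ : Path b (b + ω)) (y : Fin 2 → ℂ → ℂ)
    (M : Matrix (Fin 2) (Fin 2) ℂ) : Prop :=
  ∃ g : Fin 2 → ℂ → ℂ, (∀ i, IsContinuation γ (y i) (g i)) ∧
    ∀ᶠ z in 𝓝 b, ∀ i, g i (z + ω) = ∑ j, M i j * y j z

/-- `ρ : π₁(ℂ / Λ_τ) = Λ_τ → SL(2, ℂ)` is the monodromy representation of `y'' = I(z; τ) y` with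
respect to the fundamental system `y` at `b`: every loop in the torus `ℂ / Λ_τ` punctured at the
singular points, lifted to a path from `b` to `b + ω` in `ℂ`, has monodromy matrix `ρ ω`.
In particular loops around the singular points have trivial monodromy. -/
def IsMonodromyRep (τ : UpperHalfPlane) (b : ℂ) (y : Fin 2 → ℂ → ℂ)
    (ρ : Multiplicative (periods τ).lattice →* SL(2, ℂ)) : Prop :=
  IsFundamentalSystem τ b y ∧
    ∀ (ω : (periods τ).lattice) (γ : Path b (b + ω)), (∀ t, γ t ∉ singular τ) →
      IsMonodromyMatrix γ y (ρ (Multiplicative.ofAdd ω) : Matrix (Fin 2) (Fin 2) ℂ)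

/-- The period `1` as an element of `Λ_τ`. -/
def period1 (τ : UpperHalfPlane) : Multiplicative (periods τ).lattice :=
  Multiplicative.ofAdd ⟨(periods τ).ω₁, (periods τ).ω₁_mem_lattice⟩

/-- The period `τ` as an element of `Λ_τ`. -/
def period2 (τ : UpperHalfPlane) : Multiplicative (periods τ).lattice :=
  Multiplicative.ofAdd ⟨(periods τ).ω₂, (periods τ).ω₂_mem_lattice⟩

/-- The unipotent matrix with rows `(1, 0)` and `(x, 1)`. -/
def lower (x : ℂ) : SL(2, ℂ) := ⟨!![1, 0; x, 1], by simp [Matrix.det_fin_two]⟩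

/-- The normal form of the monodromy along the period `1`: `lower 1`, or the identity matrix if
`D = ∞`. -/
def normalForm1 : OnePoint ℂ → SL(2, ℂ)
  | none => 1
  | some _ => lower 1

/-- The normal form of the monodromy along the period `τ`: `lower D`, or `lower 1` if `D = ∞`. -/
def normalForm2 : OnePoint ℂ → SL(2, ℂ)
  | none => lower 1
  | some D => lower D

/-- `D ∈ ℂ ∪ {∞}` is the monodromy data of `y'' = I(z; τ) y`: in a suitable fundamental system, the
monodromy along the periods `1` and `τ` has the normal form given by `D`. -/
def IsMonodromyData (τ : UpperHalfPlane) (D : OnePoint ℂ) : Prop :=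
  ∃ b ∉ singular τ, ∃ y ρ, IsMonodromyRep τ b y ρ ∧
    ρ (period1 τ) = normalForm1 D ∧ ρ (period2 τ) = normalForm2 D

/-- `ℝ ∪ {∞}` as a subset of `ℂ ∪ {∞}`. -/
def realOrInfty : Set (OnePoint ℂ) :=
  {D | D = OnePoint.infty ∨ ∃ x : ℝ, D = ((x : ℂ) : OnePoint ℂ)}

/-- The set `L` of all `τ` in `F0` without `e^{πi/3}` with monodromy data in `ℝ ∪ {∞}`. -/
def setL : Set UpperHalfPlane :=
  {τ | τ ∈ F0Punctured ∧ ∃ D ∈ realOrInfty, IsMonodromyData τ D}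

/-- `-d / c` in `ℂ ∪ {∞}` for a matrix with lower row `(c, d)`. -/
def negDivLower (γ : SL(2, ℤ)) : OnePoint ℂ :=
  if γ 1 0 = 0 then OnePoint.infty else ((-(γ 1 1 : ℂ) / (γ 1 0 : ℂ) : ℂ) : OnePoint ℂ)

end

end E6Monodromy

open E6Monodromy

/-!
The theorem has two halves, joined by the function `φ`.

**Modular half.** The invariants are `g₂ = (4π⁴/3) E₄`, `g₃ = (8π⁶/27) E₆`, and summing the series
of `2 ζ(1/2)` row by row gives `η₁ = G₂ = (π²/3) E₂` (`eta1_eq_G2`); homogeneity and the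
transformation law of `G₂` then give Legendre's relation (`legendre_relation`). The Serre derivative
of `E₆` plus `E₄² / 2` is a cusp form of weight `8`, hence zero, which is Ramanujan's formula
`E₆' = πi (E₂ E₆ - E₄²)` (`E6Deriv_eq`). So, up to one common constant, `g₂² - 18 η₁ g₃` is `E₆'`
and `g₂² τ - 18 η₂ g₃` is `τ E₆' + 6 E₆`. Thus `φ = (τ E₆' + 6 E₆) / E₆'`, a function which is
equivariant under `SL(2, ℤ)` (`E6Deriv_smul`, `phiNum_smul`), and `f_C` vanishes exactly where
`τ E₆' + 6 E₆ = C E₆'`, that is, where `φ = C`. In particular `E₆'(γ τ) = 0` means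
`φ(τ) = γ⁻¹ ∞ = -d / c`.

It remains to locate the real values of `φ` on the fundamental domain `F` of `SL(2, ℤ)`. There `q`
is small, and `φ = τ + (i / 168π) (1 / q - 570 + P(q))` with explicit bounds for `P`. On the left
half of `F` this is real only in the strip `1/6 < Re τ < 1/3`, `Im τ > 0.94`
(`mem_strip_of_im_phiFun_eq_zero`), where `φ` is injective (`injOn_phiFun`) and has positive real
part. On the unit circle `|φ| = 1`, since there the reflection `τ ↦ 1 - τ̄` is the action of `γ₂`.
Outside the circle the set of real values is open, and closed up to the value `1`; as it contains a
number above `1` and omits `0`, the real values on the left half of `F` are those `C ≥ 1`, each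
taken once. The reflection gives the values `C ≤ 0` on the right half, and since the left half of
`F₀` is covered by `F` and `γ₁ F`, equivariance gives all values on `F₀`.

**Differential equation.** The points `q_j` are the zeros of `℘''`. Where `℘''(q) = 0`, Liouville's
theorem shows that `(℘(z - q) + ℘(z + q) - 2℘(q)) (℘(z) - ℘(q))² = ℘'(q)²`
(`weierstrassP_sub_add_weierstrassP_add_mul_sq`), so the coefficient `I` is a rational function of
`℘`, and it becomes a matter of algebra that `y₁ = 1 / ℘''` is a solution. Since `χ' = 7 ℘''²`, so
is `y₂ = y₁ χ`, with Wronskian `7`. These solutions are globally meromorphic, `y₁` is elliptic and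
`χ` is quasi-periodic; hence the monodromy is given by the lower triangular unipotent matrices with
entries the quasi-periods of `χ`, in the ratio `χ₂ / χ₁ = φ`. In any other fundamental system the
monodromy is conjugate to this one, and conjugation preserves the ratio, so the data is unique
(`isMonodromyData_iff`). Finally `g₂ ≠ 0` on `F₀` away from `e^{πi/3}`, because `E₄` is an injective
function of `q` for small `q`.
-/

namespace PeriodPair

open Filter Topology Complex

variable (L : PeriodPair)

/-! ### Liouville's theorem and the second derivative of `℘` -/

instance : Countable L.lattice := L.latticeEquivProd.toEquiv.countable_iff.mpr inferInstance

lemma countable_lattice : (L.lattice : Set ℂ).Countable :=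
  Set.countable_coe_iff.mp (inferInstanceAs (Countable L.lattice))

lemma isPreconnected_compl_lattice : IsPreconnected ((L.lattice : Set ℂ)ᶜ) :=
  (L.countable_lattice.isPathConnected_compl_of_one_lt_rank
    (by simp [Complex.rank_real_complex])).isConnected.isPreconnected

lemma isOpen_compl_lattice : IsOpen ((L.lattice : Set ℂ)ᶜ) := L.isClosed_lattice.isOpen_compl

/-- Liouville's theorem for elliptic functions: a `Λ`-periodic function all of whose singularities
are removable is constant. -/
theorem eventuallyEq_const_of_periodic (f : ℂ → ℂ)
    (hper : ∀ z, ∀ l ∈ L.lattice, f (z + l) = f z)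
    (hf : ∀ x, ∃ g, AnalyticAt ℂ g x ∧ f =ᶠ[𝓝[≠] x] g) :
    ∃ C, ∀ x, f =ᶠ[𝓝[≠] x] fun _ ↦ C := by
  choose g hg hfg using hf
  -- The values `g y y` of the extensions glue to one entire function.
  have hloc : ∀ x, (fun y ↦ g y y) =ᶠ[𝓝 x] g x := by
    intro x
    have h := eventually_eventually_nhdsWithin.mpr (hfg x)
    rw [eventually_nhdsWithin_iff] at h
    filter_upwards [h, (hg x).eventually_analyticAt] with y hy ha
    by_cases hyx : y = x
    · rw [hyx]
    have h1 := hy hyx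
    rw [isOpen_compl_singleton.nhdsWithin_eq hyx] at h1
    exact (((hg y).continuousAt.eventuallyEq_nhds_iff_eventuallyEq_nhdsNE ha.continuousAt).mp
      ((hfg y).symm.trans (h1.filter_mono nhdsWithin_le_nhds))).eq_of_nhds
  have hfF : ∀ x, f =ᶠ[𝓝[≠] x] fun y ↦ g y y := fun x ↦
    (hfg x).trans ((hloc x).filter_mono nhdsWithin_le_nhds).symm
  have hF : ∀ x, AnalyticAt ℂ (fun y ↦ g y y) x := fun x ↦ (hg x).congr (hloc x).symm
  have hFper : ∀ z l, l ∈ L.lattice → g (z + l) (z + l) = g z z := by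
    intro z l hl
    have h1 : AnalyticAt ℂ (fun y ↦ g (y + l) (y + l)) z :=
      (hF (z + l)).fun_comp (f := (· + l)) (by fun_prop)
    refine ((h1.continuousAt.eventuallyEq_nhds_iff_eventuallyEq_nhdsNE
      (hF z).continuousAt).mp ?_).eq_of_nhds
    have ht : Tendsto (· + l) (𝓝[≠] z) (𝓝[≠] (z + l)) := by
      refine tendsto_nhdsWithin_of_tendsto_nhds_of_eventually_within _ ?_ ?_
      · exact (Continuous.tendsto (by fun_prop) z).mono_left nhdsWithin_le_nhds
      · filter_upwards [self_mem_nhdsWithin] with y hy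
        simpa using hy
    filter_upwards [ht.eventually (hfF (z + l)), hfF z] with y h2 h3
    rw [← h2, ← h3, hper y l hl]
  have hd : Differentiable ℂ (fun y ↦ g y y) := fun x ↦ (hF x).differentiableAt
  refine ⟨g 0 0, fun x ↦ ?_⟩
  filter_upwards [hfF x] with y hy
  rw [hy]
  exact hd.apply_eq_apply_of_bounded (IsZLattice.isCompact_range_of_periodic L.lattice _
    hd.continuous fun z w hw ↦ hFper z w hw).isBounded y 0

/-- `℘` is not constant, as it has a pole at the origin. -/
lemma not_eqOn_const_weierstrassP (C : ℂ) : ¬ ∀ z ∉ L.lattice, ℘[L] z = C := by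
  intro h
  have h1 := L.order_weierstrassP 0 L.lattice.zero_mem
  have h2 : ℘[L] =ᶠ[𝓝[≠] 0] fun _ ↦ C := by
    filter_upwards [self_mem_nhdsWithin, mem_nhdsWithin_of_mem_nhds
      (L.compl_lattice_sdiff_singleton_mem_nhds 0)] with w hw hw'
    exact h w (by simp_all)
  rw [meromorphicOrderAt_congr h2, meromorphicOrderAt_const] at h1
  split_ifs at h1
  · exact WithTop.top_ne_coe h1
  · exact absurd (WithTop.coe_injective (h1 : ((0 : ℤ) : WithTop ℤ) = ((-2 : ℤ) : WithTop ℤ)))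
      (by norm_num)

/-- The zeros of `℘'` are isolated: otherwise `℘'` would vanish identically and `℘` would be
constant. -/
lemma eventually_derivWeierstrassP_ne_zero {z : ℂ} (hz : z ∉ L.lattice) :
    ∀ᶠ w in 𝓝[≠] z, ℘'[L] w ≠ 0 := by
  rcases (L.analyticOnNhd_derivWeierstrassP z hz).eventually_eq_zero_or_eventually_ne_zero
    with h | h
  · exfalso
    have h0 : Set.EqOn ℘'[L] 0 (L.lattice : Set ℂ)ᶜ :=
      L.analyticOnNhd_derivWeierstrassP.eqOn_zero_of_preconnected_of_eventuallyEq_zero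
        L.isPreconnected_compl_lattice hz h
    have hc := L.isOpen_compl_lattice.exists_is_const_of_deriv_eq_zero
      L.isPreconnected_compl_lattice L.differentiableOn_weierstrassP
      (by simpa using h0)
    obtain ⟨C, hC⟩ := hc
    exact L.not_eqOn_const_weierstrassP C fun w hw ↦ hC w hw
  · exact h

/-- `℘'' = 6 ℘² - g₂ / 2`. Differentiating the equation for `℘'²` gives this up to a factor `℘'`,
whose zeros are isolated. -/
theorem deriv_derivWeierstrassP {z : ℂ} (hz : z ∉ L.lattice) :
    deriv ℘'[L] z = 6 * ℘[L] z ^ 2 - L.g₂ / 2 := by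
  have hmem : ∀ᶠ w in 𝓝 z, w ∉ L.lattice := L.isOpen_compl_lattice.mem_nhds hz
  have hP : ∀ w ∉ L.lattice, HasDerivAt ℘[L] (℘'[L] w) w := fun w hw ↦ by
    rw [← L.deriv_weierstrassP]
    exact (L.analyticOnNhd_weierstrassP w hw).differentiableAt.hasDerivAt
  have hP' : ∀ w ∉ L.lattice, HasDerivAt ℘'[L] (deriv ℘'[L] w) w := fun w hw ↦
    (L.analyticOnNhd_derivWeierstrassP w hw).differentiableAt.hasDerivAt
  have h1 : ∀ w ∉ L.lattice, ℘'[L] w * (deriv ℘'[L] w - (6 * ℘[L] w ^ 2 - L.g₂ / 2)) = 0 := by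
    intro w hw
    have hl := (hP' w hw).pow 2
    have hr := ((((hP w hw).pow 3).const_mul 4).sub ((hP w hw).const_mul L.g₂)).sub_const L.g₃
    have he : (℘'[L] ^ 2) =ᶠ[𝓝 w]
        fun w ↦ 4 * (℘[L] ^ 3) w - L.g₂ * ℘[L] w - L.g₃ := by
      filter_upwards [L.isOpen_compl_lattice.mem_nhds hw] with u hu
      exact L.derivWeierstrassP_sq u hu
    have := hl.unique (hr.congr_of_eventuallyEq he)
    simp only [Nat.cast_ofNat, Nat.add_one_sub_one, pow_one] at this
    linear_combination this / 2
  have hA := L.analyticOnNhd_derivWeierstrassP z hz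
  have hB := L.analyticOnNhd_weierstrassP z hz
  have hl : AnalyticAt ℂ (deriv ℘'[L]) z := hA.deriv
  have hr : AnalyticAt ℂ (fun w ↦ 6 * ℘[L] w ^ 2 - L.g₂ / 2) z := by fun_prop
  refine ((hl.continuousAt.eventuallyEq_nhds_iff_eventuallyEq_nhdsNE hr.continuousAt).mp
    ?_).eq_of_nhds
  filter_upwards [L.eventually_derivWeierstrassP_ne_zero hz,
    hmem.filter_mono nhdsWithin_le_nhds] with w hw hw'
  have := (mul_eq_zero.mp (h1 w hw')).resolve_left hw
  linear_combination this

/-- `℘` takes every value: otherwise `1 / (℘ - c)` would be entire and periodic, hence constant. -/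
theorem exists_weierstrassP_eq (c : ℂ) : ∃ z, z ∉ L.lattice ∧ ℘[L] z = c := by
  by_contra! hne
  obtain ⟨C, hC⟩ := L.eventuallyEq_const_of_periodic (fun z ↦ (℘[L] z - c)⁻¹)
    (fun z l hl ↦ by simp only [L.weierstrassP_add_coe z ⟨l, hl⟩]) (by
      intro x
      by_cases hx : x ∈ L.lattice
      · have hE : AnalyticAt ℂ ℘[L - x] x := L.analyticAt_weierstrassPExcept x
        refine ⟨fun z ↦ (z - x) ^ 2 * (((z - x) ^ 2 * (℘[L - x] z - 1 / x ^ 2 - c) + 1)⁻¹), ?_, ?_⟩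
        · have h1 : AnalyticAt ℂ (fun z ↦ (z - x) ^ 2 * (℘[L - x] z - 1 / x ^ 2 - c) + 1) x := by
            fun_prop
          exact AnalyticAt.fun_mul (by fun_prop) (h1.inv (by simp))
        · filter_upwards [self_mem_nhdsWithin] with z hz
          have hz' : z - x ≠ 0 := sub_ne_zero.mpr hz
          rw [← L.weierstrassPExcept_add ⟨x, hx⟩ z]
          have : ℘[L - x] z + (1 / (z - x) ^ 2 - 1 / x ^ 2) - c =
            ((z - x) ^ 2 * (℘[L - x] z - 1 / x ^ 2 - c) + 1) / (z - x) ^ 2 := by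
            field_simp
            ring
          rw [this, inv_div, div_eq_mul_inv]
      · have := L.analyticOnNhd_weierstrassP x hx
        refine ⟨fun z ↦ (℘[L] z - c)⁻¹, ?_, EventuallyEq.rfl⟩
        exact AnalyticAt.fun_inv (by fun_prop) (sub_ne_zero.mpr (hne x hx)))
  refine L.not_eqOn_const_weierstrassP (c + C⁻¹) fun z hz ↦ ?_
  have h1 : ContinuousAt (fun z ↦ (℘[L] z - c)⁻¹) z := by
    have := (L.analyticOnNhd_weierstrassP z hz).continuousAt
    exact ContinuousAt.inv₀ (by fun_prop) (sub_ne_zero.mpr (hne z hz))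
  have h2 := ((h1.eventuallyEq_nhds_iff_eventuallyEq_nhdsNE continuousAt_const).mp
    (hC z)).eq_of_nhds
  rw [← h2, inv_inv]
  ring

/-! ### An addition formula at a zero of `℘''` -/

lemma hasDerivAt_weierstrassP {z : ℂ} (hz : z ∉ L.lattice) : HasDerivAt ℘[L] (℘'[L] z) z := by
  rw [← L.deriv_weierstrassP]
  exact (L.analyticOnNhd_weierstrassP z hz).differentiableAt.hasDerivAt

lemma hasDerivAt_derivWeierstrassP {z : ℂ} (hz : z ∉ L.lattice) :
    HasDerivAt ℘'[L] (6 * ℘[L] z ^ 2 - L.g₂ / 2) z := by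
  rw [← L.deriv_derivWeierstrassP hz]
  exact (L.analyticOnNhd_derivWeierstrassP z hz).differentiableAt.hasDerivAt

/-- If `℘''(q) = 0`, then `℘(z - q) + ℘(z + q) - 2℘(q)` has a zero of order at least four at the
origin, because it is even and its value and its second derivative vanish there. -/
lemma exists_weierstrassP_sub_add_eq_pow_four_mul {q : ℂ} (hq : q ∉ L.lattice)
    (hq'' : 6 * ℘[L] q ^ 2 = L.g₂ / 2) :
    ∃ h, AnalyticAt ℂ h 0 ∧
      ∀ᶠ z in 𝓝 0, ℘[L] (z - q) + ℘[L] (z + q) - 2 * ℘[L] q = z ^ 4 * h z := by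
  set f : ℂ → ℂ := fun z ↦ ℘[L] (z - q) + ℘[L] (z + q) - 2 * ℘[L] q with hf
  have hnq : -q ∉ L.lattice := by simpa using hq
  have hA : AnalyticAt ℂ f 0 := by
    have h1 : AnalyticAt ℂ (fun z ↦ ℘[L] (z - q)) 0 :=
      (L.analyticOnNhd_weierstrassP (0 - q) (by simpa using hq)).fun_comp (f := (· - q))
        (by fun_prop)
    have h2 : AnalyticAt ℂ (fun z ↦ ℘[L] (z + q)) 0 :=
      (L.analyticOnNhd_weierstrassP (0 + q) (by simpa using hq)).fun_comp (f := (· + q))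
        (by fun_prop)
    fun_prop
  have heven : ∀ z, f (-z) = f z := by
    intro z
    simp only [hf]
    rw [← L.weierstrassP_neg (-z - q), ← L.weierstrassP_neg (-z + q)]
    ring_nf
  have h0 : f 0 = 0 := by
    simp only [hf, zero_sub, zero_add, L.weierstrassP_neg]
    ring
  have h2 : iteratedDeriv 2 f 0 = 0 := by
    have hmem1 : ∀ᶠ z in 𝓝 (0 : ℂ), z - q ∉ L.lattice :=
      (Continuous.continuousAt (f := fun z : ℂ ↦ z - q) (by fun_prop)).eventually_mem
        (L.isOpen_compl_lattice.mem_nhds (by simpa using hq))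
    have hmem2 : ∀ᶠ z in 𝓝 (0 : ℂ), z + q ∉ L.lattice :=
      (Continuous.continuousAt (f := fun z : ℂ ↦ z + q) (by fun_prop)).eventually_mem
        (L.isOpen_compl_lattice.mem_nhds (by simpa using hq))
    have h1 : deriv f =ᶠ[𝓝 0] fun z ↦ ℘'[L] (z - q) + ℘'[L] (z + q) := by
      filter_upwards [hmem1, hmem2] with z hz1 hz2
      exact ((((L.hasDerivAt_weierstrassP hz1).comp_sub_const z q).add
        ((L.hasDerivAt_weierstrassP hz2).comp_add_const z q)).sub_const _).deriv
    rw [iteratedDeriv_succ, iteratedDeriv_one, h1.deriv_eq]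
    have h3 := ((L.hasDerivAt_derivWeierstrassP hmem1.self_of_nhds).comp_sub_const 0 q).add
        ((L.hasDerivAt_derivWeierstrassP hmem2.self_of_nhds).comp_add_const 0 q)
    refine h3.deriv.trans ?_
    simp only [zero_sub, zero_add, L.weierstrassP_neg]
    linear_combination 2 * hq''
  have hord : ((4 : ℕ) : ℕ∞) ≤ analyticOrderAt f 0 := by
    rw [natCast_le_analyticOrderAt_iff_iteratedDeriv_eq_zero hA]
    intro i hi
    have hodd : ∀ j, Odd j → iteratedDeriv j f 0 = 0 := by
      intro j hj
      have := iteratedDeriv_comp_neg j f 0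
      rw [show (fun x ↦ f (-x)) = f from funext heven] at this
      simpa [← CharZero.eq_neg_self_iff, hj] using this
    interval_cases i
    · simpa using h0
    · exact hodd 1 (by decide)
    · exact h2
    · exact hodd 3 (by decide)
  obtain ⟨h, hh, hfh⟩ := (natCast_le_analyticOrderAt hA).mp hord
  exact ⟨h, hh, by simpa [hf] using hfh⟩

/-- At a point `q` of order two modulo the lattice, the odd function `℘'` vanishes. -/
lemma two_mul_notMem_lattice {q : ℂ} (hq' : ℘'[L] q ≠ 0) : 2 * q ∉ L.lattice := by
  intro h
  have := L.derivWeierstrassP_add_coe (-q) ⟨2 * q, h⟩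
  rw [L.derivWeierstrassP_neg, show -q + 2 * q = q by ring, eq_neg_iff_add_eq_zero,
    ← two_mul] at this
  exact hq' (by simpa using this)

/-- If `℘''(q) = 0` and `℘'(q) ≠ 0`, then the double poles of `℘(z - q) + ℘(z + q)` match the double
zeros of `(℘(z) - ℘(q))²`, and the zero of order four of `℘(z - q) + ℘(z + q) - 2℘(q)` at the
origin matches the pole of `(℘(z) - ℘(q))²`. Hence the product is constant. -/
theorem weierstrassP_sub_add_weierstrassP_add_mul_sq {q : ℂ} (hq : q ∉ L.lattice)
    (hq'' : 6 * ℘[L] q ^ 2 = L.g₂ / 2) (hq' : ℘'[L] q ≠ 0) {z : ℂ} (hz : z ∉ L.lattice)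
    (hz₁ : z - q ∉ L.lattice) (hz₂ : z + q ∉ L.lattice) :
    (℘[L] (z - q) + ℘[L] (z + q) - 2 * ℘[L] q) * (℘[L] z - ℘[L] q) ^ 2 = ℘'[L] q ^ 2 := by
  have h2q := L.two_mul_notMem_lattice hq'
  set f : ℂ → ℂ := fun z ↦
    (℘[L] (z - q) + ℘[L] (z + q) - 2 * ℘[L] q) * (℘[L] z - ℘[L] q) ^ 2 with hf
  have hper : ∀ z, ∀ l ∈ L.lattice, f (z + l) = f z := by
    intro z l hl
    simp only [hf, add_sub_right_comm z l q, add_right_comm z l q,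
      L.weierstrassP_add_coe _ ⟨l, hl⟩]
  have heven : ∀ z, f (-z) = f z := by
    intro z
    simp only [hf, L.weierstrassP_neg z]
    rw [← L.weierstrassP_neg (-z - q), ← L.weierstrassP_neg (-z + q)]
    ring_nf
  -- The condition of removability is invariant under translation by periods.
  have htrans : ∀ x, ∀ l ∈ L.lattice, (∃ g, AnalyticAt ℂ g x ∧ f =ᶠ[𝓝[≠] x] g) →
      ∃ g, AnalyticAt ℂ g (x + l) ∧ f =ᶠ[𝓝[≠] (x + l)] g := by
    rintro x l hl ⟨g, hg, hfg⟩
    have hsub : x + l - l = x := by ring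
    refine ⟨fun z ↦ g (z - l), ?_, ?_⟩
    · rw [← hsub] at hg
      exact hg.fun_comp (f := (· - l)) (by fun_prop)
    · have ht : Tendsto (· - l) (𝓝[≠] (x + l)) (𝓝[≠] x) := by
        refine tendsto_nhdsWithin_of_tendsto_nhds_of_eventually_within _ ?_ ?_
        · have h := (show Continuous (fun y : ℂ ↦ y - l) by fun_prop).tendsto (x + l)
          simp only [hsub] at h
          exact h.mono_left nhdsWithin_le_nhds
        · filter_upwards [self_mem_nhdsWithin] with y hy
          simpa [sub_eq_iff_eq_add] using hy
      filter_upwards [ht.eventually hfg] with y hy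
      rw [← hy, ← hper (y - l) l hl, sub_add_cancel]
  have hA : ∀ x, x ∉ L.lattice → x - q ∉ L.lattice → x + q ∉ L.lattice → AnalyticAt ℂ f x := by
    intro x h1 h2 h3
    have e1 : AnalyticAt ℂ (fun z ↦ ℘[L] (z - q)) x :=
      (L.analyticOnNhd_weierstrassP (x - q) h2).fun_comp (f := (· - q)) (by fun_prop)
    have e2 : AnalyticAt ℂ (fun z ↦ ℘[L] (z + q)) x :=
      (L.analyticOnNhd_weierstrassP (x + q) h3).fun_comp (f := (· + q)) (by fun_prop)
    have e3 := L.analyticOnNhd_weierstrassP x h1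
    fun_prop
  have hzero : ∃ g, AnalyticAt ℂ g 0 ∧ f =ᶠ[𝓝[≠] 0] g := by
    obtain ⟨h, hh, he⟩ := L.exists_weierstrassP_sub_add_eq_pow_four_mul hq hq''
    have hE : AnalyticAt ℂ ℘[L - (0 : ℂ)] 0 := L.analyticAt_weierstrassPExcept 0
    refine ⟨fun z ↦ h z * (z ^ 2 * ℘[L - (0 : ℂ)] z + 1 - z ^ 2 * ℘[L] q) ^ 2, by fun_prop, ?_⟩
    filter_upwards [he.filter_mono nhdsWithin_le_nhds, self_mem_nhdsWithin] with z h1 h2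
    have h2 : z ≠ 0 := h2
    simp only [hf, h1]
    rw [← L.weierstrassPExcept_add 0 z]
    simp only [ZeroMemClass.coe_zero, sub_zero]
    field_simp
    ring
  -- The removable singularity at `q` also determines the constant: there the value is `℘'(q)²`.
  have hnear : ∃ g, AnalyticAt ℂ g q ∧ f =ᶠ[𝓝[≠] q] g ∧ g q = ℘'[L] q ^ 2 := by
    obtain ⟨p, hp⟩ := L.analyticOnNhd_weierstrassP q hq
    have hk : AnalyticAt ℂ (dslope ℘[L] q) q := ⟨_, hp.has_fpower_series_dslope_fslope⟩
    have hkq : dslope ℘[L] q q = ℘'[L] q := by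
      rw [dslope_same, (L.hasDerivAt_weierstrassP hq).deriv]
    have hE : AnalyticAt ℂ (fun z ↦ ℘[L - (0 : ℂ)] (z - q)) q := by
      have := L.analyticAt_weierstrassPExcept 0
      rw [← sub_self q] at this
      exact AnalyticAt.fun_comp (f := (· - q)) (by simpa using this) (by fun_prop)
    have hQ : AnalyticAt ℂ (fun z ↦ ℘[L] (z + q)) q :=
      (L.analyticOnNhd_weierstrassP (q + q) (by simpa [two_mul] using h2q)).fun_comp
        (f := (· + q)) (by fun_prop)
    refine ⟨fun z ↦ ((z - q) ^ 2 * (℘[L - (0 : ℂ)] (z - q) + ℘[L] (z + q) - 2 * ℘[L] q) + 1) *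
      dslope ℘[L] q z ^ 2, by fun_prop, ?_, by simp⟩
    filter_upwards [self_mem_nhdsWithin] with z hz
    have hz' : z - q ≠ 0 := sub_ne_zero.mpr hz
    have h1 : ℘[L] z - ℘[L] q = (z - q) * dslope ℘[L] q z := by
      simpa using (sub_smul_dslope ℘[L] q z).symm
    simp only [hf, h1]
    rw [← L.weierstrassPExcept_add 0 (z - q)]
    simp only [ZeroMemClass.coe_zero, sub_zero]
    field_simp
    ring
  have hq_rem : ∃ g, AnalyticAt ℂ g q ∧ f =ᶠ[𝓝[≠] q] g := by
    obtain ⟨g, h1, h2, -⟩ := hnear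
    exact ⟨g, h1, h2⟩
  have hnq_rem : ∃ g, AnalyticAt ℂ g (-q) ∧ f =ᶠ[𝓝[≠] (-q)] g := by
    obtain ⟨g, hg, hfg⟩ := hq_rem
    refine ⟨fun z ↦ g (-z), ?_, ?_⟩
    · rw [← neg_neg q] at hg
      exact hg.fun_comp (f := (- ·)) (by fun_prop)
    · have ht : Tendsto (- ·) (𝓝[≠] (-q)) (𝓝[≠] q) := by
        refine tendsto_nhdsWithin_of_tendsto_nhds_of_eventually_within _ ?_ ?_
        · have h := (show Continuous (fun y : ℂ ↦ -y) by fun_prop).tendsto (-q)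
          simp only [neg_neg] at h
          exact h.mono_left nhdsWithin_le_nhds
        · filter_upwards [self_mem_nhdsWithin] with y hy
          simpa [neg_eq_iff_eq_neg] using hy
      filter_upwards [ht.eventually hfg] with y hy
      rw [← hy, heven]
  obtain ⟨C, hC⟩ := L.eventuallyEq_const_of_periodic f hper (by
    intro x
    by_cases h1 : x ∈ L.lattice
    · simpa using htrans 0 x h1 hzero
    by_cases h2 : x - q ∈ L.lattice
    · simpa using htrans q _ h2 hq_rem
    by_cases h3 : x + q ∈ L.lattice
    · simpa using htrans (-q) _ h3 hnq_rem
    exact ⟨f, hA x h1 h2 h3, EventuallyEq.rfl⟩)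
  have hCval : ∀ x g, AnalyticAt ℂ g x → f =ᶠ[𝓝[≠] x] g → g x = C := fun x g hg hfg ↦
    ((hg.continuousAt.eventuallyEq_nhds_iff_eventuallyEq_nhdsNE continuousAt_const).mp
      (hfg.symm.trans (hC x))).eq_of_nhds
  obtain ⟨g, hg, hfg, hgq⟩ := hnear
  rw [← hgq, hCval q g hg hfg]
  exact hCval z f (hA z hz hz₁ hz₂) EventuallyEq.rfl

/-! ### The Weierstrass zeta function -/

/-- The Weierstrass zeta function `ζ(z) = 1/z + ∑_{ω ≠ 0} (1/(z - ω) + 1/ω + z/ω²)`; by `1 / 0 = 0`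
the summand at `ω = 0` is the leading term. -/
noncomputable def weierstrassZeta (z : ℂ) : ℂ :=
  ∑' l : L.lattice, (1 / (z - l) + 1 / (l : ℂ) + z / (l : ℂ) ^ 2)

/-- The Weierstrass zeta function with the `l₀`-term missing. -/
noncomputable def weierstrassZetaExcept (l₀ z : ℂ) : ℂ :=
  ∑' l : L.lattice, if l.1 = l₀ then 0 else (1 / (z - l) + 1 / (l : ℂ) + z / (l : ℂ) ^ 2)

lemma weierstrassZeta_bound {r : ℝ} {s : ℂ} (hs : ‖s‖ < r) {l : ℂ}
    (h : 2 * r ≤ ‖l‖) : ‖1 / (s - l) + 1 / l + s / l ^ 2‖ ≤ 2 * r ^ 2 * ‖l‖ ^ (-3 : ℝ) := by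
  have hs0 := norm_nonneg s
  have hl : l ≠ 0 := by rintro rfl; simp at h; linarith
  have hl' : 0 < ‖l‖ := norm_pos_iff.mpr hl
  have hsl : s - l ≠ 0 := by
    intro h0
    rw [sub_eq_zero.mp h0] at hs
    linarith
  have h1 : 1 / (s - l) + 1 / l + s / l ^ 2 = s ^ 2 / (l ^ 2 * (s - l)) := by
    field_simp
    ring
  have h2 : ‖l‖ / 2 ≤ ‖s - l‖ := by
    have := norm_sub_norm_le l s
    rw [norm_sub_rev] at this
    linarith
  rw [h1, norm_div, norm_mul, norm_pow, norm_pow]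
  calc ‖s‖ ^ 2 / (‖l‖ ^ 2 * ‖s - l‖) ≤ r ^ 2 / (‖l‖ ^ 2 * (‖l‖ / 2)) := by gcongr
    _ = 2 * r ^ 2 / ‖l‖ ^ 3 := by field_simp
    _ = _ := by norm_cast

lemma hasSumLocallyUniformly_weierstrassZetaExcept (l₀ : ℂ) :
    HasSumLocallyUniformly (fun (l : L.lattice) (z : ℂ) ↦
      if l.1 = l₀ then 0 else (1 / (z - l) + 1 / (l : ℂ) + z / (l : ℂ) ^ 2))
      (L.weierstrassZetaExcept l₀) := by
  refine L.hasSumLocallyUniformly_aux (u := (2 * · ^ 2 * ‖·‖ ^ (-3 : ℝ))) _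
    (fun _ _ ↦ (ZLattice.summable_norm_rpow _ _ (by simp; norm_num)).mul_left _) fun r hr ↦
    Filter.eventually_atTop.mpr ⟨2 * r, ?_⟩
  rintro _ h s hs l rfl
  split_ifs
  · simpa using! show 0 ≤ 2 * r ^ 2 * (‖↑l‖ ^ 3)⁻¹ by positivity
  · exact weierstrassZeta_bound hs h

lemma differentiableOn_zetaSummand (l₀ : ℂ) (l : L.lattice) :
    DifferentiableOn ℂ (fun z ↦ if l.1 = l₀ then 0 else
      (1 / (z - l) + 1 / (l : ℂ) + z / (l : ℂ) ^ 2)) (L.lattice \ {l₀})ᶜ := by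
  split_ifs with h
  · simp
  · intro z hz
    have hzl : z - l ≠ 0 := by
      rw [sub_ne_zero]
      rintro rfl
      exact hz ⟨l.2, h⟩
    have h1 : DifferentiableAt ℂ (fun z ↦ 1 / (z - l) + 1 / (l : ℂ) + z / (l : ℂ) ^ 2) z :=
      DifferentiableAt.fun_add (DifferentiableAt.fun_add
        (DifferentiableAt.fun_div (by fun_prop) (by fun_prop) hzl) (by fun_prop)) (by fun_prop)
    exact h1.differentiableWithinAt

lemma differentiableOn_weierstrassZetaExcept (l₀ : ℂ) :
    DifferentiableOn ℂ (L.weierstrassZetaExcept l₀) (L.lattice \ {l₀})ᶜ :=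
  (L.hasSumLocallyUniformly_weierstrassZetaExcept l₀).hasSumLocallyUniformlyOn.differentiableOn
    (.of_forall fun _ ↦ .fun_sum fun i _ ↦ L.differentiableOn_zetaSummand l₀ i)
    L.isOpen_compl_lattice_sdiff

lemma weierstrassZetaExcept_of_notMem {l₀ : ℂ} (hl : l₀ ∉ L.lattice) :
    L.weierstrassZetaExcept l₀ = L.weierstrassZeta := by
  ext z
  refine tsum_congr fun l ↦ if_neg ?_
  rintro rfl
  exact hl l.2

lemma hasSum_weierstrassZeta (z : ℂ) :
    HasSum (fun l : L.lattice ↦ 1 / (z - l) + 1 / (l : ℂ) + z / (l : ℂ) ^ 2)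
      (L.weierstrassZeta z) := by
  have h := (L.hasSumLocallyUniformly_weierstrassZetaExcept (L.ω₁ / 2)).hasSum (x := z)
  rw [L.weierstrassZetaExcept_of_notMem L.ω₁_div_two_notMem_lattice] at h
  convert! h using 2 with l
  rw [if_neg]
  intro h
  exact L.ω₁_div_two_notMem_lattice (h ▸ l.2)

lemma differentiableOn_weierstrassZeta :
    DifferentiableOn ℂ L.weierstrassZeta (L.lattice : Set ℂ)ᶜ := by
  have h := L.differentiableOn_weierstrassZetaExcept (L.ω₁ / 2)
  rw [L.weierstrassZetaExcept_of_notMem L.ω₁_div_two_notMem_lattice] at h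
  exact h.mono (Set.compl_subset_compl.mpr Set.sdiff_subset)

lemma analyticAt_weierstrassZeta {z : ℂ} (hz : z ∉ L.lattice) :
    AnalyticAt ℂ L.weierstrassZeta z :=
  L.differentiableOn_weierstrassZeta.analyticOnNhd L.isOpen_compl_lattice z hz

/-- `ζ' = -℘`. -/
theorem hasDerivAt_weierstrassZeta {z : ℂ} (hz : z ∉ L.lattice) :
    HasDerivAt L.weierstrassZeta (-℘[L] z) z := by
  have h0 : (L.ω₁ / 2) ∉ L.lattice := L.ω₁_div_two_notMem_lattice
  have h := (L.hasSumLocallyUniformly_weierstrassZetaExcept (L.ω₁ / 2))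
  have h1 := (h.tendstoLocallyUniformlyOn (s := (L.lattice \ {L.ω₁ / 2})ᶜ)).deriv
    (.of_forall fun _ ↦ .fun_sum fun i _ ↦ L.differentiableOn_zetaSummand (L.ω₁ / 2) i)
    L.isOpen_compl_lattice_sdiff
  rw [L.weierstrassZetaExcept_of_notMem h0] at h1
  have hz' : z ∈ (L.lattice \ {L.ω₁ / 2} : Set ℂ)ᶜ := fun h ↦ hz h.1
  have h2 := h1.tendsto_at hz'
  have h3 := (L.hasSum_weierstrassP z).neg
  have h5 : ∀ s : Finset L.lattice, deriv (fun z ↦ ∑ l ∈ s, if l.1 = L.ω₁ / 2 then 0 else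
      (1 / (z - l) + 1 / (l : ℂ) + z / (l : ℂ) ^ 2)) z =
      ∑ l ∈ s, -(1 / (z - l) ^ 2 - 1 / (l : ℂ) ^ 2) := by
    intro s
    refine HasDerivAt.deriv (HasDerivAt.fun_sum fun l _ ↦ ?_)
    have hl : l.1 ≠ L.ω₁ / 2 := fun h ↦ h0 (h ▸ l.2)
    simp only [hl, if_false]
    have hzl : z - l ≠ 0 := by
      rw [sub_ne_zero]
      rintro rfl
      exact hz l.2
    have := (((((hasDerivAt_id z).sub_const (l : ℂ)).inv hzl).add_const (1 / (l : ℂ))).add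
      ((hasDerivAt_id z).div_const ((l : ℂ) ^ 2)))
    refine (this.congr_of_eventuallyEq (.of_forall fun w ↦ ?_)).congr_deriv ?_
    · simp
    · simp only [id]
      ring
  have h6 : deriv L.weierstrassZeta z = -℘[L] z := by
    refine tendsto_nhds_unique (h2.congr fun s ↦ ?_) h3
    exact h5 s
  rw [← h6]
  exact (L.analyticAt_weierstrassZeta hz).differentiableAt.hasDerivAt

lemma weierstrassZeta_neg (z : ℂ) : L.weierstrassZeta (-z) = -L.weierstrassZeta z := by
  simp only [weierstrassZeta]
  rw [← (Equiv.neg L.lattice).tsum_eq, ← tsum_neg]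
  refine tsum_congr fun l ↦ ?_
  simp only [Equiv.neg_apply, NegMemClass.coe_neg]
  rw [show -z - -(l : ℂ) = -(z - l) by ring, one_div, one_div, one_div, one_div, inv_neg, inv_neg]
  ring

@[fun_prop]
lemma meromorphic_weierstrassZeta : Meromorphic L.weierstrassZeta := by
  intro x
  by_cases hx : x ∈ L.lattice
  · have h : AnalyticAt ℂ (L.weierstrassZetaExcept x) x :=
      (L.differentiableOn_weierstrassZetaExcept x).analyticOnNhd L.isOpen_compl_lattice_sdiff x
        (by simp)
    have he : L.weierstrassZeta =
        fun z ↦ L.weierstrassZetaExcept x z + (1 / (z - x) + 1 / x + z / x ^ 2) := by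
      ext z
      have h1 := ((L.hasSumLocallyUniformly_weierstrassZetaExcept x).hasSum (x := z)).add
        (hasSum_ite_eq (⟨x, hx⟩ : L.lattice) (1 / (z - x) + 1 / x + z / x ^ 2))
      refine (L.hasSum_weierstrassZeta z).unique ?_
      convert! h1 using 2 with l
      by_cases hl : l = ⟨x, hx⟩
      · subst hl
        simp
      · have : l.1 ≠ x := fun h ↦ hl (Subtype.ext h)
        simp [hl, this]
    rw [he]
    have := h.meromorphicAt
    fun_prop
  · exact (L.analyticAt_weierstrassZeta hx).meromorphicAt

/-- `ζ` is quasi-periodic. -/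
theorem exists_weierstrassZeta_add (l : L.lattice) :
    ∃ c, ∀ z ∉ L.lattice, L.weierstrassZeta (z + l) = L.weierstrassZeta z + c := by
  have hmem : ∀ z, z ∉ L.lattice → z + l ∉ L.lattice := fun z hz h ↦
    hz (by simpa using L.lattice.sub_mem h l.2)
  have hd : ∀ z ∉ L.lattice,
      HasDerivAt (fun z ↦ L.weierstrassZeta (z + l) - L.weierstrassZeta z) 0 z := fun z hz ↦ by
    refine (((L.hasDerivAt_weierstrassZeta (hmem z hz)).comp_add_const z l).sub
      (L.hasDerivAt_weierstrassZeta hz)).congr_deriv ?_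
    rw [L.weierstrassP_add_coe]
    ring
  obtain ⟨c, hc⟩ := L.isOpen_compl_lattice.exists_is_const_of_deriv_eq_zero
    L.isPreconnected_compl_lattice
    (fun z hz ↦ (hd z hz).differentiableAt.differentiableWithinAt)
    (fun z hz ↦ (hd z hz).deriv)
  exact ⟨c, fun z hz ↦ by linear_combination hc z hz⟩

/-- The quasi-period `ζ(z + ω) - ζ(z)` is `2 ζ(ω / 2)`, as one sees at `z = -ω / 2` since `ζ` is
odd. -/
lemma weierstrassZeta_add_of_half {ω : ℂ} (hω : ω ∈ L.lattice) (hω' : ω / 2 ∉ L.lattice) {z : ℂ}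
    (hz : z ∉ L.lattice) :
    L.weierstrassZeta (z + ω) = L.weierstrassZeta z + 2 * L.weierstrassZeta (ω / 2) := by
  obtain ⟨c, hc⟩ := L.exists_weierstrassZeta_add ⟨ω, hω⟩
  have h := hc (-(ω / 2)) (by simpa using hω')
  rw [show -(ω / 2) + ω = ω / 2 by ring, L.weierstrassZeta_neg] at h
  rw [hc z hz]
  linear_combination -h

end PeriodPair

namespace E6Monodromy

open Filter Topology

/-! ### Invariants and quasi-periods as Eisenstein series -/

section

open EisensteinSeries ModularForm

/-- A summable series of differences over `ℤ` has sum zero if the terms tend to zero at both ends.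
-/
lemma hasSum_int_telescope {a : ℤ → ℂ} (ha : Summable fun n ↦ a (n + 1) - a n)
    (htop : Tendsto (fun n : ℕ ↦ a n) atTop (𝓝 0))
    (hbot : Tendsto (fun n : ℕ ↦ a (-n)) atTop (𝓝 0)) :
    HasSum (fun n ↦ a (n + 1) - a n) 0 := by
  have h1 : HasSum (fun n : ℕ ↦ a ((n : ℤ) + 1) - a (n : ℤ)) (-a 0) := by
    have hs : Summable fun n : ℕ ↦ a ((n : ℤ) + 1) - a (n : ℤ) :=
      ha.comp_injective Nat.cast_injective
    rw [hs.hasSum_iff_tendsto_nat]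
    have : ∀ N, ∑ n ∈ Finset.range N, (a ((n : ℤ) + 1) - a (n : ℤ)) = a N - a 0 := fun N ↦ by
      simpa using Finset.sum_range_sub (fun n : ℕ ↦ a n) N
    simp only [this]
    simpa using htop.sub_const (a 0)
  have h2 : HasSum (fun n : ℕ ↦ a (-((n : ℤ) + 1) + 1) - a (-((n : ℤ) + 1))) (a 0) := by
    have hinj : Function.Injective fun n : ℕ ↦ -((n : ℤ) + 1) := fun m n h ↦ by
      simpa using h
    have hs : Summable fun n : ℕ ↦ a (-((n : ℤ) + 1) + 1) - a (-((n : ℤ) + 1)) :=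
      ha.comp_injective hinj
    rw [hs.hasSum_iff_tendsto_nat]
    have : ∀ N, ∑ n ∈ Finset.range N, (a (-((n : ℤ) + 1) + 1) - a (-((n : ℤ) + 1))) =
        a 0 - a (-(N : ℤ)) := fun N ↦ by
      have := Finset.sum_range_sub' (fun n : ℕ ↦ a (-(n : ℤ))) N
      simpa [add_comm] using this
    simp only [this]
    simpa using hbot.const_sub (a 0)
  simpa using HasSum.of_nat_of_neg_add_one (f := fun n ↦ a (n + 1) - a n) h1 h2

lemma hasSum_int_prod_of_lattice {τ : UpperHalfPlane} {f : ℂ → ℂ} {a : ℂ}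
    (h : HasSum (fun l : (periods τ).lattice ↦ f l) a) :
    HasSum (fun p : ℤ × ℤ ↦ f (p.1 * τ + p.2)) a := by
  have h1 := ((periods τ).latticeEquivProd.symm.toEquiv.hasSum_iff).mpr h
  have h2 := ((Equiv.prodComm ℤ ℤ).hasSum_iff).mpr h1
  convert! h2 using 2 with p
  have := (periods τ).latticeEquiv_symm_apply (p.2, p.1)
  simp only [periods, mul_one] at this
  simp only [Function.comp_apply, Equiv.prodComm_apply, Prod.swap]
  rw [add_comm]
  exact congrArg f this.symm

lemma G_eq_tsum_eisSummand (τ : UpperHalfPlane) {k : ℕ} (hk : 3 ≤ k) :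
    (periods τ).G k = ∑' v : Fin 2 → ℤ, eisSummand k v τ := by
  have h1 : HasSum (fun l : (periods τ).lattice ↦ ((l : ℂ) ^ k)⁻¹) ((periods τ).G k) := by
    simpa using (periods τ).hasSum_sumInvPow 0 (r := k) (by lia)
  have h2 := (finTwoArrowEquiv ℤ).hasSum_iff.mpr
    (hasSum_int_prod_of_lattice (f := fun z ↦ (z ^ k)⁻¹) h1)
  rw [← h2.tsum_eq]
  refine tsum_congr fun v ↦ ?_
  simp [eisSummand]

lemma riemannZeta_six : riemannZeta 6 = Real.pi ^ 6 / 945 := by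
  have h := riemannZeta_two_mul_nat (k := 3) (by norm_num)
  rw [show bernoulli (2 * 3) = 1 / 42 by decide +kernel] at h
  norm_num [Nat.factorial] at h
  rw [h]
  ring

lemma g2_eq (τ : UpperHalfPlane) : g2 τ = 4 * Real.pi ^ 4 / 3 * E₄ τ := by
  have h := tsum_eisSummand_eq_riemannZeta_mul_eisensteinSeries (k := 4) (by norm_num) τ
  have hE : E₄ τ = (1 / 2 : ℂ) * eisensteinSeries (N := 1) 0 4 τ := rfl
  rw [g2, PeriodPair.g₂, G_eq_tsum_eisSummand τ (by norm_num), h, hE]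
  norm_num [riemannZeta_four]
  ring

lemma g3_eq (τ : UpperHalfPlane) : g3 τ = 8 * Real.pi ^ 6 / 27 * E₆ τ := by
  have h := tsum_eisSummand_eq_riemannZeta_mul_eisensteinSeries (k := 6) (by norm_num) τ
  have hE : E₆ τ = (1 / 2 : ℂ) * eisensteinSeries (N := 1) 0 6 τ := rfl
  rw [g3, PeriodPair.g₃, G_eq_tsum_eisSummand τ (by norm_num), h, hE]
  norm_num [riemannZeta_six]
  ring

/-- The half-period value `2 ζ(ω/2)` as a sum over the lattice, symmetrized under `l ↦ -l`. -/
lemma hasSum_two_mul_zeta_half (τ : UpperHalfPlane) (ω : ℂ) :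
    HasSum (fun p : ℤ × ℤ ↦ 1 / (ω / 2 + (p.1 * τ + p.2)) + 1 / (ω / 2 - (p.1 * τ + p.2)) +
      ω / (p.1 * τ + p.2 : ℂ) ^ 2) (2 * zeta τ (ω / 2)) := by
  have h1 := (periods τ).hasSum_weierstrassZeta (ω / 2)
  have h2 := ((Equiv.neg (periods τ).lattice).hasSum_iff).mpr h1
  have h3 := h1.add h2
  rw [← two_mul] at h3
  refine hasSum_int_prod_of_lattice (f := fun w ↦ 1 / (ω / 2 + w) + 1 / (ω / 2 - w) + ω / w ^ 2) ?_
  convert! h3 using 2 with l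
  simp only [Function.comp_apply, Equiv.neg_apply, NegMemClass.coe_neg, sub_neg_eq_add, neg_sq,
    one_div, inv_neg]
  ring

/-- `η₁` is the Eisenstein series `G₂`: for fixed `m` the terms that are not inverse squares
telescope. -/
theorem eta1_eq_G2 (τ : UpperHalfPlane) : eta1 τ = G2 τ := by
  have h := hasSum_two_mul_zeta_half τ 1
  have hm : ∀ m : ℤ, HasSum (fun n : ℤ ↦ 1 / (1 / 2 + ((m : ℂ) * τ + n)) +
      1 / (1 / 2 - (m * τ + n)) + 1 / ((m : ℂ) * τ + n) ^ 2) (e2Summand m τ) := by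
    intro m
    have hs1 : Summable fun n : ℤ ↦ 1 / (1 / 2 + ((m : ℂ) * τ + n)) +
      1 / (1 / 2 - (m * τ + n)) + 1 / ((m : ℂ) * τ + n) ^ 2 := h.summable.prod_factor m
    have hs2 : HasSum (fun n : ℤ ↦ 1 / ((m : ℂ) * τ + n) ^ 2) (e2Summand m τ) := by
      simpa [eisSummand, e2Summand] using (e2Summand_summable m τ).hasSum
    have ht : ∀ n : ℤ, 1 / (1 / 2 + ((m : ℂ) * τ + n)) + 1 / (1 / 2 - (m * τ + n)) =
        1 / ((m : ℂ) * τ - 1 / 2 + ((n + 1 : ℤ) : ℂ)) - 1 / ((m : ℂ) * τ - 1 / 2 + (n : ℂ)) := by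
      intro n
      rw [← neg_sub _ (1 / 2 : ℂ), one_div (-_), inv_neg]
      push_cast
      ring
    have hs3 := hs1.sub hs2.summable
    simp only [add_sub_cancel_right, ht] at hs3
    have hcob : ∀ u : ℕ → ℂ, Tendsto (fun n ↦ ‖u n‖) atTop atTop →
        Tendsto (fun n ↦ 1 / ((m : ℂ) * τ - 1 / 2 + u n)) atTop (𝓝 0) := by
      intro u hu
      simp only [one_div]
      refine tendsto_inv₀_cobounded.comp ?_
      exact tendsto_const_add_cobounded _ |>.comp (tendsto_norm_atTop_iff_cobounded.mp hu)
    have h0 := hasSum_int_telescope (a := fun n : ℤ ↦ 1 / ((m : ℂ) * τ - 1 / 2 + (n : ℂ))) hs3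
      (hcob (fun n ↦ ((n : ℤ) : ℂ)) (by simpa using tendsto_natCast_atTop_atTop))
      (hcob (fun n ↦ ((-n : ℤ) : ℂ)) (by simpa using tendsto_natCast_atTop_atTop))
    simp only [← ht] at h0
    simpa using h0.add hs2
  have h1 := h.prod_fiberwise hm
  rw [eta1, ← h1.tsum_eq, G2]
  exact (tsum_eq_of_summable_unconditional h1.summable).symm

/-- Dividing the lattice `ℤ + ℤ τ` by `τ` turns the half-period `τ / 2` into `1 / 2` and `Λ_τ` into
`Λ_{-1/τ}`; the function `ζ` is homogeneous of degree `-1`. -/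
theorem eta2_eq_eta1 (τ : UpperHalfPlane) :
    eta2 τ = (τ : ℂ)⁻¹ * eta1 (ModularGroup.S • τ) := by
  have h1 := hasSum_two_mul_zeta_half τ τ
  have h2 := (hasSum_two_mul_zeta_half (ModularGroup.S • τ) 1).mul_left (τ : ℂ)⁻¹
  -- The bijection of the index sets is `(m, n) ↦ (-n, m)`, as `(-n) (-1 / τ) + m = (m τ + n) / τ`.
  let e : ℤ × ℤ ≃ ℤ × ℤ := (Equiv.prodComm ℤ ℤ).trans ((Equiv.neg ℤ).prodCongr (Equiv.refl ℤ))
  have h3 := e.hasSum_iff.mpr h2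
  have hτ : (τ : ℂ) ≠ 0 := τ.ne_zero
  refine h1.unique ?_
  convert! h3 using 2 with p
  simp only [Function.comp_apply, e, Equiv.trans_apply, Equiv.prodComm_apply, Prod.swap,
    Equiv.prodCongr_apply, Prod.map, Equiv.neg_apply, Equiv.refl_apply,
    UpperHalfPlane.modular_S_smul]
  have hw : ((-p.2 : ℤ) : ℂ) * (-(τ : ℂ))⁻¹ + p.1 = (p.1 * τ + p.2) / τ := by
    push_cast
    field_simp
    ring
  simp only [hw]
  rw [show (1 / 2 : ℂ) = (τ / 2) / τ by field_simp, ← add_div, ← sub_div, div_pow, one_div_div,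
    one_div_div, one_div_div]
  field_simp

/-- Legendre's relation, equivalent to the transformation law of `G₂` under `τ ↦ -1 / τ`. -/
theorem legendre_relation (τ : UpperHalfPlane) :
    eta1 τ * τ - eta2 τ = 2 * Real.pi * Complex.I := by
  rw [eta2_eq_eta1, eta1_eq_G2, eta1_eq_G2, G2_S_transform τ]
  have hτ : (τ : ℂ) ≠ 0 := τ.ne_zero
  field_simp
  ring

lemma eta1_eq (τ : UpperHalfPlane) : eta1 τ = Real.pi ^ 2 / 3 * E2 τ := by
  have hpi : (Real.pi : ℂ) ≠ 0 := by exact_mod_cast Real.pi_ne_zero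
  rw [eta1_eq_G2, E2, Pi.smul_apply, smul_eq_mul, riemannZeta_two]
  field_simp
  ring

end

/-! ### Power series with geometrically bounded coefficients -/

section

/-- The sum of the power series with coefficients `c`. -/
noncomputable def powerSum (c : ℕ → ℂ) (q : ℂ) : ℂ := ∑' n, c n * q ^ n

/-- The coefficients `c` are bounded by `C * 10 ^ n`. The base `10` is a convenient choice: the
series below have coefficients of growth at most `n ^ 7`, and numerical values are needed only for
`‖q‖ ≤ 1 / 230`. -/
def CoeffBound (c : ℕ → ℂ) (C : ℝ) : Prop := ∀ n, ‖c n‖ ≤ C * 10 ^ n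

namespace CoeffBound

variable {c d : ℕ → ℂ} {C D : ℝ} {q : ℂ}

lemma nonneg (h : CoeffBound c C) : 0 ≤ C := by simpa using (norm_nonneg _).trans (h 0)

lemma norm_mul_pow_le (h : CoeffBound c C) (n : ℕ) : ‖c n * q ^ n‖ ≤ C * (10 * ‖q‖) ^ n := by
  rw [norm_mul, norm_pow, mul_pow, ← mul_assoc]
  gcongr
  exact h n

lemma summable (h : CoeffBound c C) (hq : 10 * ‖q‖ < 1) : Summable fun n ↦ c n * q ^ n :=
  Summable.of_norm_bounded ((summable_geometric_of_lt_one (by positivity) hq).mul_left C)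
    h.norm_mul_pow_le

lemma shift (h : CoeffBound c C) : CoeffBound (fun n ↦ c (n + 1)) (10 * C) := fun n ↦
  (h (n + 1)).trans_eq (by ring)

lemma powerSum_eq (h : CoeffBound c C) (hq : 10 * ‖q‖ < 1) :
    powerSum c q = c 0 + q * powerSum (fun n ↦ c (n + 1)) q := by
  rw [powerSum, (h.summable hq).tsum_eq_zero_add, powerSum, ← tsum_mul_left]
  congr 1
  · simp
  · exact tsum_congr fun n ↦ by ring

lemma norm_powerSum_le (h : CoeffBound c C) (hq : 10 * ‖q‖ < 1) :
    ‖powerSum c q‖ ≤ C / (1 - 10 * ‖q‖) := by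
  have h1 := (hasSum_geometric_of_lt_one (r := 10 * ‖q‖) (by positivity) hq).mul_left C
  rw [div_eq_mul_inv]
  exact tsum_of_norm_bounded h1 h.norm_mul_pow_le

lemma differentiableOn (h : CoeffBound c C) :
    DifferentiableOn ℂ (powerSum c) (Metric.ball 0 (1 / 10)) := by
  intro q hq
  obtain ⟨r, hr1, hr2⟩ := exists_between (mem_ball_zero_iff.mp hq)
  have hr0 : 0 ≤ r := (norm_nonneg q).trans hr1.le
  refine (DifferentiableOn.differentiableAt (s := Metric.ball 0 r) ?_
    (Metric.isOpen_ball.mem_nhds (by simpa using hr1))).differentiableWithinAt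
  refine Complex.differentiableOn_tsum_of_summable_norm (u := fun n ↦ C * (10 * r) ^ n) ?_ ?_
    Metric.isOpen_ball ?_
  · exact (summable_geometric_of_lt_one (by positivity) (by linarith)).mul_left C
  · intro n
    fun_prop
  · intro n w hw
    have hw' : ‖w‖ < r := by simpa using hw
    have := h.nonneg
    exact h.norm_mul_pow_le n |>.trans (by gcongr)

/-- Termwise differentiation of `q ↦ q * ∑ c n q ^ n`. -/
lemma hasDerivAt_mul_powerSum (hd : CoeffBound (fun n ↦ (n + 1 : ℂ) * c n) D) (hq : 10 * ‖q‖ < 1) :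
    HasDerivAt (fun w ↦ w * powerSum c w) (powerSum (fun n ↦ (n + 1 : ℂ) * c n) q) q := by
  have hq' : ‖q‖ < 1 / 10 := by linarith
  obtain ⟨r, hr1, hr2⟩ := exists_between hq'
  have hr0 : 0 ≤ r := (norm_nonneg q).trans hr1.le
  have hfun : (fun w ↦ w * powerSum c w) = fun w : ℂ ↦ ∑' n : ℕ, c n * w ^ (n + 1) := by
    ext w
    rw [powerSum, ← tsum_mul_left]
    exact tsum_congr fun n ↦ by ring
  rw [hfun]
  refine hasDerivAt_tsum_of_isPreconnected (u := fun n ↦ D * (10 * r) ^ n)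
    (t := Metric.ball 0 r) (y₀ := 0) (g' := fun (n : ℕ) w ↦ (n + 1 : ℂ) * c n * w ^ n)
    ?_ Metric.isOpen_ball (convex_ball 0 r).isPreconnected ?_ ?_ ?_ ?_ (by simpa using hr1)
  · exact (summable_geometric_of_lt_one (by positivity) (by linarith)).mul_left D
  · intro n w _
    refine ((hasDerivAt_pow (n + 1) w).const_mul (c n)).congr_deriv ?_
    push_cast
    ring
  · intro n w hw
    have hw' : ‖w‖ < r := by simpa using hw
    have := hd.nonneg
    exact hd.norm_mul_pow_le n |>.trans (by gcongr)
  · simpa using lt_of_le_of_lt (norm_nonneg q) hr1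
  · simp

lemma powerSum_add (h : CoeffBound c C) (h' : CoeffBound d D) (hq : 10 * ‖q‖ < 1) :
    powerSum (fun n ↦ c n + d n) q = powerSum c q + powerSum d q := by
  simp only [powerSum, add_mul]
  exact (h.summable hq).tsum_add (h'.summable hq)

end CoeffBound

lemma powerSum_const_mul (a : ℂ) (c : ℕ → ℂ) (q : ℂ) :
    powerSum (fun n ↦ a * c n) q = a * powerSum c q := by
  simp only [powerSum, mul_assoc, tsum_mul_left]

/-! ### The `q`-expansions of `E₄`, `E₆` and `E₆'` -/

open ArithmeticFunction ModularForm
open scoped ArithmeticFunction.sigma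

lemma pow_seven_le (n : ℕ) : (((n + 1 : ℕ) : ℝ)) ^ 7 ≤ 22 * 10 ^ n := by
  rcases lt_or_ge n 2 with h | h
  · interval_cases n <;> norm_num
  induction n, h using Nat.le_induction with
  | base => norm_num
  | succ n hn ih =>
    have hn' : (2 : ℝ) ≤ n := by exact_mod_cast hn
    have h1 : ((n + 1 + 1 : ℕ) : ℝ) ≤ 4 / 3 * ((n + 1 : ℕ) : ℝ) := by push_cast; linarith
    calc (((n + 1 + 1 : ℕ) : ℝ)) ^ 7 ≤ (4 / 3 * ((n + 1 : ℕ) : ℝ)) ^ 7 := by gcongr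
      _ = (4 / 3) ^ 7 * ((n + 1 : ℕ) : ℝ) ^ 7 := by rw [mul_pow]
      _ ≤ (4 / 3) ^ 7 * (22 * 10 ^ n) := by gcongr
      _ ≤ 22 * 10 ^ (n + 1) := by
        rw [pow_succ (10 : ℝ) n]
        have : (0 : ℝ) < 10 ^ n := by positivity
        nlinarith

lemma sigma_five_le (n : ℕ) : (σ 5 (n + 1) : ℝ) * (n + 1) ≤ 22 * 10 ^ n := by
  have h : (σ 5 (n + 1) : ℝ) ≤ ((n + 1 : ℕ) : ℝ) ^ 6 := by
    exact_mod_cast sigma_le_pow_succ 5 (n + 1)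
  calc (σ 5 (n + 1) : ℝ) * (n + 1) ≤ ((n + 1 : ℕ) : ℝ) ^ 6 * ((n + 1 : ℕ) : ℝ) := by
        push_cast at h ⊢; gcongr
    _ = ((n + 1 : ℕ) : ℝ) ^ 7 := by ring
    _ ≤ _ := pow_seven_le n

/-- The coefficients `σ₅(n + 1)`. -/
noncomputable def sigmaCoeff (n : ℕ) : ℂ := (σ 5 (n + 1) : ℂ)

/-- The coefficients `(n + 1) σ₅(n + 1)`. -/
noncomputable def derivCoeff (n : ℕ) : ℂ := (n + 1 : ℂ) * sigmaCoeff n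

lemma coeffBound_derivCoeff : CoeffBound derivCoeff 22 := fun n ↦ by
  have h := sigma_five_le n
  rw [derivCoeff, sigmaCoeff, norm_mul, Complex.norm_natCast]
  rw [show (n + 1 : ℂ) = ((n + 1 : ℕ) : ℂ) by push_cast; ring, Complex.norm_natCast, mul_comm]
  simpa using h

lemma coeffBound_sigma {k : ℕ} (hk : k ≤ 6) : CoeffBound (fun n ↦ (σ k (n + 1) : ℂ)) 22 :=
    fun n ↦ by
  rw [Complex.norm_natCast]
  have h : (σ k (n + 1) : ℝ) ≤ ((n + 1 : ℕ) : ℝ) ^ (k + 1) := by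
    exact_mod_cast sigma_le_pow_succ k (n + 1)
  refine h.trans (le_trans ?_ (pow_seven_le n))
  exact pow_le_pow_right₀ (by norm_cast; lia) (by lia)

lemma coeffBound_sigmaCoeff : CoeffBound sigmaCoeff 22 := coeffBound_sigma (by norm_num)

/-- The nome `q = exp(2πiz)`. -/
noncomputable def nome (z : ℂ) : ℂ := Complex.exp (2 * Real.pi * Complex.I * z)

lemma norm_nome (z : ℂ) : ‖nome z‖ = Real.exp (-(2 * Real.pi * z.im)) := by
  rw [nome, Complex.norm_exp]
  congr 1
  simp

lemma nome_ne_zero (z : ℂ) : nome z ≠ 0 := Complex.exp_ne_zero _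

lemma hasDerivAt_nome (z : ℂ) : HasDerivAt nome (2 * Real.pi * Complex.I * nome z) z := by
  have := ((hasDerivAt_id z).const_mul (2 * Real.pi * Complex.I)).cexp
  refine this.congr_deriv ?_
  simp only [id, nome]
  ring

lemma tsum_pnat_eq_powerSum {k : ℕ} (τ : UpperHalfPlane) :
    ∑' n : ℕ+, (σ k n : ℂ) * Complex.exp (2 * Real.pi * Complex.I * τ) ^ ((n : ℕ) : ℤ) =
      nome τ * powerSum (fun n ↦ (σ k (n + 1) : ℂ)) (nome τ) := by
  rw [tsum_pnat_eq_tsum_succ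
    (f := fun n : ℕ ↦ (σ k n : ℂ) * Complex.exp (2 * Real.pi * Complex.I * τ) ^ (n : ℤ)),
    powerSum, ← tsum_mul_left]
  refine tsum_congr fun n ↦ ?_
  rw [nome, zpow_natCast]
  ring

lemma E6_eq_powerSum (τ : UpperHalfPlane) :
    E₆ τ = 1 - 504 * (nome τ * powerSum sigmaCoeff (nome τ)) := by
  have h := EisensteinSeries.q_expansion_bernoulli (k := 6) (by norm_num) ⟨3, rfl⟩ τ
  rw [show bernoulli 6 = 1 / 42 by decide +kernel, tsum_pnat_eq_powerSum] at h
  rw [h]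
  norm_num
  exact Or.inl rfl

lemma E4_eq_powerSum (τ : UpperHalfPlane) :
    E₄ τ = 1 + 240 * (nome τ * powerSum (fun n ↦ (σ 3 (n + 1) : ℂ)) (nome τ)) := by
  have h := EisensteinSeries.q_expansion_bernoulli (k := 4) (by norm_num) ⟨2, rfl⟩ τ
  rw [show bernoulli 4 = -1 / 30 by decide +kernel, tsum_pnat_eq_powerSum] at h
  rw [h]
  norm_num

lemma E6Deriv_eq_powerSum {τ : UpperHalfPlane} (hτ : 10 * ‖nome τ‖ < 1) :
    E6Deriv τ = -1008 * Real.pi * Complex.I * (nome τ * powerSum derivCoeff (nome τ)) := by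
  have h1 := CoeffBound.hasDerivAt_mul_powerSum coeffBound_derivCoeff hτ
  have h2 := ((h1.comp (τ : ℂ) (hasDerivAt_nome τ)).const_mul 504).const_sub 1
  have h3 : (fun z : ℂ ↦ E₆ (UpperHalfPlane.ofComplex z)) =ᶠ[𝓝 (τ : ℂ)]
      fun z ↦ 1 - 504 * (nome z * powerSum sigmaCoeff (nome z)) := by
    filter_upwards [UpperHalfPlane.isOpen_upperHalfPlaneSet.mem_nhds τ.im_pos] with z hz
    rw [E6_eq_powerSum, UpperHalfPlane.ofComplex_apply_of_im_pos hz]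
  rw [E6Deriv, h3.deriv_eq]
  refine h2.deriv.trans ?_
  change -(504 * (powerSum derivCoeff (nome τ) * _)) = _
  ring

/-- The coefficients of `(E₆ - (1 - 570 q) b) / q²`, where `b = ∑ (n + 1) σ₅(n + 1) q ^ n`. The
first two coefficients of `E₆ = 1 - 504 q - ⋯` and of `(1 - 570 q) b` agree as `b = 1 + 66 q + ⋯`.
-/
noncomputable def remCoeff (n : ℕ) : ℂ :=
  (570 * derivCoeff (n + 1) + -504 * sigmaCoeff (n + 1)) + (-1) * derivCoeff (n + 2)

lemma CoeffBound.add {c d : ℕ → ℂ} {C D : ℝ} (h : CoeffBound c C) (h' : CoeffBound d D) :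
    CoeffBound (fun n ↦ c n + d n) (C + D) := fun n ↦
  (norm_add_le _ _).trans ((add_le_add (h n) (h' n)).trans_eq (by ring))

lemma CoeffBound.const_mul {c : ℕ → ℂ} {C : ℝ} (h : CoeffBound c C) (a : ℂ) :
    CoeffBound (fun n ↦ a * c n) (‖a‖ * C) := fun n ↦ by
  rw [norm_mul, mul_assoc]
  gcongr
  exact h n

lemma coeffBound_remCoeff : CoeffBound remCoeff 238480 := by
  have h : CoeffBound remCoeff _ := ((coeffBound_derivCoeff.shift.const_mul 570).add
    (coeffBound_sigmaCoeff.shift.const_mul (-504))).add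
    (coeffBound_derivCoeff.shift.shift.const_mul (-1))
  convert! h using 1
  norm_num

/-- The power series `b = ∑ (n + 1) σ₅(n + 1) q ^ n`, so that `E₆' = -1008 π i q b`. -/
noncomputable def bSeries (q : ℂ) : ℂ := powerSum derivCoeff q

/-- `P(q)`, defined by `E₆ / (q b) = 1 / q - 570 + P`. -/
noncomputable def pSeries (q : ℂ) : ℂ := q * powerSum remCoeff q / bSeries q

lemma sigmaCoeff_values : sigmaCoeff 0 = 1 ∧ sigmaCoeff 1 = 33 ∧ sigmaCoeff 2 = 244 ∧
    sigmaCoeff 3 = 1057 := by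
  refine ⟨?_, ?_, ?_, ?_⟩ <;> unfold sigmaCoeff
  · simp
  · rw [show σ 5 (1 + 1) = 33 by decide +kernel]; norm_num
  · rw [show σ 5 (2 + 1) = 244 by decide +kernel]; norm_num
  · rw [show σ 5 (3 + 1) = 1057 by decide +kernel]; norm_num

lemma E6_eq_bSeries {τ : UpperHalfPlane} (hτ : 10 * ‖nome τ‖ < 1) :
    E₆ τ = (1 - 570 * nome τ) * bSeries (nome τ) + nome τ ^ 2 * powerSum remCoeff (nome τ) := by
  obtain ⟨h0, h1, -, -⟩ := sigmaCoeff_values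
  have e1 := coeffBound_sigmaCoeff.powerSum_eq hτ
  have e2 := coeffBound_derivCoeff.powerSum_eq hτ
  have e3 := coeffBound_derivCoeff.shift.powerSum_eq hτ
  have e4 : powerSum remCoeff (nome τ) = _ :=
    ((coeffBound_derivCoeff.shift.const_mul 570).add
    (coeffBound_sigmaCoeff.shift.const_mul (-504))).powerSum_add
    (coeffBound_derivCoeff.shift.shift.const_mul (-1)) hτ
  rw [(coeffBound_derivCoeff.shift.const_mul 570).powerSum_add
    (coeffBound_sigmaCoeff.shift.const_mul (-504)) hτ, powerSum_const_mul, powerSum_const_mul,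
    powerSum_const_mul] at e4
  have d0 : derivCoeff 0 = 1 := by simp [derivCoeff, h0]
  have d1 : derivCoeff (0 + 1) = 66 := by norm_num [derivCoeff, h1]
  rw [h0] at e1
  rw [d0] at e2
  rw [d1] at e3
  rw [E6_eq_powerSum, e4, bSeries]
  linear_combination (-504 * nome τ) * e1 + (-1 + 570 * nome τ) * e2 - nome τ * e3

/-! ### Numerical bounds for `‖q‖ ≤ 1 / 230` -/

lemma norm_bSeries_sub_one_le {q : ℂ} (hq : ‖q‖ ≤ 1 / 230) : ‖bSeries q - 1‖ ≤ 0.303 := by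
  obtain ⟨h0, h1, h2, -⟩ := sigmaCoeff_values
  have hq' : 10 * ‖q‖ < 1 := by linarith
  have e1 := coeffBound_derivCoeff.powerSum_eq hq'
  have e2 := coeffBound_derivCoeff.shift.powerSum_eq hq'
  -- Split off the first three terms `1 + 66 q + 732 q²`; the remainder is bounded geometrically.
  have e3 := coeffBound_derivCoeff.shift.shift.powerSum_eq hq'
  have b3 := coeffBound_derivCoeff.shift.shift.shift.norm_powerSum_le hq'
  rw [show derivCoeff 0 = 1 by simp [derivCoeff, h0]] at e1
  rw [show derivCoeff (0 + 1) = 66 by norm_num [derivCoeff, h1]] at e2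
  rw [show derivCoeff (0 + 1 + 1) = 732 by norm_num [derivCoeff, h2]] at e3
  set R := powerSum (fun n ↦ derivCoeff (n + 1 + 1 + 1)) q
  have hR : ‖R‖ ≤ 23000 := by
    refine b3.trans ?_
    rw [div_le_iff₀ (by linarith)]
    linarith
  have : bSeries q - 1 = q * (66 + q * (732 + q * R)) := by
    rw [bSeries, e1, e2, e3]
    ring
  rw [this, norm_mul]
  have k1 : ‖732 + q * R‖ ≤ 832 := by
    refine (norm_add_le _ _).trans ?_
    rw [norm_mul]
    have : ‖q‖ * ‖R‖ ≤ 1 / 230 * 23000 := by gcongr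
    norm_num at this ⊢
    linarith
  have k2 : ‖66 + q * (732 + q * R)‖ ≤ 66 + 832 / 230 := by
    refine (norm_add_le _ _).trans ?_
    rw [norm_mul]
    have : ‖q‖ * ‖732 + q * R‖ ≤ 1 / 230 * 832 := by gcongr
    norm_num at this ⊢
    linarith
  calc ‖q‖ * ‖66 + q * (732 + q * R)‖ ≤ 1 / 230 * (66 + 832 / 230) := by gcongr
    _ ≤ _ := by norm_num

lemma le_norm_bSeries {q : ℂ} (hq : ‖q‖ ≤ 1 / 230) : 0.697 ≤ ‖bSeries q‖ := by
  have h := norm_bSeries_sub_one_le hq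
  have h1 := norm_sub_norm_le (1 : ℂ) (1 - bSeries q)
  rw [norm_sub_rev, sub_sub_cancel, norm_one, norm_sub_rev] at h1
  linarith [norm_sub_rev (bSeries q) 1]

lemma bSeries_ne_zero {q : ℂ} (hq : ‖q‖ ≤ 1 / 230) : bSeries q ≠ 0 := fun h ↦ by
  have := le_norm_bSeries hq
  rw [h] at this
  norm_num at this

lemma norm_powerSum_remCoeff_le {q : ℂ} (hq : ‖q‖ ≤ 1 / 230) :
    ‖powerSum remCoeff q‖ ≤ 21990 := by
  obtain ⟨-, h1, h2, h3⟩ := sigmaCoeff_values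
  have hq' : 10 * ‖q‖ < 1 := by linarith
  have e1 := coeffBound_remCoeff.powerSum_eq hq'
  have e2 := coeffBound_remCoeff.shift.powerSum_eq hq'
  have b2 := coeffBound_remCoeff.shift.shift.norm_powerSum_le hq'
  rw [show remCoeff 0 = 20256 by norm_num [remCoeff, derivCoeff, h1, h2]] at e1
  rw [show remCoeff (0 + 1) = 290036 by norm_num [remCoeff, derivCoeff, h2, h3]] at e2
  set R := powerSum (fun n ↦ remCoeff (n + 1 + 1)) q
  have hR : ‖R‖ ≤ 24932000 := by
    refine b2.trans ?_
    rw [div_le_iff₀ (by linarith)]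
    linarith
  rw [e1, e2]
  have k1 : ‖290036 + q * R‖ ≤ 398436 := by
    refine (norm_add_le _ _).trans ?_
    rw [norm_mul]
    have : ‖q‖ * ‖R‖ ≤ 1 / 230 * 24932000 := by gcongr
    norm_num at this ⊢
    linarith
  refine (norm_add_le _ _).trans ?_
  rw [norm_mul]
  have : ‖q‖ * ‖290036 + q * R‖ ≤ 1 / 230 * 398436 := by gcongr
  norm_num at this ⊢
  linarith

lemma norm_pSeries_le {q : ℂ} (hq : ‖q‖ ≤ 1 / 230) : ‖pSeries q‖ ≤ 31600 * ‖q‖ := by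
  have h1 := le_norm_bSeries hq
  have h2 := norm_powerSum_remCoeff_le hq
  rw [pSeries, norm_div, norm_mul, div_le_iff₀ (by linarith)]
  calc ‖q‖ * ‖powerSum remCoeff q‖ ≤ ‖q‖ * 21990 := by gcongr
    _ ≤ 31600 * ‖q‖ * 0.697 := by nlinarith [norm_nonneg q]
    _ ≤ _ := by gcongr

lemma differentiableAt_pSeries {q : ℂ} (hq : ‖q‖ ≤ 1 / 230) : DifferentiableAt ℂ pSeries q := by
  have hmem : q ∈ Metric.ball (0 : ℂ) (1 / 10) := by
    rw [mem_ball_zero_iff]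
    linarith
  have h1 := coeffBound_remCoeff.differentiableOn.differentiableAt
    (Metric.isOpen_ball.mem_nhds hmem)
  have h2 := coeffBound_derivCoeff.differentiableOn.differentiableAt
    (Metric.isOpen_ball.mem_nhds hmem)
  exact (differentiableAt_id.mul h1).div h2 (bSeries_ne_zero hq)

/-- Cauchy's estimate for `P` on the disc of radius `1 / 230`. -/
lemma norm_mul_deriv_pSeries_le {q : ℂ} (hq : ‖q‖ ≤ 1 / 367) : ‖q * deriv pSeries q‖ ≤ 231 := by
  have h : ‖deriv pSeries q‖ ≤ (31600 / 230) / (1 / 230 - 1 / 367) := by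
    refine Complex.norm_deriv_le_of_forall_mem_sphere_norm_le (by norm_num) ?_ ?_
    · refine DifferentiableOn.diffContOnCl fun w hw ↦ ?_
      rw [closure_ball _ (by norm_num), mem_closedBall_iff_norm] at hw
      refine (differentiableAt_pSeries ?_).differentiableWithinAt
      have := norm_sub_norm_le w q
      linarith
    · intro w hw
      rw [mem_sphere_iff_norm] at hw
      have h1 := norm_sub_norm_le w q
      have h2 : ‖w‖ ≤ 1 / 230 := by linarith
      exact (norm_pSeries_le h2).trans (by linarith)
  rw [norm_mul]
  calc ‖q‖ * ‖deriv pSeries q‖ ≤ 1 / 367 * ((31600 / 230) / (1 / 230 - 1 / 367)) := by gcongr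
    _ ≤ 231 := by norm_num

end

section

open ArithmeticFunction ModularForm UpperHalfPlane
open scoped ArithmeticFunction.sigma Manifold MatrixGroups

/-! ### Ramanujan's formula for `E₆'` -/

lemma E2_eq_powerSum (τ : UpperHalfPlane) : EisensteinSeries.E2 τ =
    1 - 24 * (nome τ * powerSum (fun n ↦ (σ 1 (n + 1) : ℂ)) (nome τ)) := by
  rw [EisensteinSeries.E2_eq_tsum_cexp, ← tsum_pnat_eq_powerSum]
  simp only [zpow_natCast]

lemma tendsto_nome : Tendsto (fun τ : UpperHalfPlane ↦ nome τ) atImInfty (𝓝 0) := by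
  have := UpperHalfPlane.qParam_tendsto_atImInfty zero_lt_one
  refine this.congr fun τ ↦ ?_
  simp [Function.Periodic.qParam, nome]

lemma CoeffBound.tendsto {c : ℕ → ℂ} {C : ℝ} (h : CoeffBound c C) :
    Tendsto (fun τ : UpperHalfPlane ↦ nome τ * powerSum c (nome τ)) atImInfty (𝓝 0) := by
  have h1 : ContinuousAt (powerSum c) 0 := (h.differentiableOn.differentiableAt
    (Metric.ball_mem_nhds _ (by norm_num))).continuousAt
  simpa using tendsto_nome.mul (h1.tendsto.comp tendsto_nome)

lemma normalizedDerivOfComplex_E6 (τ : UpperHalfPlane) :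
    Derivative.normalizedDerivOfComplex E₆ τ = (2 * Real.pi * Complex.I)⁻¹ * E6Deriv τ := rfl

/-- The Serre derivative raises the weight by two, so that `ϑE₆ + E₄² / 2` has weight `8`. -/
lemma serreDerivative_E6_add_slash (A : SL(2, ℤ)) :
    (Derivative.serreDerivative ((6 : ℤ) : ℂ) E₆ + (2⁻¹ : ℂ) • (E₄ * E₄ : ℍ → ℂ)) ∣[(8 : ℤ)] A =
      Derivative.serreDerivative ((6 : ℤ) : ℂ) E₆ + (2⁻¹ : ℂ) • (E₄ * E₄ : ℍ → ℂ) := by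
  have h6 : (E₆ : ℍ → ℂ) ∣[(6 : ℤ)] A = E₆ := SlashInvariantForm.slash_action_eqn E₆ _ ⟨A, rfl⟩
  have h4 : (E₄ : ℍ → ℂ) ∣[(4 : ℤ)] A = E₄ := SlashInvariantForm.slash_action_eqn E₄ _ ⟨A, rfl⟩
  rw [SlashAction.add_slash, SL_smul_slash]
  congr 1
  · exact Derivative.serreDerivative_slash_invariant (ModularFormClass.holo E₆) h6
  · rw [show (8 : ℤ) = 4 + 4 by norm_num, mul_slash_SL2, h4]

/-- The constant term is `0 - 6 / 12 + 1 / 2 = 0`. -/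
lemma isZeroAtImInfty_serreDerivative_E6_add : IsZeroAtImInfty
    (Derivative.serreDerivative ((6 : ℤ) : ℂ) E₆ + (2⁻¹ : ℂ) • (E₄ * E₄ : ℍ → ℂ)) := by
  have hD : Tendsto (Derivative.normalizedDerivOfComplex E₆) atImInfty (𝓝 0) := by
    have h1 := coeffBound_derivCoeff.tendsto.const_mul
      ((2 * Real.pi * Complex.I)⁻¹ * (-1008 * Real.pi * Complex.I))
    rw [mul_zero] at h1
    refine h1.congr' ?_
    filter_upwards [tendsto_nome.eventually (Metric.ball_mem_nhds 0 (show (0 : ℝ) < 1 / 10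
      by norm_num))] with τ hτ
    rw [dist_zero_right] at hτ
    rw [normalizedDerivOfComplex_E6, E6Deriv_eq_powerSum (by linarith), mul_assoc]
  have h2 : Tendsto EisensteinSeries.E2 atImInfty (𝓝 1) := by
    have := ((coeffBound_sigma (k := 1) (by norm_num)).tendsto.const_mul 24).const_sub 1
    rw [mul_zero, sub_zero] at this
    exact this.congr fun τ ↦ (E2_eq_powerSum τ).symm
  have h4 : Tendsto E₄ atImInfty (𝓝 1) := by
    have := ((coeffBound_sigma (k := 3) (by norm_num)).tendsto.const_mul 240).const_add 1
    rw [mul_zero, add_zero] at this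
    exact this.congr fun τ ↦ (E4_eq_powerSum τ).symm
  have h6 : Tendsto E₆ atImInfty (𝓝 1) := by
    have := (coeffBound_sigmaCoeff.tendsto.const_mul 504).const_sub 1
    rw [mul_zero, sub_zero] at this
    exact this.congr fun τ ↦ (E6_eq_powerSum τ).symm
  have h := (hD.sub ((h2.const_mul (((6 : ℤ) : ℂ) * 12⁻¹)).mul h6)).add
    ((h4.mul h4).const_mul (2⁻¹ : ℂ))
  rw [show (0 : ℂ) - ((6 : ℤ) : ℂ) * 12⁻¹ * 1 * 1 + 2⁻¹ * (1 * 1) = 0 by norm_num] at h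
  exact h

/-- The Serre derivative of `E₆` plus `E₄² / 2`, a cusp form of weight `8`. -/
noncomputable def ramanujanCuspForm : CuspForm 𝒮ℒ 8 where
  toFun := Derivative.serreDerivative ((6 : ℤ) : ℂ) E₆ + (2⁻¹ : ℂ) • (E₄ * E₄ : ℍ → ℂ)
  slash_action_eq' A hA := by
    obtain ⟨A, rfl⟩ := hA
    exact serreDerivative_E6_add_slash A
  holo' := (Derivative.serreDerivative_mdifferentiable _ (ModularFormClass.holo E₆)).add
    (((ModularFormClass.holo E₄).mul (ModularFormClass.holo E₄)).const_smul _)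
  zero_at_cusps' hc := by
    rw [Subgroup.IsArithmetic.isCusp_iff_isCusp_SL2Z] at hc
    rw [OnePoint.isZeroAt_iff_forall_SL2Z hc]
    intro γ _
    rw [serreDerivative_E6_add_slash]
    exact isZeroAtImInfty_serreDerivative_E6_add

/-- Ramanujan's formula for `E₆'`: there is no cusp form of weight `8` other than zero. -/
lemma E6Deriv_eq (τ : UpperHalfPlane) : E6Deriv τ =
    Real.pi * Complex.I * (EisensteinSeries.E2 τ * E₆ τ - E₄ τ ^ 2) := by
  have h : ramanujanCuspForm = 0 := rank_zero_iff_forall_zero.mp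
    (CuspForm.rank_eq_zero_of_weight_lt_twelve (by norm_num)) _
  have h1 : Derivative.normalizedDerivOfComplex E₆ τ - ((6 : ℤ) : ℂ) * 12⁻¹ *
      EisensteinSeries.E2 τ * E₆ τ + 2⁻¹ * (E₄ τ * E₄ τ) = 0 :=
    congrArg (fun f : CuspForm 𝒮ℒ 8 ↦ f τ) h
  rw [normalizedDerivOfComplex_E6] at h1
  have h2 : (2 * Real.pi * Complex.I) ≠ 0 := Complex.two_pi_I_ne_zero
  have h3 : (2 * Real.pi * Complex.I) * (2 * Real.pi * Complex.I)⁻¹ = 1 := mul_inv_cancel₀ h2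
  push_cast at h1
  linear_combination (2 * Real.pi * Complex.I) * h1 - E6Deriv τ * h3

/-! ### The equivariant function `φ = (τ E₆' + 6 E₆) / E₆'` -/

/-- The numerator `τ E₆' + 6 E₆` of `φ`, whose denominator is `E₆'`. -/
noncomputable def phiNum (τ : ℍ) : ℂ := τ * E6Deriv τ + 6 * E₆ τ

/-- The constant relating `g₂² - 18 η₁ g₃` to `E₆'`. -/
noncomputable def phiConst : ℂ := 16 * Real.pi ^ 7 * Complex.I / 9

lemma phiConst_ne_zero : phiConst ≠ 0 := by
  have := Real.pi_ne_zero
  simp [phiConst, Complex.I_ne_zero, this]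

/-- The denominator of `φ`, by Ramanujan's formula. -/
lemma g2_sq_sub_eta1 (τ : ℍ) :
    g2 τ ^ 2 - 18 * eta1 τ * g3 τ = phiConst * E6Deriv τ := by
  rw [g2_eq, g3_eq, eta1_eq, E6Deriv_eq, phiConst]
  linear_combination (16 / 9 * Real.pi ^ 8 * (EisensteinSeries.E2 τ * E₆ τ - E₄ τ ^ 2)) *
    -Complex.I_sq

/-- The numerator of `φ`, by Legendre's relation and Ramanujan's formula. -/
lemma g2_sq_mul_sub_eta2 (τ : ℍ) :
    g2 τ ^ 2 * τ - 18 * eta2 τ * g3 τ = phiConst * phiNum τ := by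
  have h := legendre_relation τ
  have h1 := g2_sq_sub_eta1 τ
  rw [phiNum]
  have h3 : 36 * Real.pi * Complex.I * g3 τ = phiConst * (6 * E₆ τ) := by
    rw [g3_eq, phiConst]
    ring
  linear_combination τ * h1 + 18 * g3 τ * h + h3

lemma fC_eq (C : ℝ) (τ : ℍ) : fC C τ = phiConst * (C * E6Deriv τ - phiNum τ) := by
  rw [fC]
  linear_combination (C : ℂ) * g2_sq_sub_eta1 τ - g2_sq_mul_sub_eta2 τ

lemma fC_eq_zero_iff (C : ℝ) (τ : ℍ) : fC C τ = 0 ↔ phiNum τ = C * E6Deriv τ := by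
  rw [fC_eq, mul_eq_zero, or_iff_right phiConst_ne_zero, sub_eq_zero, eq_comm]

lemma chi1_eq (τ : ℍ) : chi1 τ = 2 * phiConst * E6Deriv τ := by
  rw [chi1, g2_sq_sub_eta1, mul_assoc]

lemma chi2_eq (τ : ℍ) : chi2 τ = 2 * phiConst * phiNum τ := by
  rw [chi2, g2_sq_mul_sub_eta2, mul_assoc]

lemma phi_of_eq_zero {τ : ℍ} (h : E6Deriv τ = 0) : phi τ = OnePoint.infty := by
  rw [phi, if_pos (by rw [g2_sq_sub_eta1, h, mul_zero])]

lemma phi_of_ne_zero {τ : ℍ} (h : E6Deriv τ ≠ 0) :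
    phi τ = ((phiNum τ / E6Deriv τ : ℂ) : OnePoint ℂ) := by
  rw [phi, if_neg (by rw [g2_sq_sub_eta1]; exact mul_ne_zero phiConst_ne_zero h)]
  congr 1
  have h3 : 36 * Real.pi * Complex.I * g3 τ = phiConst * (6 * E₆ τ) := by
    rw [g3_eq, phiConst]
    ring
  rw [h3, g2_sq_sub_eta1, mul_div_mul_left _ _ phiConst_ne_zero, phiNum]
  field_simp

/-- The numerator and the denominator of `φ` have no common zero: there `E₆` and `E₄` would vanish,
and with them the discriminant. -/
lemma phiNum_ne_zero_of_E6Deriv_eq_zero {τ : ℍ} (h : E6Deriv τ = 0) : phiNum τ ≠ 0 := by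
  intro h1
  rw [phiNum, h, mul_zero, zero_add, mul_eq_zero, or_iff_right (by norm_num)] at h1
  rw [E6Deriv_eq, h1, mul_zero, zero_sub, mul_eq_zero] at h
  have h4 : E₄ τ = 0 := by
    simpa [Real.pi_ne_zero, Complex.I_ne_zero] using h
  apply discriminant_ne_zero τ
  rw [discriminant_eq_E₄_cube_sub_E₆_sq, h1, h4]
  norm_num

lemma g2_cube_ne (τ : ℍ) : g2 τ ^ 3 ≠ 27 * g3 τ ^ 2 := by
  intro h
  rw [g2_eq, g3_eq] at h
  apply discriminant_ne_zero τ
  have hpi : (Real.pi : ℂ) ≠ 0 := by exact_mod_cast Real.pi_ne_zero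
  have : 64 / 27 * (Real.pi : ℂ) ^ 12 ≠ 0 := mul_ne_zero (by norm_num) (pow_ne_zero _ hpi)
  rw [discriminant_eq_E₄_cube_sub_E₆_sq, div_eq_zero_iff]
  left
  apply mul_left_cancel₀ this
  linear_combination h

lemma coe_smul_eq (γ : SL(2, ℤ)) (τ : ℍ) :
    ((γ • τ : ℍ) : ℂ) = (γ 0 0 * τ + γ 0 1) / (γ 1 0 * τ + γ 1 1) := by
  rw [UpperHalfPlane.coe_specialLinearGroup_apply]
  simp

lemma denom_coe_ne_zero (γ : SL(2, ℤ)) (τ : ℍ) : (γ 1 0 * τ + γ 1 1 : ℂ) ≠ 0 := by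
  rw [← ModularGroup.denom_apply]
  exact UpperHalfPlane.denom_ne_zero _ τ

lemma E6_smul (γ : SL(2, ℤ)) (τ : ℍ) : E₆ (γ • τ) = (γ 1 0 * τ + γ 1 1) ^ 6 * E₆ τ := by
  have h6 : (E₆ : ℍ → ℂ) ∣[(6 : ℤ)] γ = E₆ := SlashInvariantForm.slash_action_eqn E₆ _ ⟨γ, rfl⟩
  have h := congrFun h6 τ
  have hj := denom_coe_ne_zero γ τ
  rw [SL_slash_apply, ← ModularGroup.denom_apply] at *
  rw [← h, zpow_neg]
  field_simp

lemma E4_smul (γ : SL(2, ℤ)) (τ : ℍ) : E₄ (γ • τ) = (γ 1 0 * τ + γ 1 1) ^ 4 * E₄ τ := by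
  have h6 : (E₄ : ℍ → ℂ) ∣[(4 : ℤ)] γ = E₄ := SlashInvariantForm.slash_action_eqn E₄ _ ⟨γ, rfl⟩
  have h := congrFun h6 τ
  have hj := denom_coe_ne_zero γ τ
  rw [SL_slash_apply, ← ModularGroup.denom_apply] at *
  rw [← h, zpow_neg]
  field_simp

/-- Together with `phiNum_smul` this says that the column vector with entries `τ E₆' + 6 E₆` and
`E₆'` is multiplied by `(c τ + d) ^ 7 γ` under `τ ↦ γ τ`, so that `φ(γ τ) = γ φ(τ)`. -/
lemma E6Deriv_smul (γ : SL(2, ℤ)) (τ : ℍ) : E6Deriv (γ • τ) =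
    (γ 1 0 * τ + γ 1 1) ^ 7 * (γ 1 0 * phiNum τ + γ 1 1 * E6Deriv τ) := by
  have h6 : (E₆ : ℍ → ℂ) ∣[(6 : ℤ)] γ = E₆ := SlashInvariantForm.slash_action_eqn E₆ _ ⟨γ, rfl⟩
  have h := congrFun (Derivative.normalizedDerivOfComplex_SL_slash (ModularFormClass.holo E₆)
    (k := 6) (γ := γ)) τ
  have hj := denom_coe_ne_zero γ τ
  rw [h6, Pi.sub_apply, SL_slash_apply, normalizedDerivOfComplex_E6,
    normalizedDerivOfComplex_E6, ModularGroup.denom_apply] at h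
  have hj8 : (γ 1 0 * τ + γ 1 1 : ℂ) ^ (-(6 + 2) : ℤ) = ((γ 1 0 * τ + γ 1 1 : ℂ) ^ 8)⁻¹ := by
    rw [zpow_neg]
    norm_cast
  rw [hj8] at h
  have h2 := Complex.two_pi_I_ne_zero
  rw [phiNum]
  push_cast at h
  field_simp at h
  linear_combination -h

lemma phiNum_smul (γ : SL(2, ℤ)) (τ : ℍ) : phiNum (γ • τ) =
    (γ 1 0 * τ + γ 1 1) ^ 7 * (γ 0 0 * phiNum τ + γ 0 1 * E6Deriv τ) := by
  have hj := denom_coe_ne_zero γ τ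
  have hdet : (γ 0 0 * γ 1 1 - γ 0 1 * γ 1 0 : ℂ) = 1 := by
    have := γ.det_coe
    rw [Matrix.det_fin_two] at this
    exact_mod_cast this
  rw [phiNum, E6Deriv_smul, E6_smul, coe_smul_eq]
  field_simp
  rw [phiNum]
  linear_combination (-6 * E₆ τ * (γ 1 0 * τ + γ 1 1 : ℂ) ^ 6) * hdet

/-! ### The reflection `τ ↦ 1 - τ̄` -/

/-- The reflection `τ ↦ 1 - τ̄` in the line `Re τ = 1 / 2`. -/
noncomputable def reflect (τ : ℍ) : ℍ := ⟨1 - (starRingEnd ℂ) τ, by simpa using τ.im_pos⟩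

lemma coe_reflect (τ : ℍ) : (reflect τ : ℂ) = 1 - (starRingEnd ℂ) τ := rfl

lemma re_reflect (τ : ℍ) : (reflect τ).re = 1 - τ.re := by
  simp [← UpperHalfPlane.coe_re, coe_reflect]

lemma im_reflect (τ : ℍ) : (reflect τ).im = τ.im := by
  simp [← UpperHalfPlane.coe_im, coe_reflect]

lemma reflect_reflect (τ : ℍ) : reflect (reflect τ) = τ := by
  ext
  simp [coe_reflect]

lemma nome_reflect (τ : ℍ) : nome (reflect τ) = (starRingEnd ℂ) (nome τ) := by
  rw [nome, nome, ← Complex.exp_conj, Complex.exp_eq_exp_iff_exists_int, coe_reflect]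
  refine ⟨1, ?_⟩
  simp [Complex.conj_ofNat]
  ring

lemma powerSum_conj {c : ℕ → ℂ} (h : ∀ n, (starRingEnd ℂ) (c n) = c n) (q : ℂ) :
    powerSum c ((starRingEnd ℂ) q) = (starRingEnd ℂ) (powerSum c q) := by
  simp [powerSum, Complex.conj_tsum, h]

lemma E6_reflect (τ : ℍ) : E₆ (reflect τ) = (starRingEnd ℂ) (E₆ τ) := by
  rw [E6_eq_powerSum, E6_eq_powerSum, nome_reflect, powerSum_conj (by simp [sigmaCoeff])]
  simp [Complex.conj_ofNat]

lemma E4_reflect (τ : ℍ) : E₄ (reflect τ) = (starRingEnd ℂ) (E₄ τ) := by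
  rw [E4_eq_powerSum, E4_eq_powerSum, nome_reflect, powerSum_conj (by simp)]
  simp [Complex.conj_ofNat]

lemma E2_reflect (τ : ℍ) : EisensteinSeries.E2 (reflect τ) =
    (starRingEnd ℂ) (EisensteinSeries.E2 τ) := by
  rw [E2_eq_powerSum, E2_eq_powerSum, nome_reflect, powerSum_conj (by simp)]
  simp [Complex.conj_ofNat]

lemma E6Deriv_reflect (τ : ℍ) : E6Deriv (reflect τ) = -(starRingEnd ℂ) (E6Deriv τ) := by
  rw [E6Deriv_eq, E6Deriv_eq, E6_reflect, E4_reflect, E2_reflect]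
  simp

lemma phiNum_reflect (τ : ℍ) :
    phiNum (reflect τ) = (starRingEnd ℂ) (phiNum τ - E6Deriv τ) := by
  rw [phiNum, phiNum, E6Deriv_reflect, E6_reflect, coe_reflect]
  simp [Complex.conj_ofNat]
  ring

end

section

open UpperHalfPlane ModularForm
open scoped MatrixGroups

/-! ### Numerical estimates for `φ` -/

/-- A function whose derivative has positive real part after multiplication by a constant is
injective on convex sets. -/
lemma injOn_of_re_mul_deriv_pos {s : Set ℂ} (hs : Convex ℝ s) {f f' : ℂ → ℂ} (c : ℂ)
    (hf : ∀ z ∈ s, HasDerivAt f (f' z) z) (hpos : ∀ z ∈ s, 0 < (c * f' z).re) :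
    Set.InjOn f s := by
  intro a ha b hb hab
  by_contra hne
  set w : ℂ := b - a with hw
  have hw0 : w ≠ 0 := sub_ne_zero.mpr (Ne.symm hne)
  set h : ℝ → ℝ := fun t ↦ (c * (starRingEnd ℂ) w * f (a + t * w)).re
  have hmem : ∀ t ∈ Set.Icc (0 : ℝ) 1, a + t * w ∈ s := fun t ht ↦ by
    have := hs.add_smul_sub_mem ha hb ht
    simpa [hw] using this
  -- Along the segment from `a` to `b`, the real part of `c w̄ f` has derivative `|w|² Re (c f')`.
  have hd : ∀ t ∈ Set.Icc (0 : ℝ) 1,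
      HasDerivAt h (c * (starRingEnd ℂ) w * (f' (a + t * w) * w)).re t := fun t ht ↦ by
    have h1 : HasDerivAt (fun u : ℂ ↦ a + u * w) w (t : ℂ) := by
      simpa using ((hasDerivAt_id (t : ℂ)).mul_const w).const_add a
    exact (((hf _ (hmem t ht)).comp (t : ℂ) h1).const_mul _).real_of_complex
  have hmono : StrictMonoOn h (Set.Icc 0 1) := by
    refine strictMonoOn_of_deriv_pos (convex_Icc 0 1)
      (fun t ht ↦ (hd t ht).continuousAt.continuousWithinAt) fun t ht ↦ ?_
    rw [interior_Icc] at ht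
    have ht' : t ∈ Set.Icc (0 : ℝ) 1 := Set.Ioo_subset_Icc_self ht
    rw [(hd t ht').deriv]
    have h2 : c * (starRingEnd ℂ) w * (f' (a + t * w) * w) =
        ((Complex.normSq w : ℝ) : ℂ) * (c * f' (a + t * w)) := by
      rw [Complex.normSq_eq_conj_mul_self]
      ring
    rw [h2, Complex.re_ofReal_mul]
    exact mul_pos (Complex.normSq_pos.mpr hw0) (hpos _ (hmem t ht'))
  have := hmono (Set.left_mem_Icc.mpr zero_le_one) (Set.right_mem_Icc.mpr zero_le_one) zero_lt_one
  simp only [h, hw, Complex.ofReal_zero, Complex.ofReal_one] at this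
  rw [zero_mul, one_mul, add_zero, add_sub_cancel, hab] at this
  exact lt_irrefl _ this

lemma exp_five_ge : 148.41 ≤ Real.exp 5 := by
  rw [show (5 : ℝ) = (5 : ℕ) * 1 by norm_num, Real.exp_nat_mul]
  have := Real.exp_one_gt_d9
  calc (148.41 : ℝ) ≤ 2.7182818283 ^ 5 := by norm_num
    _ ≤ _ := by gcongr

lemma exp_ge_230 : 230 ≤ Real.exp 5.44 := by
  rw [show (5.44 : ℝ) = 5 + 0.44 by norm_num, Real.exp_add]
  have h1 := exp_five_ge
  have h2 := Real.sum_le_exp_of_nonneg (x := 0.44) (by norm_num) 4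
  norm_num [Finset.sum_range_succ, Nat.factorial] at h2
  nlinarith

lemma exp_ge_367 : 367 ≤ Real.exp 5.906 := by
  rw [show (5.906 : ℝ) = 5 + 0.906 by norm_num, Real.exp_add]
  have h1 := exp_five_ge
  have h2 := Real.sum_le_exp_of_nonneg (x := 0.906) (by norm_num) 7
  norm_num [Finset.sum_range_succ, Nat.factorial] at h2
  nlinarith

/-- Lower bounds for `|1 / q| = exp(2πy)` when `y ≥ √3 / 2`: a constant, and a linear one coming
from `1 + x ≤ exp x`, with `5.44 < 2π * 0.866` and `6 < 2π`. -/
lemma exp_two_pi_mul_ge {y : ℝ} (hy : 3 / 4 ≤ y ^ 2) (hy0 : 0 < y) :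
    230 ≤ Real.exp (2 * Real.pi * y) ∧
      230 * (1 + 6 * (y - 0.866)) ≤ Real.exp (2 * Real.pi * y) := by
  have hy1 : 0.866 ≤ y := by nlinarith
  have hpi := Real.pi_gt_d4
  have hmain : 230 * (1 + 6 * (y - 0.866)) ≤ Real.exp (2 * Real.pi * y) := by
    have h1 : 5.44 + 6 * (y - 0.866) ≤ 2 * Real.pi * y := by nlinarith
    refine le_trans ?_ (Real.exp_le_exp.mpr h1)
    rw [Real.exp_add]
    have h2 := Real.add_one_le_exp (6 * (y - 0.866))
    exact mul_le_mul exp_ge_230 (by linarith) (by linarith) (Real.exp_pos _).le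
  exact ⟨by linarith, hmain⟩

lemma exp_two_pi_mul_ge_367 {y : ℝ} (hy : 0.94 ≤ y) : 367 ≤ Real.exp (2 * Real.pi * y) := by
  have hpi := Real.pi_gt_d4
  exact exp_ge_367.trans (Real.exp_le_exp.mpr (by nlinarith))

lemma norm_nome_eq_inv (z : ℂ) : ‖nome z‖ = (Real.exp (2 * Real.pi * z.im))⁻¹ := by
  rw [norm_nome, Real.exp_neg]

lemma norm_nome_le {z : ℂ} (hz : 3 / 4 ≤ z.im ^ 2) (hz0 : 0 < z.im) : ‖nome z‖ ≤ 1 / 230 := by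
  rw [norm_nome_eq_inv, one_div]
  exact inv_anti₀ (by norm_num) (exp_two_pi_mul_ge hz hz0).1

lemma inv_nome (z : ℂ) : (nome z)⁻¹ = Real.exp (2 * Real.pi * z.im) *
    (Real.cos (2 * Real.pi * z.re) - Real.sin (2 * Real.pi * z.re) * Complex.I) := by
  rw [nome, ← Complex.exp_neg]
  have h : -(2 * Real.pi * Complex.I * z) =
      ((2 * Real.pi * z.im : ℝ) : ℂ) + (-(2 * Real.pi * z.re) : ℝ) * Complex.I := by
    conv_lhs => rw [← Complex.re_add_im z]
    push_cast
    linear_combination (-2 * Real.pi * z.im : ℂ) * Complex.I_sq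
  rw [h, Complex.exp_add, Complex.exp_mul_I]
  simp
  ring

/-- The `q`-expansion `z + (i / 168π) (1 / q - 570 + P(q))` of `φ`, as a function on `ℂ`. It
represents `φ` where `‖q‖ ≤ 1 / 230`, by `phiNum_eq_phiFun_mul`. -/
noncomputable def phiFun (z : ℂ) : ℂ :=
  z + Complex.I / (168 * Real.pi) * ((nome z)⁻¹ - 570 + pSeries (nome z))

lemma E6Deriv_ne_zero_of_norm_nome_le {τ : ℍ} (h : ‖nome τ‖ ≤ 1 / 230) : E6Deriv τ ≠ 0 := by
  rw [E6Deriv_eq_powerSum (by linarith)]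
  exact mul_ne_zero (by simp [Real.pi_ne_zero, Complex.I_ne_zero])
    (mul_ne_zero (nome_ne_zero _) (bSeries_ne_zero h))

lemma phiNum_eq_phiFun_mul {τ : ℍ} (h : ‖nome τ‖ ≤ 1 / 230) :
    phiNum τ = phiFun τ * E6Deriv τ := by
  have hpi : (Real.pi : ℂ) ≠ 0 := by exact_mod_cast Real.pi_ne_zero
  have hb := bSeries_ne_zero h
  have hq := nome_ne_zero τ
  rw [phiNum, phiFun, add_mul, E6_eq_bSeries (by linarith), E6Deriv_eq_powerSum (by linarith),
    pSeries, ← bSeries]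
  field_simp
  linear_combination ((1008 : ℂ) * ((1 - 570 * nome τ) * bSeries (nome τ) +
    nome τ ^ 2 * powerSum remCoeff (nome τ))) * Complex.I_sq

lemma re_phiFun (z : ℂ) : (phiFun z).re = z.re + (Real.exp (2 * Real.pi * z.im) *
    Real.sin (2 * Real.pi * z.re) - (pSeries (nome z)).im) / (168 * Real.pi) := by
  have h : Complex.I / (168 * Real.pi) = (((168 * Real.pi)⁻¹ : ℝ) : ℂ) * Complex.I := by
    push_cast
    ring
  rw [phiFun, h, inv_nome, mul_assoc, Complex.add_re, Complex.re_ofReal_mul, Complex.I_mul_re]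
  simp only [Complex.add_im, Complex.sub_im, Complex.im_ofReal_mul, Complex.ofReal_im,
    Complex.ofReal_re, Complex.mul_I_im, Complex.im_ofNat]
  ring

lemma im_phiFun (z : ℂ) : (phiFun z).im = z.im + (Real.exp (2 * Real.pi * z.im) *
    Real.cos (2 * Real.pi * z.re) - 570 + (pSeries (nome z)).re) / (168 * Real.pi) := by
  have h : Complex.I / (168 * Real.pi) = (((168 * Real.pi)⁻¹ : ℝ) : ℂ) * Complex.I := by
    push_cast
    ring
  rw [phiFun, h, inv_nome, mul_assoc, Complex.add_im, Complex.im_ofReal_mul, Complex.I_mul_im]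
  simp only [Complex.add_re, Complex.sub_re, Complex.re_ofReal_mul, Complex.ofReal_im,
    Complex.ofReal_re, Complex.mul_I_re, Complex.re_ofNat]
  ring

lemma hasDerivAt_phiFun {z : ℂ} (h : ‖nome z‖ ≤ 1 / 230) : HasDerivAt phiFun
    (1 + ((nome z)⁻¹ - nome z * deriv pSeries (nome z)) / 84) z := by
  have hpi : (Real.pi : ℂ) ≠ 0 := by exact_mod_cast Real.pi_ne_zero
  have hq := nome_ne_zero z
  have h1 := hasDerivAt_nome z
  have h2 := (differentiableAt_pSeries h).hasDerivAt.comp z h1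
  have h3 := (hasDerivAt_id z).add ((((h1.inv hq).sub_const 570).add h2).const_mul
    (Complex.I / (168 * Real.pi)))
  refine h3.congr_deriv ?_
  field_simp
  linear_combination (168 * (-1 + nome z ^ 2 * deriv pSeries (nome z))) * Complex.I_sq

lemma norm_pSeries_nome_le {z : ℂ} {s : ℝ} (hs : 230 ≤ s)
    (h : s ≤ Real.exp (2 * Real.pi * z.im)) : ‖pSeries (nome z)‖ ≤ 31600 / s := by
  have h1 : ‖nome z‖ ≤ 1 / s := by
    rw [norm_nome_eq_inv, one_div]
    exact inv_anti₀ (by linarith) h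
  have h2 : 1 / s ≤ 1 / 230 := one_div_le_one_div_of_le (by norm_num) hs
  calc _ ≤ 31600 * ‖nome z‖ := norm_pSeries_le (h1.trans h2)
    _ ≤ 31600 * (1 / s) := by gcongr
    _ = _ := by ring

/-- Where `1 / q` has real part at most `-|1 / q| / 2`, the negative number `Re (1 / q) - 570`
outweighs `168π Im z`. -/
lemma im_phiFun_neg {z : ℂ} (hz : 3 / 4 ≤ z.im ^ 2) (hz0 : 0 < z.im)
    (hcos : Real.cos (2 * Real.pi * z.re) ≤ -1 / 2) : (phiFun z).im < 0 := by
  obtain ⟨h1, h2⟩ := exp_two_pi_mul_ge hz hz0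
  have hP := (Complex.abs_re_le_norm _).trans (norm_pSeries_nome_le le_rfl h1)
  have hP' := (abs_le.mp hP).2
  have hpi := Real.pi_lt_d4
  have hpi0 := Real.pi_pos
  rw [im_phiFun]
  set s := Real.exp (2 * Real.pi * z.im)
  have h3 : s * Real.cos (2 * Real.pi * z.re) ≤ s * (-1 / 2) := by gcongr
  have h4 : (s * Real.cos (2 * Real.pi * z.re) - 570 + (pSeries (nome z)).re) / (168 * Real.pi)
      < -z.im := by
    rw [div_lt_iff₀ (by positivity)]
    have : z.im * (168 * Real.pi) ≤ z.im * (168 * 3.1416) := by gcongr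
    linarith
  linarith

/-- Where `1 / q` has real part at least `|1 / q| / 2` and `Im z ≥ 0.94`, the possibly negative
number `Re (1 / q) - 570 ≥ 367 / 2 - 570` is outweighed by `168π Im z`. -/
lemma im_phiFun_pos {z : ℂ} (hz : 0.94 ≤ z.im)
    (hcos : 1 / 2 ≤ Real.cos (2 * Real.pi * z.re)) : 0 < (phiFun z).im := by
  have h1 := exp_two_pi_mul_ge_367 hz
  have hP := (Complex.abs_re_le_norm _).trans (norm_pSeries_nome_le (by norm_num) h1)
  have hP' := (abs_le.mp hP).1
  have hpi := Real.pi_gt_d4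
  rw [im_phiFun]
  set s := Real.exp (2 * Real.pi * z.im)
  have h3 : s * (1 / 2) ≤ s * Real.cos (2 * Real.pi * z.re) := by gcongr
  have h4 : -z.im <
      (s * Real.cos (2 * Real.pi * z.re) - 570 + (pSeries (nome z)).re) / (168 * Real.pi) := by
    rw [lt_div_iff₀ (by positivity)]
    nlinarith
  linarith

lemma sin_two_pi_mul_ge {x : ℝ} (h1 : 1 / 6 ≤ x) (h2 : x ≤ 1 / 3) :
    0.866 ≤ Real.sin (2 * Real.pi * x) := by
  have hpi := Real.pi_pos
  have h3 : 0.866 ≤ Real.cos (Real.pi / 6) := by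
    rw [Real.cos_pi_div_six, le_div_iff₀ (by norm_num)]
    exact Real.le_sqrt_of_sq_le (by norm_num)
  rw [← Real.cos_sub_pi_div_two, ← Real.cos_abs]
  refine h3.trans (Real.cos_le_cos_of_nonneg_of_le_pi (abs_nonneg _) (by linarith) ?_)
  rw [abs_le]
  constructor <;> nlinarith

lemma cos_two_pi_mul_ge {x : ℝ} (h1 : 0 ≤ x) (h2 : x ≤ 1 / 6) :
    1 / 2 ≤ Real.cos (2 * Real.pi * x) := by
  have hpi := Real.pi_pos
  rw [← Real.cos_pi_div_three]
  exact Real.cos_le_cos_of_nonneg_of_le_pi (by positivity) (by linarith) (by nlinarith)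

lemma cos_two_pi_mul_le {x : ℝ} (h1 : 1 / 3 ≤ x) (h2 : x ≤ 1 / 2) :
    Real.cos (2 * Real.pi * x) ≤ -1 / 2 := by
  have hpi := Real.pi_pos
  have : Real.cos (Real.pi - Real.pi / 3) = -1 / 2 := by
    rw [Real.cos_pi_sub, Real.cos_pi_div_three]
    norm_num
  rw [← this]
  exact Real.cos_le_cos_of_nonneg_of_le_pi (by linarith) (by nlinarith) (by nlinarith)

/-- The strip in which `φ` takes its real values on the left half of the fundamental domain. -/
def strip : Set ℂ := {z | 1 / 6 ≤ z.re ∧ z.re ≤ 1 / 3 ∧ 0.94 ≤ z.im}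

lemma norm_nome_le_of_mem_strip {z : ℂ} (hz : z ∈ strip) : ‖nome z‖ ≤ 1 / 367 := by
  rw [norm_nome_eq_inv, one_div]
  exact inv_anti₀ (by norm_num) (exp_two_pi_mul_ge_367 hz.2.2)

lemma norm_nome_le_of_mem_strip' {z : ℂ} (hz : z ∈ strip) : ‖nome z‖ ≤ 1 / 230 :=
  (norm_nome_le_of_mem_strip hz).trans (by norm_num)

lemma convex_strip : Convex ℝ strip :=
  (convex_halfSpace_re_ge _).inter ((convex_halfSpace_re_le _).inter (convex_halfSpace_im_ge _))

/-- On the strip `φ' ≈ 1 + 1 / (84 q)`, and `Im (1 / q)` is negative there; so `Re (i φ') > 0`. -/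
lemma injOn_phiFun : Set.InjOn phiFun strip := by
  refine injOn_of_re_mul_deriv_pos convex_strip Complex.I
    (fun z hz ↦ hasDerivAt_phiFun (norm_nome_le_of_mem_strip' hz)) fun z hz ↦ ?_
  have h1 := exp_two_pi_mul_ge_367 hz.2.2
  have h2 := sin_two_pi_mul_ge hz.1 hz.2.1
  have h3 := (Complex.abs_im_le_norm _).trans
    (norm_mul_deriv_pSeries_le (norm_nome_le_of_mem_strip hz))
  have h4 := (abs_le.mp h3).1
  rw [Complex.I_mul_re, Complex.add_im, show (84 : ℂ) = ((84 : ℝ) : ℂ) by norm_num,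
    Complex.div_ofReal_im, Complex.sub_im, inv_nome, Complex.im_ofReal_mul]
  simp only [Complex.sub_im, Complex.ofReal_im, Complex.mul_I_im, Complex.ofReal_re,
    Complex.one_im]
  nlinarith

/-- On the strip `φ` has positive real part, which tends to infinity with `Im z`. -/
lemma re_phiFun_ge {z : ℂ} (hz : z ∈ strip) :
    0 < (phiFun z).re ∧ 0.866 * z.im - 87 ≤ (168 * Real.pi) * (phiFun z).re := by
  have h1 := exp_two_pi_mul_ge_367 hz.2.2
  have h2 := sin_two_pi_mul_ge hz.1 hz.2.1
  have hP := (Complex.abs_im_le_norm _).trans (norm_pSeries_nome_le (by norm_num) h1)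
  have hP' := (abs_le.mp hP).2
  have hpi := Real.pi_gt_d4
  have h0 : 0 < 168 * Real.pi := by positivity
  have hs : z.im ≤ Real.exp (2 * Real.pi * z.im) := by
    have := Real.add_one_le_exp (2 * Real.pi * z.im)
    nlinarith [hz.2.2]
  rw [re_phiFun, mul_add, mul_div_cancel₀ _ h0.ne']
  set s := Real.exp (2 * Real.pi * z.im)
  have h3 : s * 0.866 ≤ s * Real.sin (2 * Real.pi * z.re) := by gcongr
  have hx := hz.1
  constructor
  · have : 0 < (s * Real.sin (2 * Real.pi * z.re) - (pSeries (nome z)).im) / (168 * Real.pi) :=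
      div_pos (by linarith) h0
    linarith
  · have : 0 < 168 * Real.pi * z.re := by positivity
    linarith

lemma three_fourths_le_im_sq {z : ℂ} (h0 : 0 ≤ z.re) (h1 : z.re ≤ 1 / 2) (h : 1 ≤ ‖z‖) :
    3 / 4 ≤ z.im ^ 2 := by
  have h2 : 1 ≤ ‖z‖ ^ 2 := by nlinarith
  rw [← Complex.normSq_eq_norm_sq, Complex.normSq_apply] at h2
  nlinarith

/-- Outside the strip, `φ` has no real values on the left half of the fundamental domain. -/
lemma mem_strip_of_im_phiFun_eq_zero {z : ℂ} (h0 : 0 ≤ z.re) (h1 : z.re ≤ 1 / 2) (h : 1 ≤ ‖z‖)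
    (him : 0 < z.im) (hz : (phiFun z).im = 0) :
    z ∈ strip ∧ 1 / 6 < z.re ∧ z.re < 1 / 3 := by
  have h2 : 1 ≤ ‖z‖ ^ 2 := by nlinarith
  rw [← Complex.normSq_eq_norm_sq, Complex.normSq_apply] at h2
  have h3 : z.re < 1 / 3 := by
    by_contra! hc
    exact (im_phiFun_neg (three_fourths_le_im_sq h0 h1 h) him (cos_two_pi_mul_le hc h1)).ne hz
  -- Here `(Im z)² ≥ 1 - 1 / 9 > 0.94²`.
  have h4 : 0.94 ≤ z.im := by nlinarith
  have h5 : 1 / 6 < z.re := by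
    by_contra! hc
    exact (im_phiFun_pos h4 (cos_two_pi_mul_ge h0 hc)).ne' hz
  exact ⟨⟨h5.le, h3.le, h4⟩, h5, h3⟩

/-! ### The real values of `φ` on the fundamental domain -/

lemma coe_gamma1_smul (τ : ℍ) : ((gamma1 • τ : ℍ) : ℂ) = 1 / (1 - τ) := by
  rw [coe_smul_eq]
  simp [gamma1]
  ring

lemma coe_gamma2_smul (τ : ℍ) : ((gamma2 • τ : ℍ) : ℂ) = (τ - 1) / τ := by
  rw [coe_smul_eq]
  simp [gamma2]
  ring

lemma E6Deriv_gamma1_smul (τ : ℍ) :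
    E6Deriv (gamma1 • τ) = (1 - τ) ^ 7 * (E6Deriv τ - phiNum τ) := by
  rw [E6Deriv_smul]
  simp [gamma1]
  ring

lemma phiNum_gamma1_smul (τ : ℍ) : phiNum (gamma1 • τ) = (1 - τ) ^ 7 * E6Deriv τ := by
  rw [phiNum_smul]
  simp [gamma1]
  exact Or.inl (by ring)

lemma E6Deriv_gamma2_smul (τ : ℍ) : E6Deriv (gamma2 • τ) = τ ^ 7 * phiNum τ := by
  rw [E6Deriv_smul]
  simp [gamma2]

lemma phiNum_gamma2_smul (τ : ℍ) :
    phiNum (gamma2 • τ) = τ ^ 7 * (phiNum τ - E6Deriv τ) := by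
  rw [phiNum_smul]
  simp [gamma2]
  exact Or.inl (by ring)

/-- The reflection `τ ↦ 1 - τ̄` acts on the unit circle as the modular transformation `γ₂`. -/
lemma reflect_eq_gamma2_smul {τ : ℍ} (h : ‖(τ : ℂ)‖ = 1) : reflect τ = gamma2 • τ := by
  ext
  rw [coe_reflect, coe_gamma2_smul, sub_div, div_self τ.ne_zero, one_div,
    Complex.inv_eq_conj h]

/-- `|φ| = 1` on the unit circle: the value of `E₆'` at `γ₂ τ` is `τ ^ 7` times the numerator of `φ`
by modularity, and the negative of the conjugate of `E₆'(τ)` as `γ₂ τ` is the reflection of `τ`. -/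
lemma norm_phiNum_eq {τ : ℍ} (h : ‖(τ : ℂ)‖ = 1) : ‖phiNum τ‖ = ‖E6Deriv τ‖ := by
  have h1 := E6Deriv_reflect τ
  rw [reflect_eq_gamma2_smul h, E6Deriv_gamma2_smul] at h1
  simpa [h] using congrArg norm h1

lemma norm_phiFun_eq_one {z : ℂ} (hz : 0 < z.im) (h : ‖z‖ = 1) (hq : ‖nome z‖ ≤ 1 / 230) :
    ‖phiFun z‖ = 1 := by
  have h1 := norm_phiNum_eq (τ := ⟨z, hz⟩) h
  rw [phiNum_eq_phiFun_mul hq, norm_mul] at h1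
  exact mul_right_cancel₀ (norm_ne_zero_iff.mpr (E6Deriv_ne_zero_of_norm_nome_le hq))
    (h1.trans (one_mul _).symm)

lemma eq_one_of_norm_phiFun {z : ℂ} (hz : z ∈ strip) (h : ‖z‖ = 1) {C : ℝ}
    (hC : phiFun z = C) : C = 1 := by
  have h1 := norm_phiFun_eq_one (by linarith [hz.2.2]) h (norm_nome_le_of_mem_strip' hz)
  have h2 := (re_phiFun_ge hz).1
  rw [hC] at h1 h2
  rw [Complex.ofReal_re] at h2
  rwa [Complex.norm_real, Real.norm_of_nonneg h2.le] at h1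

lemma continuousOn_phiFun : ContinuousOn phiFun strip := fun _ hz ↦
  (hasDerivAt_phiFun (norm_nome_le_of_mem_strip' hz)).continuousAt.continuousWithinAt

/-- On each continuous arc that crosses the strip, `φ` takes a real value. -/
lemma exists_im_phiFun_eq_zero {f : ℝ → ℝ} (hf : ContinuousOn f (Set.Icc (1 / 6) (1 / 3)))
    (hf1 : ∀ x ∈ Set.Icc (1 / 6 : ℝ) (1 / 3), 0.94 ≤ f x) :
    ∃ x ∈ Set.Icc (1 / 6 : ℝ) (1 / 3), (phiFun ⟨x, f x⟩).im = 0 := by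
  have hc : ContinuousOn (fun x : ℝ ↦ (⟨x, f x⟩ : ℂ)) (Set.Icc (1 / 6) (1 / 3)) := by
    have : ContinuousOn (fun x : ℝ ↦ (x + f x * Complex.I : ℂ)) (Set.Icc (1 / 6) (1 / 3)) := by
      fun_prop
    exact this.congr fun x _ ↦ Complex.mk_eq_add_mul_I x (f x)
  have hg : ContinuousOn (fun x : ℝ ↦ (phiFun ⟨x, f x⟩).im) (Set.Icc (1 / 6) (1 / 3)) :=
    Complex.continuous_im.comp_continuousOn
      (continuousOn_phiFun.comp hc fun x hx ↦ ⟨hx.1, hx.2, hf1 x hx⟩)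
  have hl : 0 < (phiFun ⟨1 / 6, f (1 / 6)⟩).im :=
    im_phiFun_pos (hf1 _ (by constructor <;> norm_num))
      (cos_two_pi_mul_ge (by norm_num) (by norm_num))
  have hr : (phiFun ⟨1 / 3, f (1 / 3)⟩).im < 0 := by
    have := hf1 (1 / 3) (by constructor <;> norm_num)
    exact im_phiFun_neg (by simp only; nlinarith) (by simp only; linarith)
      (cos_two_pi_mul_le (by norm_num) (by norm_num))
  exact intermediate_value_Icc' (by norm_num) hg ⟨hr.le, hl.le⟩

/-- On the arc of the unit circle in the strip, `φ` takes a real value; this is `1`, as `|φ| = 1`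
and `Re φ > 0`. -/
lemma exists_phiFun_eq_one : ∃ z ∈ strip, ‖z‖ = 1 ∧ phiFun z = 1 := by
  have hx : ∀ x ∈ Set.Icc (1 / 6 : ℝ) (1 / 3), 0.94 ≤ √(1 - x ^ 2) := fun x hx ↦
    Real.le_sqrt_of_sq_le (by nlinarith [hx.1, hx.2])
  obtain ⟨x, hx1, hx2⟩ := exists_im_phiFun_eq_zero (f := fun x ↦ √(1 - x ^ 2)) (by fun_prop) hx
  have hmem : (⟨x, √(1 - x ^ 2)⟩ : ℂ) ∈ strip := ⟨hx1.1, hx1.2, hx x hx1⟩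
  have hnorm : ‖(⟨x, √(1 - x ^ 2)⟩ : ℂ)‖ = 1 := by
    rw [← sq_eq_sq₀ (norm_nonneg _) zero_le_one, ← Complex.normSq_eq_norm_sq, Complex.normSq_mk,
      Real.mul_self_sqrt (by nlinarith [hx1.1, hx1.2])]
    ring
  have hre : phiFun ⟨x, √(1 - x ^ 2)⟩ = ((phiFun ⟨x, √(1 - x ^ 2)⟩).re : ℂ) :=
    Complex.ext rfl hx2
  refine ⟨_, hmem, hnorm, ?_⟩
  rw [hre, eq_one_of_norm_phiFun hmem hnorm hre, Complex.ofReal_one]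

lemma norm_eq_one_of_phiFun_eq_one {z : ℂ} (hz : z ∈ strip) (h : phiFun z = 1) : ‖z‖ = 1 := by
  obtain ⟨w, hw, hw1, hw2⟩ := exists_phiFun_eq_one
  rwa [injOn_phiFun hz hw (h.trans hw2.symm)]

/-- The open part of the strip outside the unit circle. -/
def outerStrip : Set ℂ := {z | 1 / 6 < z.re ∧ z.re < 1 / 3 ∧ 0.94 < z.im ∧ 1 < ‖z‖}

lemma outerStrip_subset : outerStrip ⊆ strip := fun _ h ↦ ⟨h.1.le, h.2.1.le, h.2.2.1.le⟩

lemma isOpen_outerStrip : IsOpen outerStrip :=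
  (isOpen_lt continuous_const Complex.continuous_re).inter
    ((isOpen_lt Complex.continuous_re continuous_const).inter
      ((isOpen_lt continuous_const Complex.continuous_im).inter
        (isOpen_lt continuous_const continuous_norm)))

lemma mem_outerStrip {z : ℂ} (hz : z ∈ strip) (h1 : 1 ≤ ‖z‖) {C : ℝ} (hC : C ≠ 1)
    (h : phiFun z = C) : z ∈ outerStrip := by
  obtain ⟨-, h2, h3⟩ := mem_strip_of_im_phiFun_eq_zero (by linarith [hz.1])
    (by linarith [hz.2.1]) h1 (by linarith [hz.2.2]) (by rw [h, Complex.ofReal_im])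
  have h4 : 1 < ‖z‖ := lt_of_le_of_ne h1 fun h5 ↦ hC (eq_one_of_norm_phiFun hz h5.symm h)
  refine ⟨h2, h3, ?_, h4⟩
  have h5 : 1 < ‖z‖ ^ 2 := by nlinarith
  rw [← Complex.normSq_eq_norm_sq, Complex.normSq_apply] at h5
  nlinarith [hz.2.2]

/-- The set of real values of `φ` on the open part of the strip outside the unit circle. -/
def realValues : Set ℝ := {C | ∃ z ∈ outerStrip, phiFun z = C}

/-- Being holomorphic and injective on the outer strip, `φ` is an open map there. -/
lemma isOpen_realValues : IsOpen realValues := by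
  rw [isOpen_iff_mem_nhds]
  rintro C ⟨z, hz, hC⟩
  have hq := norm_nome_le_of_mem_strip' (outerStrip_subset hz)
  have hopen : 𝓝 (phiFun z) ≤ map phiFun (𝓝 z) := by
    have han : AnalyticAt ℂ phiFun z := by
      have hd : DifferentiableOn ℂ phiFun outerStrip := fun w hw ↦
        (hasDerivAt_phiFun (norm_nome_le_of_mem_strip'
          (outerStrip_subset hw))).differentiableAt.differentiableWithinAt
      exact hd.analyticAt (isOpen_outerStrip.mem_nhds hz)
    refine han.eventually_constant_or_nhds_le_map_nhds.resolve_left fun hconst ↦ ?_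
    obtain ⟨w, ⟨hw1, hw2⟩, hw3⟩ := ((hconst.and (isOpen_outerStrip.mem_nhds hz)).filter_mono
      nhdsWithin_le_nhds |>.and (eventually_mem_nhdsWithin (s := {z}ᶜ))).exists
    exact hw3 (injOn_phiFun (outerStrip_subset hw2) (outerStrip_subset hz) hw1)
  have himage : phiFun '' outerStrip ∈ 𝓝 (phiFun z) :=
    hopen (image_mem_map (isOpen_outerStrip.mem_nhds hz))
  rw [hC] at himage
  exact Complex.continuous_ofReal.continuousAt.preimage_mem_nhds himage

/-- The set of real values of `φ` on the outer strip is closed up to the value `1`: the preimage of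
a bounded set of values is bounded, and on the boundary of the outer strip the only real value of
`φ` is `1`. -/
lemma closure_realValues_inter_subset : closure realValues ∩ {1}ᶜ ⊆ realValues := by
  rintro C ⟨hC, hC1⟩
  -- Real values below `C + 1` are taken at heights `Im z ≤ B`, by `re_phiFun_ge`.
  set B : ℝ := (168 * Real.pi * (C + 1) + 87) / 0.866 with hB
  set K : Set ℂ := (Set.Icc (1 / 6) (1 / 3) ×ℂ Set.Icc 0.94 B) ∩ {z | 1 ≤ ‖z‖} with hK
  have hKc : IsCompact K := (isCompact_Icc.reProdIm isCompact_Icc).inter_right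
    (isClosed_le continuous_const continuous_norm)
  have hKs : K ⊆ strip := fun z hz ↦ ⟨hz.1.1.1, hz.1.1.2, hz.1.2.1⟩
  have hcl : IsClosed ((fun x : ℝ ↦ (x : ℂ)) ⁻¹' (phiFun '' K)) :=
    (hKc.image_of_continuousOn (continuousOn_phiFun.mono hKs)).isClosed.preimage
      Complex.continuous_ofReal
  have hsub : realValues ∩ Set.Iio (C + 1) ⊆ (fun x : ℝ ↦ (x : ℂ)) ⁻¹' (phiFun '' K) := by
    rintro D ⟨⟨z, hz, hD⟩, hD1⟩
    refine ⟨z, ⟨⟨⟨hz.1.le, hz.2.1.le⟩, hz.2.2.1.le, ?_⟩, hz.2.2.2.le⟩, hD⟩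
    have h1 := (re_phiFun_ge (outerStrip_subset hz)).2
    rw [hD, Complex.ofReal_re] at h1
    have h2 : 168 * Real.pi * D ≤ 168 * Real.pi * (C + 1) := by
      have := Real.pi_pos
      have := (Set.mem_Iio.mp hD1).le
      gcongr
    rw [hB, le_div_iff₀ (by norm_num)]
    linarith
  have hmem : C ∈ closure (realValues ∩ Set.Iio (C + 1)) := by
    rw [Set.inter_comm]
    exact isOpen_Iio.inter_closure ⟨by simp, hC⟩
  obtain ⟨z, hz, hzC⟩ := closure_minimal hsub hcl hmem
  exact ⟨z, mem_outerStrip (hKs hz) hz.2 hC1 hzC, hzC⟩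

/-- High up in the strip, where `Re φ` is large, `φ` takes a real value. -/
lemma exists_mem_realValues : ∃ C ∈ realValues, 1 < C := by
  obtain ⟨x, hx, hx1⟩ := exists_im_phiFun_eq_zero (f := fun _ ↦ 1000) (by fun_prop)
    (fun _ _ ↦ by norm_num)
  have hmem : (⟨x, 1000⟩ : ℂ) ∈ strip := ⟨hx.1, hx.2, by norm_num⟩
  have h1 := (re_phiFun_ge hmem).2
  have hre : 1 < (phiFun ⟨x, 1000⟩).re := by
    have hpi := Real.pi_lt_d4
    by_contra! hc
    have : 168 * Real.pi * (phiFun ⟨x, 1000⟩).re ≤ 168 * Real.pi * 1 := by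
      have := Real.pi_pos
      gcongr
    norm_num at h1
    linarith
  have hnorm : 1 ≤ ‖(⟨x, 1000⟩ : ℂ)‖ := by
    have := Complex.abs_im_le_norm ⟨x, 1000⟩
    norm_num at this
    linarith
  have heq : phiFun ⟨x, 1000⟩ = ((phiFun ⟨x, 1000⟩).re : ℂ) := Complex.ext rfl hx1
  exact ⟨_, ⟨_, mem_outerStrip hmem hnorm hre.ne' heq, heq⟩, hre⟩

/-- The real values above `1` form a nonempty open and closed part of the ray `(1, ∞)`. -/
lemma Ioi_subset_realValues : Set.Ioi 1 ⊆ realValues := by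
  refine isPreconnected_Ioi.subset_of_closure_inter_subset isOpen_realValues ?_ ?_
  · obtain ⟨C, hC, hC1⟩ := exists_mem_realValues
    exact ⟨C, hC1, hC⟩
  · exact fun C hC ↦ closure_realValues_inter_subset ⟨hC.1, (Set.mem_Ioi.mp hC.2).ne'⟩

/-- A real value below `1` would, by connectedness, force the value `0`, but `φ` has positive real
part on the strip. -/
lemma one_le_of_mem_realValues {C : ℝ} (hC : C ∈ realValues) : 1 ≤ C := by
  by_contra! hlt
  have h : Set.Iio 1 ⊆ realValues := by
    refine isPreconnected_Iio.subset_of_closure_inter_subset isOpen_realValues ⟨C, hlt, hC⟩ ?_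
    exact fun C hC ↦ closure_realValues_inter_subset ⟨hC.1, (Set.mem_Iio.mp hC.2).ne⟩
  obtain ⟨z, hz, hz0⟩ := h (show (0 : ℝ) ∈ Set.Iio 1 by simp)
  have := (re_phiFun_ge (outerStrip_subset hz)).1
  rw [hz0] at this
  simp at this

/-- The real values of `φ` on the left half of the fundamental domain. -/
lemma phiFun_real {z : ℂ} (h0 : 0 ≤ z.re) (h1 : z.re ≤ 1 / 2) (h : 1 ≤ ‖z‖) (him : 0 < z.im)
    {C : ℝ} (hz : phiFun z = C) :
    z ∈ strip ∧ 1 / 6 < z.re ∧ z.re < 1 / 3 ∧ 1 ≤ C ∧ (C = 1 ↔ ‖z‖ = 1) := by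
  obtain ⟨h2, h3, h4⟩ := mem_strip_of_im_phiFun_eq_zero h0 h1 h him (by rw [hz, Complex.ofReal_im])
  refine ⟨h2, h3, h4, ?_, ?_, fun h5 ↦ eq_one_of_norm_phiFun h2 h5 hz⟩
  · by_cases hC : C = 1
    · exact hC.ge
    · exact one_le_of_mem_realValues ⟨z, mem_outerStrip h2 h hC hz, hz⟩
  · rintro rfl
    exact norm_eq_one_of_phiFun_eq_one h2 (by simpa using hz)

lemma exists_phiFun_eq {C : ℝ} (hC : 1 ≤ C) : ∃ z ∈ strip, 1 ≤ ‖z‖ ∧ phiFun z = C := by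
  rcases hC.eq_or_lt with rfl | hC
  · obtain ⟨z, hz, h1, h2⟩ := exists_phiFun_eq_one
    exact ⟨z, hz, h1.ge, by simpa using h2⟩
  · obtain ⟨z, hz, h⟩ := Ioi_subset_realValues hC
    exact ⟨z, outerStrip_subset hz, hz.2.2.2.le, h⟩

/-! ### Values of `φ` on the fundamental domain `F` -/

lemma normSq_coe (τ : ℍ) : Complex.normSq τ = τ.re * τ.re + τ.im * τ.im := by
  rw [Complex.normSq_apply, coe_re, coe_im]

lemma one_le_norm_iff (z : ℂ) : 1 ≤ ‖z‖ ↔ 1 ≤ Complex.normSq z := by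
  rw [Complex.normSq_eq_norm_sq, one_le_sq_iff₀ (norm_nonneg z)]

lemma norm_eq_one_iff_normSq (z : ℂ) : ‖z‖ = 1 ↔ Complex.normSq z = 1 := by
  rw [Complex.normSq_eq_norm_sq, pow_eq_one_iff_of_nonneg (norm_nonneg z) two_ne_zero]

lemma normSq_coe_sub_one (τ : ℍ) :
    Complex.normSq ((τ : ℂ) - 1) = Complex.normSq τ - 2 * τ.re + 1 := by
  rw [normSq_coe, Complex.normSq_apply]
  simp
  ring

lemma mem_F_iff {τ : ℍ} : τ ∈ F ↔ 0 ≤ τ.re ∧ τ.re ≤ 1 ∧ 1 ≤ Complex.normSq τ ∧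
    2 * τ.re ≤ Complex.normSq τ := by
  rw [F, Set.mem_ofPred_eq, one_le_norm_iff, one_le_norm_iff, normSq_coe_sub_one]
  refine and_congr_right fun _ ↦ and_congr_right fun _ ↦ and_congr_right fun _ ↦ ?_
  constructor <;> intro <;> linarith

lemma mem_F0_iff {τ : ℍ} : τ ∈ F0 ↔ 0 ≤ τ.re ∧ τ.re ≤ 1 ∧ τ.re ≤ Complex.normSq τ := by
  rw [F0, Set.mem_ofPred_eq]
  refine and_congr_right fun _ ↦ and_congr_right fun _ ↦ ?_
  rw [← sq_le_sq₀ (by norm_num) (norm_nonneg _), ← Complex.normSq_eq_norm_sq, normSq_coe,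
    Complex.normSq_apply]
  simp
  constructor <;> intro <;> linarith

lemma mem_interior_F0 {τ : ℍ} (h0 : 0 < τ.re) (h1 : τ.re < 1)
    (h : τ.re < Complex.normSq τ) : τ ∈ interior F0 := by
  rw [mem_interior]
  refine ⟨{τ : ℍ | 0 < τ.re ∧ τ.re < 1 ∧ τ.re < Complex.normSq τ}, fun σ hσ ↦
    mem_F0_iff.mpr ⟨hσ.1.le, hσ.2.1.le, hσ.2.2.le⟩, ?_, h0, h1, h⟩
  have hre : Continuous UpperHalfPlane.re := UpperHalfPlane.continuous_re
  have hn : Continuous fun τ : ℍ ↦ Complex.normSq τ :=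
    Complex.continuous_normSq.comp UpperHalfPlane.continuous_coe
  exact (isOpen_lt continuous_const hre).inter
    ((isOpen_lt hre continuous_const).inter (isOpen_lt hre hn))

lemma normSq_reflect (τ : ℍ) :
    Complex.normSq (reflect τ) = Complex.normSq τ - 2 * τ.re + 1 := by
  rw [normSq_coe, normSq_coe, re_reflect, im_reflect]
  ring

lemma reflect_mem_F {τ : ℍ} (h : τ ∈ F) : reflect τ ∈ F := by
  rw [mem_F_iff] at *
  rw [re_reflect, normSq_reflect]
  refine ⟨?_, ?_, ?_, ?_⟩ <;> linarith

lemma reflect_mem_F0 {τ : ℍ} (h : τ ∈ F0) : reflect τ ∈ F0 := by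
  rw [mem_F0_iff] at *
  rw [re_reflect, normSq_reflect]
  refine ⟨?_, ?_, ?_⟩ <;> linarith

lemma phiNum_reflect_eq {τ : ℍ} {C : ℝ} (h : phiNum τ = C * E6Deriv τ) :
    phiNum (reflect τ) = (1 - C : ℝ) * E6Deriv (reflect τ) := by
  rw [phiNum_reflect, E6Deriv_reflect, h]
  simp
  ring

lemma norm_nome_le_of_mem_F {τ : ℍ} (h : τ ∈ F) : ‖nome τ‖ ≤ 1 / 230 := by
  rw [mem_F_iff, normSq_coe] at h
  refine norm_nome_le ?_ τ.im_pos
  rw [coe_im]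
  rcases le_total τ.re (1 / 2) with h1 | h1 <;> nlinarith

lemma E6Deriv_ne_zero_of_mem_F {τ : ℍ} (h : τ ∈ F) : E6Deriv τ ≠ 0 :=
  E6Deriv_ne_zero_of_norm_nome_le (norm_nome_le_of_mem_F h)

lemma phiFun_eq_iff {τ : ℍ} (h : τ ∈ F) {C : ℝ} :
    phiFun τ = C ↔ phiNum τ = C * E6Deriv τ := by
  rw [phiNum_eq_phiFun_mul (norm_nome_le_of_mem_F h),
    mul_left_inj' (E6Deriv_ne_zero_of_mem_F h)]

/-- The real values of `φ` on the left half of `F`. -/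
lemma phiNum_real_of_re_le {τ : ℍ} (h : τ ∈ F) (hre : τ.re ≤ 1 / 2) {C : ℝ}
    (hC : phiNum τ = C * E6Deriv τ) :
    (τ : ℂ) ∈ strip ∧ 0 < τ.re ∧ τ.re < 1 / 2 ∧ 1 ≤ C ∧ (C = 1 ↔ Complex.normSq τ = 1) := by
  obtain ⟨h1, h2, h3, h4, h5⟩ := phiFun_real (z := τ) h.1 hre h.2.2.1 τ.im_pos
    ((phiFun_eq_iff h).mpr hC)
  rw [coe_re] at h2 h3
  rw [norm_eq_one_iff_normSq] at h5
  exact ⟨h1, by linarith, by linarith, h4, h5⟩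

/-- The real values of `φ` on the right half of `F`, by reflection. -/
lemma phiNum_real_of_le_re {τ : ℍ} (h : τ ∈ F) (hre : 1 / 2 ≤ τ.re) {C : ℝ}
    (hC : phiNum τ = C * E6Deriv τ) :
    (reflect τ : ℂ) ∈ strip ∧ 1 / 2 < τ.re ∧ τ.re < 1 ∧ C ≤ 0 ∧
      (C = 0 ↔ Complex.normSq τ = 2 * τ.re) := by
  obtain ⟨h1, h2, h3, h4, h5⟩ := phiNum_real_of_re_le (reflect_mem_F h)
    (by rw [re_reflect]; linarith) (phiNum_reflect_eq hC)
  rw [re_reflect] at h2 h3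
  rw [normSq_reflect] at h5
  refine ⟨h1, by linarith, by linarith, by linarith, ?_⟩
  constructor
  · rintro rfl
    linarith [h5.mp (by ring)]
  · intro h6
    linarith [h5.mpr (by linarith)]

/-- `φ` takes each real value at most once on `F`. -/
lemma eq_of_phiNum_eq {τ σ : ℍ} (hτ : τ ∈ F) (hσ : σ ∈ F) {C : ℝ}
    (h1 : phiNum τ = C * E6Deriv τ) (h2 : phiNum σ = C * E6Deriv σ) : τ = σ := by
  have key : ∀ {τ σ : ℍ} {C : ℝ}, τ ∈ F → σ ∈ F → τ.re ≤ 1 / 2 → σ.re ≤ 1 / 2 →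
      phiNum τ = C * E6Deriv τ → phiNum σ = C * E6Deriv σ → τ = σ := by
    intro τ σ C hτ hσ hτ1 hσ1 h1 h2
    ext
    exact injOn_phiFun (phiNum_real_of_re_le hτ hτ1 h1).1 (phiNum_real_of_re_le hσ hσ1 h2).1
      (((phiFun_eq_iff hτ).mpr h1).trans ((phiFun_eq_iff hσ).mpr h2).symm)
  rcases le_total τ.re (1 / 2) with hτ1 | hτ1 <;> rcases le_total σ.re (1 / 2) with hσ1 | hσ1
  · exact key hτ hσ hτ1 hσ1 h1 h2
  · linarith [(phiNum_real_of_re_le hτ hτ1 h1).2.2.2.1, (phiNum_real_of_le_re hσ hσ1 h2).2.2.2.1]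
  · linarith [(phiNum_real_of_le_re hτ hτ1 h1).2.2.2.1, (phiNum_real_of_re_le hσ hσ1 h2).2.2.2.1]
  · have := key (reflect_mem_F hτ) (reflect_mem_F hσ) (by rw [re_reflect]; linarith)
      (by rw [re_reflect]; linarith) (phiNum_reflect_eq h1) (phiNum_reflect_eq h2)
    rw [← reflect_reflect τ, this, reflect_reflect]

/-- `φ` takes each real value outside the interval `(0, 1)` on `F`. -/
lemma exists_phiNum_eq {C : ℝ} (hC : 1 ≤ C ∨ C ≤ 0) : ∃ τ ∈ F, phiNum τ = C * E6Deriv τ := by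
  have key : ∀ {C : ℝ}, 1 ≤ C → ∃ τ ∈ F, phiNum τ = C * E6Deriv τ := by
    intro C hC
    obtain ⟨z, hz, hz1, hzC⟩ := exists_phiFun_eq hC
    set τ : ℍ := ⟨z, by linarith [hz.2.2]⟩
    have hτ : τ ∈ F := by
      rw [one_le_norm_iff] at hz1
      refine mem_F_iff.mpr ⟨?_, ?_, hz1, ?_⟩
      · linarith [show τ.re = z.re from rfl, hz.1]
      · linarith [show τ.re = z.re from rfl, hz.2.1]
      · linarith [show τ.re = z.re from rfl, hz.2.1,
          show Complex.normSq τ = Complex.normSq z from rfl]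
    exact ⟨τ, hτ, (phiFun_eq_iff hτ).mp hzC⟩
  rcases hC with hC | hC
  · exact key hC
  · obtain ⟨τ, hτ, h⟩ := key (show 1 ≤ 1 - C by linarith)
    refine ⟨reflect τ, reflect_mem_F hτ, ?_⟩
    have := phiNum_reflect_eq h
    rwa [sub_sub_cancel] at this

/-! ### Values of `φ` on the fundamental domain `F₀` -/

lemma gamma1_smul_gamma2_smul (τ : ℍ) : gamma1 • gamma2 • τ = τ := by
  ext
  rw [coe_gamma1_smul, coe_gamma2_smul]
  have := τ.ne_zero
  field_simp
  simp

lemma coe_sub_one_ne_zero (τ : ℍ) : (1 - τ : ℂ) ≠ 0 := by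
  have := denom_coe_ne_zero gamma1 τ
  simp [gamma1] at this
  rwa [sub_eq_neg_add]

lemma gamma2_smul_gamma1_smul (τ : ℍ) : gamma2 • gamma1 • τ = τ := by
  ext
  rw [coe_gamma2_smul, coe_gamma1_smul]
  have := coe_sub_one_ne_zero τ
  field_simp
  simp

lemma normSq_pos (τ : ℍ) : 0 < Complex.normSq τ := Complex.normSq_pos.mpr τ.ne_zero

lemma re_gamma2_smul (τ : ℍ) : (gamma2 • τ).re = 1 - τ.re / Complex.normSq τ := by
  rw [← coe_re, coe_gamma2_smul, sub_div, div_self τ.ne_zero, one_div, Complex.sub_re,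
    Complex.inv_re, Complex.one_re, coe_re]

lemma normSq_gamma2_smul (τ : ℍ) : Complex.normSq (gamma2 • τ : ℍ) =
    (Complex.normSq τ - 2 * τ.re + 1) / Complex.normSq τ := by
  rw [coe_gamma2_smul, Complex.normSq_div, normSq_coe_sub_one]

lemma re_gamma1_smul (τ : ℍ) :
    (gamma1 • τ).re = (1 - τ.re) / (Complex.normSq τ - 2 * τ.re + 1) := by
  rw [← coe_re, coe_gamma1_smul, one_div, Complex.inv_re, ← normSq_coe_sub_one,
    ← Complex.normSq_neg, neg_sub, Complex.sub_re, Complex.one_re, coe_re]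

lemma normSq_gamma1_smul (τ : ℍ) :
    Complex.normSq (gamma1 • τ : ℍ) = 1 / (Complex.normSq τ - 2 * τ.re + 1) := by
  rw [coe_gamma1_smul, Complex.normSq_div, Complex.normSq_one, ← normSq_coe_sub_one,
    ← Complex.normSq_neg, neg_sub]

lemma normSq_sub_pos (τ : ℍ) : 0 < Complex.normSq τ - 2 * τ.re + 1 := by
  rw [← normSq_coe_sub_one, Complex.normSq_pos, ← neg_ne_zero, neg_sub]
  exact coe_sub_one_ne_zero τ

lemma gamma2_smul_mem_F {τ : ℍ} (h : τ ∈ F0) (hre : τ.re ≤ 1 / 2)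
    (h1 : Complex.normSq τ ≤ 1) : gamma2 • τ ∈ F := by
  obtain ⟨h2, -, h3⟩ := mem_F0_iff.mp h
  have h0 := normSq_pos τ
  rw [mem_F_iff, re_gamma2_smul, normSq_gamma2_smul]
  refine ⟨?_, ?_, ?_, ?_⟩
  · rw [sub_nonneg, div_le_one h0]
    exact h3
  · linarith [div_nonneg h2 h0.le]
  · rw [one_le_div h0]
    linarith
  · rw [le_div_iff₀ h0]
    field_simp
    linarith

lemma gamma1_smul_mem_F0Left {σ : ℍ} (h0 : 0 < σ.re) (h1 : σ.re < 1)
    (h : 1 < Complex.normSq σ) : gamma1 • σ ∈ F0Left := by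
  have hm := normSq_sub_pos σ
  have hre : (gamma1 • σ).re < 1 / 2 := by
    rw [re_gamma1_smul, div_lt_iff₀ hm]
    linarith
  refine ⟨mem_interior_F0 ?_ (by linarith) ?_, hre⟩
  · rw [re_gamma1_smul]
    exact div_pos (by linarith) hm
  · rw [re_gamma1_smul, normSq_gamma1_smul]
    gcongr
    linarith

lemma phiNum_gamma2_smul_eq {τ : ℍ} {C : ℝ} (hC : C ≠ 0) (h : phiNum τ = C * E6Deriv τ) :
    phiNum (gamma2 • τ) = (1 - 1 / C : ℝ) * E6Deriv (gamma2 • τ) := by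
  have : (C : ℂ) ≠ 0 := by exact_mod_cast hC
  rw [phiNum_gamma2_smul, E6Deriv_gamma2_smul, h]
  push_cast
  field_simp

/-- If `φ` takes a real value `C` at a point in the left half of `F₀`, then either `1 ≤ C` and the
point lies in `F`, or `C < 1` and the point lies in the translate `γ₁ F`. -/
lemma phiNum_real_on_F0 {τ : ℍ} (h : τ ∈ F0) (hre : τ.re ≤ 1 / 2) {C : ℝ}
    (hC : phiNum τ = C * E6Deriv τ) :
    C ≠ 0 ∧ τ ∈ F0Left ∧ (τ ∈ F ∧ 1 ≤ C ∨ gamma2 • τ ∈ F ∧ C < 1) := by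
  rcases le_or_gt 1 (Complex.normSq τ) with h1 | h1
  · have hF : τ ∈ F := mem_F_iff.mpr ⟨h.1, h.2.1, h1, by linarith⟩
    obtain ⟨-, h2, h3, h4, -⟩ := phiNum_real_of_re_le hF hre hC
    exact ⟨by linarith, ⟨mem_interior_F0 h2 (by linarith) (by linarith), h3⟩, Or.inl ⟨hF, h4⟩⟩
  have hF := gamma2_smul_mem_F h hre h1.le
  -- Now `γ₂ τ` lies in `F`, and `φ(γ₂ τ) = 1 - 1 / C` is at least `1` or at most `0`. Here `C ≠ 0`
  -- as `E₆'(γ₂ τ) ≠ 0`; the value `1` is excluded as `C` is finite, and the value `0` as `τ` is not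
  -- on the unit circle.
  have hC0 : C ≠ 0 := by
    rintro rfl
    apply E6Deriv_ne_zero_of_mem_F hF
    rw [E6Deriv_gamma2_smul, hC]
    simp
  have hC' := phiNum_gamma2_smul_eq hC0 hC
  have hinv : 1 / C ≠ 0 := one_div_ne_zero hC0
  have hsq : Complex.normSq (gamma2 • τ : ℍ) - 2 * (gamma2 • τ).re = 1 / Complex.normSq τ - 1 := by
    have := (normSq_pos τ).ne'
    rw [normSq_gamma2_smul, re_gamma2_smul]
    field_simp
    ring
  have hlt : 1 < 1 / Complex.normSq τ := (one_lt_div (normSq_pos τ)).mpr h1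
  rw [← gamma1_smul_gamma2_smul τ, gamma2_smul_gamma1_smul]
  refine ⟨hC0, ?_⟩
  rcases le_total (gamma2 • τ).re (1 / 2) with h2 | h2
  · obtain ⟨-, h3, h4, h5, h6⟩ := phiNum_real_of_re_le hF h2 hC'
    refine ⟨gamma1_smul_mem_F0Left h3 (by linarith) (lt_of_le_of_ne (mem_F_iff.mp hF).2.2.1 ?_),
      Or.inr ⟨hF, ?_⟩⟩
    · intro h7
      have := h6.mpr h7.symm
      exact hinv (by linarith)
    · by_contra! hc
      have : 0 < 1 / C := by positivity
      linarith
  · obtain ⟨-, h3, h4, h5, h6⟩ := phiNum_real_of_le_re hF h2 hC'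
    refine ⟨gamma1_smul_mem_F0Left (by linarith) h4 (by linarith), Or.inr ⟨hF, ?_⟩⟩
    have h7 : 1 - 1 / C < 0 := lt_of_le_of_ne h5 fun h8 ↦ by
      have := h6.mp h8
      linarith
    by_contra! hc
    have : 1 / C ≤ 1 := by rw [div_le_one (by linarith)]; exact hc
    linarith

/-- `φ` takes each real value at most once on the left half of `F₀`: values `C ≥ 1` on `F` and
values `C < 1` on `γ₁ F`. -/
lemma eq_of_phiNum_eq_on_F0 {τ σ : ℍ} (hτ : τ ∈ F0) (hσ : σ ∈ F0) (hτ1 : τ.re ≤ 1 / 2)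
    (hσ1 : σ.re ≤ 1 / 2) {C : ℝ} (h1 : phiNum τ = C * E6Deriv τ)
    (h2 : phiNum σ = C * E6Deriv σ) : τ = σ := by
  obtain ⟨hC, -, h3 | h3⟩ := phiNum_real_on_F0 hτ hτ1 h1 <;>
    obtain ⟨-, -, h4 | h4⟩ := phiNum_real_on_F0 hσ hσ1 h2
  · exact eq_of_phiNum_eq h3.1 h4.1 h1 h2
  · linarith [h3.2, h4.2]
  · linarith [h3.2, h4.2]
  · have := eq_of_phiNum_eq h3.1 h4.1 (phiNum_gamma2_smul_eq hC h1) (phiNum_gamma2_smul_eq hC h2)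
    rw [← gamma1_smul_gamma2_smul τ, this, gamma1_smul_gamma2_smul]

lemma phiNum_gamma1_smul_eq {τ : ℍ} {C : ℝ} (hC : C ≠ 0)
    (h : phiNum τ = (1 - 1 / C : ℝ) * E6Deriv τ) :
    phiNum (gamma1 • τ) = C * E6Deriv (gamma1 • τ) := by
  have : (C : ℂ) ≠ 0 := by exact_mod_cast hC
  rw [phiNum_gamma1_smul, E6Deriv_gamma1_smul, h]
  push_cast
  field_simp
  ring

/-- `φ` takes each real value other than zero on the left half of `F₀`: if `C < 1`, the preimage is
`γ₁ σ`, where `σ` in `F` has value `1 - 1 / C`. -/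
lemma exists_phiNum_eq_on_F0 {C : ℝ} (hC : C ≠ 0) :
    ∃ τ ∈ F0, τ.re ≤ 1 / 2 ∧ phiNum τ = C * E6Deriv τ := by
  rcases le_or_gt 1 C with h1 | h1
  · obtain ⟨τ, hτ, h⟩ := exists_phiNum_eq (Or.inl h1)
    refine ⟨τ, ?_, ?_, h⟩
    · obtain ⟨h2, h3, h4, h5⟩ := mem_F_iff.mp hτ
      exact mem_F0_iff.mpr ⟨h2, h3, by linarith⟩
    · by_contra! hc
      linarith [(phiNum_real_of_le_re hτ hc.le h).2.2.2.1]
  have hC' : 1 < 1 - 1 / C ∨ 1 - 1 / C < 0 := by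
    rcases hC.lt_or_gt with h2 | h2
    · exact Or.inl (by linarith [one_div_neg.mpr h2])
    · exact Or.inr (by linarith [(one_lt_div h2).mpr h1])
  obtain ⟨σ, hσ, h⟩ := exists_phiNum_eq (hC'.imp le_of_lt le_of_lt)
  refine ⟨gamma1 • σ, ?_, ?_, phiNum_gamma1_smul_eq hC h⟩ <;>
    obtain ⟨h2, h3, h4, h5⟩ := mem_F_iff.mp hσ
  · rw [mem_F0_iff, re_gamma1_smul, normSq_gamma1_smul]
    have := normSq_sub_pos σ
    refine ⟨div_nonneg (by linarith) this.le, ?_, by gcongr; linarith⟩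
    rw [div_le_one this]
    linarith
  · rw [re_gamma1_smul, div_le_iff₀ (normSq_sub_pos σ)]
    linarith

/-- The unique zero of `E₆'` in `F₀` is the image under `γ₁` of the point on the unit circle where
`φ` takes the value `1`. -/
lemma existsUnique_E6Deriv_eq_zero : ∃ τ ∈ F0, E6Deriv τ = 0 ∧ τ.re = 1 / 2 ∧
    gamma2 • τ ∈ F ∧ (gamma2 • τ).re ≤ 1 / 2 ∧
    ∀ σ ∈ F0, E6Deriv σ = 0 → σ = τ := by
  obtain ⟨z, hz, hz1⟩ := exists_phiNum_eq (C := 1) (Or.inl le_rfl)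
  have hzre : z.re ≤ 1 / 2 := by
    by_contra! hc
    linarith [(phiNum_real_of_le_re hz hc.le hz1).2.2.2.1]
  obtain ⟨-, h1, h2, -, h3⟩ := phiNum_real_of_re_le hz hzre hz1
  have h4 := h3.mp rfl
  have hre : (gamma1 • z).re = 1 / 2 := by
    have := normSq_sub_pos z
    rw [re_gamma1_smul, div_eq_div_iff this.ne' two_ne_zero, h4]
    ring
  -- A zero of `E₆'` is a pole of `φ`, and `φ(γ₂ σ) = γ₂ ∞ = 1` determines `γ₂ σ`.
  have key : ∀ σ ∈ F0, σ.re ≤ 1 / 2 → E6Deriv σ = 0 → σ = gamma1 • z := by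
    intro σ hσ hσ1 h0
    have hlt : Complex.normSq σ < 1 := by
      by_contra! hc
      exact E6Deriv_ne_zero_of_mem_F (mem_F_iff.mpr ⟨hσ.1, hσ.2.1, hc, by linarith⟩) h0
    have hF := gamma2_smul_mem_F hσ hσ1 hlt.le
    have hone : phiNum (gamma2 • σ) = (1 : ℝ) * E6Deriv (gamma2 • σ) := by
      rw [phiNum_gamma2_smul, E6Deriv_gamma2_smul, h0]
      simp
    rw [← eq_of_phiNum_eq hF hz hone hz1, gamma1_smul_gamma2_smul]
  have hmem : gamma1 • z ∈ F0 := by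
    rw [mem_F0_iff, hre, normSq_gamma1_smul, h4]
    refine ⟨by norm_num, by norm_num, ?_⟩
    rw [div_le_div_iff₀ two_pos (by linarith)]
    linarith
  refine ⟨gamma1 • z, hmem, ?_, hre, by rwa [gamma2_smul_gamma1_smul],
    by rwa [gamma2_smul_gamma1_smul], fun σ hσ h0 ↦ ?_⟩
  · rw [E6Deriv_gamma1_smul, hz1]
    simp
  · rcases le_total σ.re (1 / 2) with hσ1 | hσ1
    · exact key σ hσ hσ1 h0
    · have h5 := key (reflect σ) (reflect_mem_F0 hσ) (by rw [re_reflect]; linarith)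
        (by rw [E6Deriv_reflect, h0]; simp)
      have h6 : σ.re = 1 / 2 := by
        have := congrArg UpperHalfPlane.re h5
        rw [re_reflect, hre] at this
        linarith
      exact key σ hσ h6.le h0

/-! ### The points `τ_∞`, `τ_<(C)`, `τ_>(C)` and the three curves -/

lemma F0Left_subset {τ : ℍ} (h : τ ∈ F0Left) : τ ∈ F0 := interior_subset h.1

lemma continuous_reflect : Continuous reflect := by
  rw [UpperHalfPlane.isEmbedding_coe.continuous_iff]
  exact continuous_const.sub (Complex.continuous_conj.comp UpperHalfPlane.continuous_coe)

lemma reflect_mem_interior {τ : ℍ} (h : τ ∈ interior F0) : reflect τ ∈ interior F0 := by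
  refine mem_interior.mpr ⟨reflect ⁻¹' interior F0, fun σ hσ ↦ ?_,
    isOpen_interior.preimage continuous_reflect, by rwa [Set.mem_preimage, reflect_reflect]⟩
  rw [← reflect_reflect σ]
  exact reflect_mem_F0 (interior_subset hσ)

lemma reflect_mem_F0Right_iff {τ : ℍ} : reflect τ ∈ F0Right ↔ τ ∈ F0Left := by
  constructor
  · rintro ⟨h1, h2⟩
    rw [re_reflect] at h2
    refine ⟨?_, by linarith⟩
    rw [← reflect_reflect τ]
    exact reflect_mem_interior h1
  · rintro ⟨h1, h2⟩
    exact ⟨reflect_mem_interior h1, by rw [re_reflect]; linarith⟩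

lemma fC_reflect_eq_zero_iff (C : ℝ) (τ : ℍ) : fC C (reflect τ) = 0 ↔ fC (1 - C) τ = 0 := by
  rw [fC_eq_zero_iff, fC_eq_zero_iff]
  constructor
  · intro h
    have := phiNum_reflect_eq h
    rwa [reflect_reflect] at this
  · intro h
    have := phiNum_reflect_eq h
    rwa [sub_sub_cancel] at this

lemma existsUnique_F0Left {C : ℝ} (hC : C ≠ 0) : ∃! τ, τ ∈ F0Left ∧ fC C τ = 0 := by
  obtain ⟨τ, h1, h2, h3⟩ := exists_phiNum_eq_on_F0 hC
  refine ⟨τ, ⟨(phiNum_real_on_F0 h1 h2 h3).2.1, (fC_eq_zero_iff _ _).mpr h3⟩, ?_⟩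
  rintro σ ⟨hσ1, hσ2⟩
  exact eq_of_phiNum_eq_on_F0 (F0Left_subset hσ1) h1 hσ1.2.le h2 ((fC_eq_zero_iff _ _).mp hσ2) h3

lemma existsUnique_F0Right {C : ℝ} (hC : C ≠ 1) : ∃! τ, τ ∈ F0Right ∧ fC C τ = 0 := by
  obtain ⟨τ, ⟨h1, h2⟩, h3⟩ := existsUnique_F0Left (C := 1 - C) (sub_ne_zero.mpr hC.symm)
  refine ⟨reflect τ, ⟨reflect_mem_F0Right_iff.mpr h1, (fC_reflect_eq_zero_iff _ _).mpr h2⟩, ?_⟩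
  rintro σ ⟨hσ1, hσ2⟩
  rw [← reflect_reflect σ] at hσ1 hσ2 ⊢
  rw [h3 _ ⟨reflect_mem_F0Right_iff.mp hσ1, (fC_reflect_eq_zero_iff _ _).mp hσ2⟩]

lemma existsUnique_tauInfty : ∃! τ, τ ∈ F0 ∧ E6Deriv τ = 0 := by
  obtain ⟨τ, h1, h2, -, -, -, h3⟩ := existsUnique_E6Deriv_eq_zero
  exact ⟨τ, ⟨h1, h2⟩, fun σ hσ ↦ h3 σ hσ.1 hσ.2⟩

lemma tauInfty_spec : tauInfty ∈ F0 ∧ E6Deriv tauInfty = 0 :=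
  Classical.epsilon_spec existsUnique_tauInfty.exists

lemma eq_tauInfty {τ : ℍ} (h : τ ∈ F0) (h0 : E6Deriv τ = 0) : τ = tauInfty :=
  existsUnique_tauInfty.unique ⟨h, h0⟩ tauInfty_spec

lemma gamma2_smul_tauInfty : gamma2 • tauInfty ∈ F0Left ∧ fC 1 (gamma2 • tauInfty) = 0 := by
  obtain ⟨τ, h1, h2, -, h3, h4, -⟩ := existsUnique_E6Deriv_eq_zero
  rw [← eq_tauInfty h1 h2]
  have h5 : phiNum (gamma2 • τ) = (1 : ℝ) * E6Deriv (gamma2 • τ) := by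
    rw [phiNum_gamma2_smul, E6Deriv_gamma2_smul, h2]
    simp
  obtain ⟨h6, h7, h8, -⟩ := mem_F_iff.mp h3
  exact ⟨(phiNum_real_on_F0 (mem_F0_iff.mpr ⟨h6, h7, by linarith⟩) h4 h5).2.1,
    (fC_eq_zero_iff _ _).mpr h5⟩

lemma reflect_tauInfty : reflect tauInfty = tauInfty :=
  eq_tauInfty (reflect_mem_F0 tauInfty_spec.1) (by rw [E6Deriv_reflect, tauInfty_spec.2]; simp)

/-- Since `τ_∞` is fixed by the reflection, `γ₁ τ_∞` is the reflection of `γ₂ τ_∞`. -/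
lemma gamma1_smul_tauInfty : gamma1 • tauInfty ∈ F0Right ∧ fC 0 (gamma1 • tauInfty) = 0 := by
  have h : gamma1 • tauInfty = reflect (gamma2 • tauInfty) := by
    ext
    rw [coe_reflect, coe_gamma1_smul, coe_gamma2_smul]
    have h1 : (starRingEnd ℂ) (tauInfty : ℂ) = 1 - tauInfty := by
      have := congrArg UpperHalfPlane.coe reflect_tauInfty
      rw [coe_reflect] at this
      linear_combination -this
    rw [map_div₀, map_sub, map_one, h1]
    have := coe_sub_one_ne_zero tauInfty
    field_simp
    ring
  rw [h, reflect_mem_F0Right_iff, fC_reflect_eq_zero_iff, sub_zero]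
  exact gamma2_smul_tauInfty

lemma tauLess_spec {C : ℝ} (hC : C ≠ 0) : tauLess C ∈ F0Left ∧ fC C (tauLess C) = 0 := by
  rw [tauLess]
  split_ifs with h
  · rw [h]
    exact gamma2_smul_tauInfty
  · exact Classical.epsilon_spec (existsUnique_F0Left hC).exists

lemma eq_tauLess {C : ℝ} {τ : ℍ} (hC : C ≠ 0) (h : τ ∈ F0Left) (h0 : fC C τ = 0) :
    τ = tauLess C :=
  (existsUnique_F0Left hC).unique ⟨h, h0⟩ (tauLess_spec hC)

lemma tauGreater_spec {C : ℝ} (hC : C ≠ 1) :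
    tauGreater C ∈ F0Right ∧ fC C (tauGreater C) = 0 := by
  rw [tauGreater]
  split_ifs with h
  · rw [h]
    exact gamma1_smul_tauInfty
  · exact Classical.epsilon_spec (existsUnique_F0Right hC).exists

lemma eq_tauGreater {C : ℝ} {τ : ℍ} (hC : C ≠ 1) (h : τ ∈ F0Right) (h0 : fC C τ = 0) :
    τ = tauGreater C :=
  (existsUnique_F0Right hC).unique ⟨h, h0⟩ (tauGreater_spec hC)

/-! ### The corner `e^{πi/3}` of the fundamental domain -/

/-- The point `e^{πi/3}` of the upper half plane. -/
noncomputable def corner : ℍ := ⟨Complex.exp (Real.pi * Complex.I / 3), by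
  rw [show (Real.pi * Complex.I / 3 : ℂ) = ((Real.pi / 3 : ℝ) : ℂ) * Complex.I by push_cast; ring,
    Complex.exp_ofReal_mul_I_im, Real.sin_pi_div_three]
  positivity⟩

lemma coe_corner : (corner : ℂ) = Complex.exp (Real.pi * Complex.I / 3) := rfl

lemma corner_re : corner.re = 1 / 2 := by
  rw [← coe_re, coe_corner,
    show (Real.pi * Complex.I / 3 : ℂ) = ((Real.pi / 3 : ℝ) : ℂ) * Complex.I by push_cast; ring,
    Complex.exp_ofReal_mul_I_re, Real.cos_pi_div_three]

lemma corner_im : corner.im = √3 / 2 := by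
  rw [← coe_im, coe_corner,
    show (Real.pi * Complex.I / 3 : ℂ) = ((Real.pi / 3 : ℝ) : ℂ) * Complex.I by push_cast; ring,
    Complex.exp_ofReal_mul_I_im, Real.sin_pi_div_three]

lemma normSq_corner : Complex.normSq corner = 1 := by
  rw [normSq_coe, corner_re, corner_im]
  have := Real.mul_self_sqrt (show (0 : ℝ) ≤ 3 by norm_num)
  linarith

lemma corner_mem_F : corner ∈ F := by
  rw [mem_F_iff, normSq_corner, corner_re]
  norm_num

lemma corner_sq : (corner : ℂ) ^ 2 = corner - 1 := by
  have h3 := Real.mul_self_sqrt (show (0 : ℝ) ≤ 3 by norm_num)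
  apply Complex.ext
  · rw [sq, Complex.mul_re, Complex.sub_re, coe_re, coe_im, corner_re, corner_im, Complex.one_re]
    linarith
  · rw [sq, Complex.mul_im, Complex.sub_im, coe_re, coe_im, corner_re, corner_im, Complex.one_im]
    ring

lemma gamma1_smul_corner : gamma1 • corner = corner := by
  ext
  rw [coe_gamma1_smul, div_eq_iff (coe_sub_one_ne_zero corner)]
  linear_combination corner_sq

/-- At the fixed point `ρ = e^{πi/3}` of `γ₁` the value of `φ` is `1 - ρ = ρ̄`, another fixed point
of `γ₁`. -/
lemma phiNum_corner : phiNum corner = (1 - corner) * E6Deriv corner := by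
  have h := phiNum_gamma1_smul corner
  rw [gamma1_smul_corner] at h
  have hsq := corner_sq
  rw [h]
  have : ((1 : ℂ) - corner) ^ 7 = 1 - corner := by
    have h2 : ((1 : ℂ) - corner) ^ 2 = -corner := by linear_combination hsq
    have h3 : ((1 : ℂ) - corner) ^ 3 = -1 := by
      rw [pow_succ, h2]
      linear_combination hsq
    rw [show 7 = 3 * 2 + 1 by norm_num, pow_succ, pow_mul, h3]
    ring
  rw [this]

lemma phiNum_corner_ne (C : ℝ) : phiNum corner ≠ C * E6Deriv corner := by
  rw [phiNum_corner]
  intro h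
  have h1 := congrArg Complex.im (mul_right_cancel₀ (E6Deriv_ne_zero_of_mem_F corner_mem_F) h)
  rw [Complex.sub_im, Complex.one_im, Complex.ofReal_im, coe_im] at h1
  linarith [corner.im_pos]

/-- At a fixed point of `γ₁` the automorphy factor of `E₄` is not `1`. -/
lemma E4_corner : E₄ corner = 0 := by
  have h := E4_smul gamma1 corner
  rw [gamma1_smul_corner] at h
  simp [gamma1] at h
  have h4 : (-(corner : ℂ) + 1) ^ 4 = corner - 1 := by
    have h2 : (-(corner : ℂ) + 1) ^ 2 = -corner := by linear_combination corner_sq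
    rw [show 4 = 2 * 2 by norm_num, pow_mul, h2]
    linear_combination corner_sq
  rw [h4] at h
  by_contra hne
  have h5 := congrArg Complex.im (mul_right_cancel₀ hne ((one_mul _).trans h))
  rw [Complex.sub_im, Complex.one_im, coe_im] at h5
  linarith [corner.im_pos]

open ArithmeticFunction in
open scoped ArithmeticFunction.sigma in
/-- `E₄` is an injective function of `q` near `q = 0`, since the derivative `1 + 18 q + ⋯` of
`q + 9 q² + ⋯` has positive real part there. -/
lemma injOn_E4_powerSum : Set.InjOn (fun q : ℂ ↦ q * powerSum (fun n ↦ (σ 3 (n + 1) : ℂ)) q)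
    (Metric.closedBall 0 (1 / 230)) := by
  have hB : CoeffBound (fun n ↦ (n + 1 : ℂ) * (σ 3 (n + 1) : ℂ)) 22 := fun n ↦ by
    rw [norm_mul, Complex.norm_natCast, show (n + 1 : ℂ) = ((n + 1 : ℕ) : ℂ) by push_cast; ring,
      Complex.norm_natCast]
    have h : (σ 3 (n + 1) : ℝ) ≤ ((n + 1 : ℕ) : ℝ) ^ 4 := by
      exact_mod_cast sigma_le_pow_succ 3 (n + 1)
    calc ((n + 1 : ℕ) : ℝ) * (σ 3 (n + 1) : ℝ) ≤ ((n + 1 : ℕ) : ℝ) * ((n + 1 : ℕ) : ℝ) ^ 4 := by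
          gcongr
      _ = ((n + 1 : ℕ) : ℝ) ^ 5 := by ring
      _ ≤ ((n + 1 : ℕ) : ℝ) ^ 7 := pow_le_pow_right₀ (by norm_cast; lia) (by norm_num)
      _ ≤ _ := pow_seven_le n
  refine injOn_of_re_mul_deriv_pos (convex_closedBall _ _) 1
    (fun q hq ↦ CoeffBound.hasDerivAt_mul_powerSum hB ?_) fun q hq ↦ ?_ <;>
    rw [mem_closedBall_zero_iff] at hq
  · linarith
  have hq' : 10 * ‖q‖ < 1 := by linarith
  have e1 := hB.powerSum_eq hq'
  have e2 := hB.shift.powerSum_eq hq'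
  have b2 := hB.shift.shift.norm_powerSum_le hq'
  set R := powerSum (fun n ↦ ((n + 1 + 1 : ℕ) + 1 : ℂ) * (σ 3 (n + 1 + 1 + 1) : ℂ)) q
  have hR : ‖R‖ ≤ 2300 := by
    refine b2.trans ?_
    rw [div_le_iff₀ (by linarith)]
    linarith
  rw [e1, e2, show σ 3 (0 + 1 + 1) = 9 by decide +kernel, show σ 3 (0 + 1) = 1 by decide +kernel]
  norm_num
  have h1 : ‖q * (18 + q * R)‖ ≤ 1 / 2 := by
    rw [norm_mul]
    have : ‖18 + q * R‖ ≤ 28 := by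
      refine (norm_add_le _ _).trans ?_
      rw [norm_mul]
      have : ‖q‖ * ‖R‖ ≤ 1 / 230 * 2300 := by gcongr
      norm_num at this ⊢
      linarith
    calc ‖q‖ * ‖18 + q * R‖ ≤ 1 / 230 * 28 := by gcongr
      _ ≤ _ := by norm_num
  have h2 := (abs_le.mp ((Complex.abs_re_le_norm _).trans h1)).1
  rw [Complex.mul_re] at h2
  simp at h2
  linarith

lemma eq_corner_of_E4_eq_zero_of_mem_F {τ : ℍ} (h : τ ∈ F) (h0 : E₄ τ = 0) : τ = corner := by
  have hq := norm_nome_le_of_mem_F h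
  have hc := norm_nome_le_of_mem_F corner_mem_F
  have h1 : nome τ = nome corner := by
    refine injOn_E4_powerSum (mem_closedBall_zero_iff.mpr hq) (mem_closedBall_zero_iff.mpr hc) ?_
    have h2 := h0.trans E4_corner.symm
    rw [E4_eq_powerSum, E4_eq_powerSum] at h2
    simp only
    linear_combination (1 / 240) * h2
  rw [nome, nome, Complex.exp_eq_exp_iff_exists_int] at h1
  obtain ⟨n, hn⟩ := h1
  have hn' : (τ : ℂ) = corner + n := by
    apply mul_left_cancel₀ Complex.two_pi_I_ne_zero
    linear_combination hn
  have him := congrArg Complex.im hn'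
  have hre := congrArg Complex.re hn'
  rw [Complex.add_im, Complex.intCast_im, coe_im, coe_im, add_zero] at him
  rw [Complex.add_re, Complex.intCast_re, coe_re, coe_re, corner_re] at hre
  obtain ⟨h2, h3, -, -⟩ := mem_F_iff.mp h
  have hn0 : n = 0 := by
    have h4 : (-1 : ℝ) < n := by linarith
    have h5 : (n : ℝ) < 1 := by linarith
    have h6 : -1 < n := by exact_mod_cast h4
    have h7 : n < 1 := by exact_mod_cast h5
    lia
  ext
  rw [hn', hn0, Int.cast_zero, add_zero]

lemma reflect_corner : reflect corner = corner := by
  ext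
  apply Complex.ext
  · rw [coe_re, re_reflect, coe_re, corner_re]
    norm_num
  · rw [coe_im, im_reflect, coe_im]

/-- The only zero of `E₄` in `F₀` is `e^{πi/3}`, which is fixed by `γ₁`. -/
lemma eq_corner_of_E4_eq_zero {τ : ℍ} (h : τ ∈ F0) (h0 : E₄ τ = 0) : τ = corner := by
  have key : ∀ τ : ℍ, τ ∈ F0 → τ.re ≤ 1 / 2 → E₄ τ = 0 → τ = corner := by
    intro τ h hre h0
    rcases le_or_gt 1 (Complex.normSq τ) with h1 | h1
    · exact eq_corner_of_E4_eq_zero_of_mem_F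
        (mem_F_iff.mpr ⟨h.1, h.2.1, h1, by linarith⟩) h0
    · have := eq_corner_of_E4_eq_zero_of_mem_F (gamma2_smul_mem_F h hre h1.le)
        (by rw [E4_smul, h0, mul_zero])
      rw [← gamma1_smul_gamma2_smul τ, this, gamma1_smul_corner]
  rcases le_total τ.re (1 / 2) with h1 | h1
  · exact key τ h h1 h0
  · have := key (reflect τ) (reflect_mem_F0 h) (by rw [re_reflect]; linarith)
      (by rw [E4_reflect, h0, map_zero])
    rw [← reflect_reflect τ, this, reflect_corner]

lemma mem_F0Punctured_iff {τ : ℍ} : τ ∈ F0Punctured ↔ τ ∈ F0 ∧ τ ≠ corner := by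
  rw [F0Punctured, Set.mem_ofPred_eq, ← coe_corner, ne_eq, ne_eq, UpperHalfPlane.ext_iff]

lemma g2_ne_zero {τ : ℍ} (h : τ ∈ F0Punctured) : g2 τ ≠ 0 := by
  rw [mem_F0Punctured_iff] at h
  have hpi : (Real.pi : ℂ) ≠ 0 := by exact_mod_cast Real.pi_ne_zero
  rw [g2_eq]
  refine mul_ne_zero (div_ne_zero (mul_ne_zero (by norm_num) (pow_ne_zero _ hpi)) (by norm_num)) ?_
  exact fun h0 ↦ h.2 (eq_corner_of_E4_eq_zero h.1 h0)

/-! ### The points with real or infinite value of `φ` -/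

/-- The points of `F₀` at which `φ` is real or infinite. -/
def realPhi : Set ℍ := {τ | τ ∈ F0Punctured ∧ phi τ ∈ realOrInfty}

lemma phi_mem_realOrInfty_iff {τ : ℍ} : phi τ ∈ realOrInfty ↔
    E6Deriv τ = 0 ∨ ∃ C : ℝ, phiNum τ = C * E6Deriv τ := by
  by_cases h : E6Deriv τ = 0
  · simp [phi_of_eq_zero h, h, realOrInfty]
  · rw [phi_of_ne_zero h, realOrInfty, Set.mem_ofPred_eq]
    simp [h, div_eq_iff h]

lemma ne_corner_of_phi_mem {τ : ℍ} (h : phi τ ∈ realOrInfty) : τ ≠ corner := by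
  rintro rfl
  rcases phi_mem_realOrInfty_iff.mp h with h | ⟨C, h⟩
  · exact E6Deriv_ne_zero_of_mem_F corner_mem_F h
  · exact phiNum_corner_ne C h

lemma mem_realPhi_iff {τ : ℍ} : τ ∈ realPhi ↔
    τ ∈ F0 ∧ (E6Deriv τ = 0 ∨ ∃ C : ℝ, phiNum τ = C * E6Deriv τ) := by
  rw [realPhi, Set.mem_ofPred_eq, mem_F0Punctured_iff, ← phi_mem_realOrInfty_iff]
  exact ⟨fun h ↦ ⟨h.1.1, h.2⟩, fun h ↦ ⟨⟨h.1, ne_corner_of_phi_mem h.2⟩, h.2⟩⟩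

/-- A point of `F₀` at which `φ` takes the real value `C` is `τ_<(C)` or `τ_>(C)`. -/
lemma mem_curve_of_phiNum_eq {τ : ℍ} (h : τ ∈ F0) {C : ℝ} (hC : phiNum τ = C * E6Deriv τ) :
    (C ≠ 0 ∧ τ = tauLess C ∧ τ.re < 1 / 2) ∨ (C ≠ 1 ∧ τ = tauGreater C ∧ 1 / 2 < τ.re) := by
  rcases le_total τ.re (1 / 2) with h1 | h1
  · obtain ⟨h2, h3, -⟩ := phiNum_real_on_F0 h h1 hC
    exact Or.inl ⟨h2, eq_tauLess h2 h3 ((fC_eq_zero_iff _ _).mpr hC), h3.2⟩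
  · obtain ⟨h2, h3, -⟩ := phiNum_real_on_F0 (reflect_mem_F0 h) (by rw [re_reflect]; linarith)
      (phiNum_reflect_eq hC)
    have h4 : C ≠ 1 := fun h ↦ h2 (by rw [h, sub_self])
    have h5 : τ ∈ F0Right := by
      rw [← reflect_reflect τ]
      exact reflect_mem_F0Right_iff.mpr h3
    exact Or.inr ⟨h4, eq_tauGreater h4 h5 ((fC_eq_zero_iff _ _).mpr hC), h5.2⟩

lemma tauLess_mem_realPhi {C : ℝ} (hC : C ≠ 0) : tauLess C ∈ realPhi :=
  mem_realPhi_iff.mpr ⟨F0Left_subset (tauLess_spec hC).1,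
    Or.inr ⟨C, (fC_eq_zero_iff _ _).mp (tauLess_spec hC).2⟩⟩

lemma tauGreater_mem_realPhi {C : ℝ} (hC : C ≠ 1) : tauGreater C ∈ realPhi :=
  mem_realPhi_iff.mpr ⟨interior_subset (tauGreater_spec hC).1.1,
    Or.inr ⟨C, (fC_eq_zero_iff _ _).mp (tauGreater_spec hC).2⟩⟩

lemma realPhi_eq : realPhi = curve1 ∪ curve2 ∪ curve3 := by
  ext τ
  constructor
  · intro h
    obtain ⟨h1, h2 | ⟨C, hC⟩⟩ := mem_realPhi_iff.mp h
    · exact Or.inl (Or.inl (Or.inl (Or.inr (eq_tauInfty h1 h2))))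
    rcases mem_curve_of_phiNum_eq h1 hC with ⟨h2, h3, -⟩ | ⟨h2, h3, -⟩
    · rcases h2.lt_or_gt with h4 | h4
      · exact Or.inl (Or.inl (Or.inl (Or.inl ⟨C, h4, h3.symm⟩)))
      · exact Or.inl (Or.inr ⟨C, h4, h3.symm⟩)
    · rcases h2.lt_or_gt with h4 | h4
      · exact Or.inr ⟨C, h4, h3.symm⟩
      · exact Or.inl (Or.inl (Or.inr ⟨C, h4, h3.symm⟩))
  · rintro ((((⟨C, hC, rfl⟩ | rfl) | ⟨C, hC, rfl⟩) | ⟨C, hC, rfl⟩) | ⟨C, hC, rfl⟩)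
    · exact tauLess_mem_realPhi (Set.mem_Iio.mp hC).ne
    · exact mem_realPhi_iff.mpr ⟨tauInfty_spec.1, Or.inl tauInfty_spec.2⟩
    · exact tauGreater_mem_realPhi (Set.mem_Ioi.mp hC).ne'
    · exact tauLess_mem_realPhi (Set.mem_Ioi.mp hC).ne'
    · exact tauGreater_mem_realPhi (Set.mem_Iio.mp hC).ne

lemma realPhi_inter_F : realPhi ∩ F = curveLess ∪ curveGreater := by
  ext τ
  constructor
  · rintro ⟨h, hF⟩
    obtain ⟨h1, h2 | ⟨C, hC⟩⟩ := mem_realPhi_iff.mp h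
    · exact absurd h2 (E6Deriv_ne_zero_of_mem_F hF)
    rcases mem_curve_of_phiNum_eq h1 hC with ⟨-, h3, h4⟩ | ⟨-, h3, h4⟩
    · have := (phiNum_real_of_re_le hF h4.le hC).2.2.2.1
      exact Or.inl ⟨⟨C, Set.mem_Ioi.mpr (by linarith), h3.symm⟩, hF⟩
    · have := (phiNum_real_of_le_re hF h4.le hC).2.2.2.1
      exact Or.inr ⟨⟨C, Set.mem_Iio.mpr (by linarith), h3.symm⟩, hF⟩
  · rw [realPhi_eq]
    rintro (⟨h, hF⟩ | ⟨h, hF⟩)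
    · exact ⟨Or.inl (Or.inr h), hF⟩
    · exact ⟨Or.inr h, hF⟩

/-- If `γ • τ` is a zero of `E₆'`, then `φ(τ) = -d / c`. -/
lemma phi_eq_negDivLower {γ : SL(2, ℤ)} {τ : ℍ} (h : E6Deriv (γ • τ) = 0) :
    phi τ = negDivLower γ ∧ phi τ ∈ realOrInfty := by
  rw [E6Deriv_smul, mul_eq_zero, or_iff_right (pow_ne_zero _ (denom_coe_ne_zero γ τ))] at h
  rw [phi_mem_realOrInfty_iff]
  by_cases hc : γ 1 0 = 0
  · have hd : (γ 1 1 : ℂ) ≠ 0 := by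
      intro hd
      have := denom_coe_ne_zero γ τ
      rw [hc, hd] at this
      simp at this
    rw [hc, Int.cast_zero, zero_mul, zero_add, mul_eq_zero, or_iff_right hd] at h
    exact ⟨by rw [phi_of_eq_zero h, negDivLower, if_pos hc], Or.inl h⟩
  · have hc' : (γ 1 0 : ℂ) ≠ 0 := by exact_mod_cast hc
    have h1 : phiNum τ = -(γ 1 1 : ℂ) / (γ 1 0 : ℂ) * E6Deriv τ := by
      field_simp
      linear_combination h
    have h2 : E6Deriv τ ≠ 0 := fun h2 ↦ phiNum_ne_zero_of_E6Deriv_eq_zero h2 (by rw [h1, h2,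
      mul_zero])
    refine ⟨?_, Or.inr ⟨-(γ 1 1 : ℝ) / (γ 1 0 : ℝ), by rw [h1]; push_cast; rfl⟩⟩
    rw [phi_of_ne_zero h2, negDivLower, if_neg hc, h1, mul_div_cancel_right₀ _ h2]

end

/-! ### The solutions `y₁`, `y₂` of the differential equation -/

lemma qValue_zero_sq (τ : UpperHalfPlane) : qValue τ 0 ^ 2 = g2 τ / 12 := by
  change ((g2 τ / 12) ^ (1 / 2 : ℂ)) ^ 2 = _
  rw [show (1 / 2 : ℂ) = ((2 : ℕ) : ℂ)⁻¹ by norm_num, Complex.cpow_nat_inv_pow _ two_ne_zero]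

lemma qValue_one (τ : UpperHalfPlane) : qValue τ 1 = -qValue τ 0 := rfl

lemma qValue_sq (τ : UpperHalfPlane) (j : Fin 2) : qValue τ j ^ 2 = g2 τ / 12 := by
  fin_cases j
  · exact qValue_zero_sq τ
  · change qValue τ 1 ^ 2 = _
    rw [qValue_one, neg_sq, qValue_zero_sq]

lemma q_spec (τ : UpperHalfPlane) (j : Fin 2) :
    q τ j ∉ (periods τ).lattice ∧ wp τ (q τ j) = qValue τ j :=
  Classical.epsilon_spec ((periods τ).exists_weierstrassP_eq (qValue τ j))

lemma wpDeriv_sq {τ : UpperHalfPlane} {z : ℂ} (hz : z ∉ (periods τ).lattice) :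
    wpDeriv τ z ^ 2 = 4 * wp τ z ^ 3 - g2 τ * wp τ z - g3 τ :=
  (periods τ).derivWeierstrassP_sq z hz

lemma wpDeriv_q_sq (τ : UpperHalfPlane) (j : Fin 2) :
    wpDeriv τ (q τ j) ^ 2 = -8 * qValue τ j ^ 3 - g3 τ := by
  rw [wpDeriv_sq (q_spec τ j).1, (q_spec τ j).2]
  linear_combination (12 * qValue τ j) * qValue_sq τ j

/-- A common zero of `℘'` and `℘''` would be a multiple root of `4 x³ - g₂ x - g₃`, whose
discriminant does not vanish. -/
lemma wpDeriv_q_ne_zero (τ : UpperHalfPlane) (j : Fin 2) : wpDeriv τ (q τ j) ≠ 0 := by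
  intro h
  have h1 := wpDeriv_q_sq τ j
  rw [h] at h1
  apply g2_cube_ne τ
  have h2 : g2 τ = 12 * qValue τ j ^ 2 := by
    rw [qValue_sq]
    ring
  have h3 : g3 τ = -8 * qValue τ j ^ 3 := by linear_combination h1
  rw [h2, h3]
  ring

lemma singular_eq (τ : UpperHalfPlane) : singular τ = ((periods τ).lattice : Set ℂ) ∪
    ⋃ j, ((fun z ↦ z - q τ j) ⁻¹' (periods τ).lattice ∪
      (fun z ↦ z + q τ j) ⁻¹' (periods τ).lattice) := by
  ext z
  simp [singular]

lemma isOpen_singular_compl (τ : UpperHalfPlane) : IsOpen (singular τ)ᶜ := by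
  have hc := (periods τ).isClosed_lattice
  rw [singular_eq]
  refine (hc.union (isClosed_iUnion_of_finite fun j ↦ ?_)).isOpen_compl
  exact (hc.preimage (by fun_prop)).union (hc.preimage (by fun_prop))

lemma countable_singular (τ : UpperHalfPlane) : (singular τ).Countable := by
  have hc := (periods τ).countable_lattice
  rw [singular_eq]
  refine hc.union (Set.countable_iUnion fun j ↦ ?_)
  exact (hc.preimage sub_left_injective).union (hc.preimage (add_left_injective _))

lemma isPathConnected_singular_compl (τ : UpperHalfPlane) : IsPathConnected (singular τ)ᶜ :=
  (countable_singular τ).isPathConnected_compl_of_one_lt_rank (by simp [Complex.rank_real_complex])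

lemma add_mem_singular_iff {τ : UpperHalfPlane} {z ω : ℂ} (hω : ω ∈ (periods τ).lattice) :
    z + ω ∈ singular τ ↔ z ∈ singular τ := by
  have h : ∀ w, w + ω ∈ (periods τ).lattice ↔ w ∈ (periods τ).lattice := fun w ↦
    (periods τ).lattice.add_mem_iff_left hω
  simp only [singular, Set.mem_ofPred_eq]
  rw [h]
  refine or_congr_right (exists_congr fun j ↦ ?_)
  rw [← h (z - q τ j), ← h (z + q τ j)]
  ring_nf

lemma notMem_lattice_of_notMem_singular {τ : UpperHalfPlane} {z : ℂ} (hz : z ∉ singular τ) :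
    z ∉ (periods τ).lattice := fun h ↦ hz (Or.inl h)

lemma wp_sub_add_wp_add_mul_sq {τ : UpperHalfPlane} {z : ℂ} (hz : z ∉ singular τ) (j : Fin 2) :
    (wp τ (z - q τ j) + wp τ (z + q τ j) - 2 * qValue τ j) * (wp τ z - qValue τ j) ^ 2 =
      wpDeriv τ (q τ j) ^ 2 := by
  rw [← (q_spec τ j).2]
  refine (periods τ).weierstrassP_sub_add_weierstrassP_add_mul_sq (q_spec τ j).1 ?_
    (wpDeriv_q_ne_zero τ j) (notMem_lattice_of_notMem_singular hz)
    (fun h ↦ hz (Or.inr ⟨j, Or.inl h⟩)) (fun h ↦ hz (Or.inr ⟨j, Or.inr h⟩))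
  change 6 * wp τ (q τ j) ^ 2 = g2 τ / 2
  rw [(q_spec τ j).2, qValue_sq]
  ring

/-- Off the singular points `℘` avoids the values `℘(q_j)`, by the product formula. -/
lemma wp_sub_qValue_ne_zero {τ : UpperHalfPlane} {z : ℂ} (hz : z ∉ singular τ) (j : Fin 2) :
    wp τ z - qValue τ j ≠ 0 := by
  intro h
  have h1 := wp_sub_add_wp_add_mul_sq hz j
  rw [h, zero_pow two_ne_zero, mul_zero] at h1
  exact pow_ne_zero 2 (wpDeriv_q_ne_zero τ j) h1.symm

/-- The second derivative of `℘`, written as a polynomial in `℘`. -/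
noncomputable def wpSnd (τ : UpperHalfPlane) (z : ℂ) : ℂ := 6 * wp τ z ^ 2 - g2 τ / 2

lemma wpSnd_eq (τ : UpperHalfPlane) (z : ℂ) :
    wpSnd τ z = 6 * ((wp τ z - qValue τ 0) * (wp τ z + qValue τ 0)) := by
  rw [wpSnd]
  linear_combination 6 * qValue_zero_sq τ

lemma wpSnd_ne_zero {τ : UpperHalfPlane} {z : ℂ} (hz : z ∉ singular τ) : wpSnd τ z ≠ 0 := by
  have h0 := wp_sub_qValue_ne_zero hz 0
  have h1 := wp_sub_qValue_ne_zero hz 1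
  rw [qValue_one, sub_neg_eq_add] at h1
  rw [wpSnd_eq]
  exact mul_ne_zero (by norm_num) (mul_ne_zero h0 h1)

section

variable {τ : UpperHalfPlane} {z : ℂ}

lemma hasDerivAt_wp (hz : z ∉ (periods τ).lattice) : HasDerivAt (wp τ) (wpDeriv τ z) z :=
  (periods τ).hasDerivAt_weierstrassP hz

lemma hasDerivAt_wpDeriv (hz : z ∉ (periods τ).lattice) :
    HasDerivAt (wpDeriv τ) (wpSnd τ z) z :=
  (periods τ).hasDerivAt_derivWeierstrassP hz

lemma hasDerivAt_wpSnd (hz : z ∉ (periods τ).lattice) :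
    HasDerivAt (wpSnd τ) (12 * wp τ z * wpDeriv τ z) z := by
  have := (((hasDerivAt_wp hz).pow 2).const_mul 6).sub_const (g2 τ / 2)
  refine this.congr_deriv ?_
  push_cast
  ring

lemma y1_eq (hz : z ∉ (periods τ).lattice) : y1 τ z = 1 / wpSnd τ z := by
  rw [y1, (hasDerivAt_wpDeriv hz).deriv]

lemma eventually_notMem_singular (hz : z ∉ singular τ) : ∀ᶠ w in 𝓝 z, w ∉ singular τ :=
  (isOpen_singular_compl τ).mem_nhds hz

lemma hasDerivAt_y1 (hz : z ∉ singular τ) :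
    HasDerivAt (y1 τ) (-(12 * wp τ z * wpDeriv τ z) / wpSnd τ z ^ 2) z := by
  have hz' := notMem_lattice_of_notMem_singular hz
  have h := (hasDerivAt_wpSnd hz').inv (wpSnd_ne_zero hz)
  refine h.congr_of_eventuallyEq ?_
  filter_upwards [eventually_notMem_singular hz] with w hw
  rw [y1_eq (notMem_lattice_of_notMem_singular hw), one_div, Pi.inv_apply]

lemma qValue_ne_zero (h : g2 τ ≠ 0) : qValue τ 0 ≠ 0 := by
  intro h0
  have := qValue_zero_sq τ
  rw [h0] at this
  apply h
  linear_combination (-12) * this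

/-- The coefficient of the differential equation is a rational function of `℘`. -/
lemma coeffI_eq (hz : z ∉ singular τ) : coeffI τ z = 12 * wp τ z +
    2 * ((-8 * qValue τ 0 ^ 3 - g3 τ) / (wp τ z - qValue τ 0) ^ 2 +
      (8 * qValue τ 0 ^ 3 - g3 τ) / (wp τ z + qValue τ 0) ^ 2) +
    ((-8 * qValue τ 0 ^ 3 - g3 τ) / (qValue τ 0 * (wp τ z - qValue τ 0)) +
      (8 * qValue τ 0 ^ 3 - g3 τ) / (-qValue τ 0 * (wp τ z + qValue τ 0))) := by
  have key : ∀ j, wp τ (z - q τ j) + wp τ (z + q τ j) =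
      2 * qValue τ j + (-8 * qValue τ j ^ 3 - g3 τ) / (wp τ z - qValue τ j) ^ 2 := fun j ↦ by
    rw [← wpDeriv_q_sq, ← wp_sub_add_wp_add_mul_sq hz j,
      mul_div_cancel_right₀ _ (pow_ne_zero 2 (wp_sub_qValue_ne_zero hz j))]
    ring
  simp only [coeffI, key, wpDeriv_q_sq, (q_spec τ _).2, Fin.sum_univ_two, qValue_one]
  ring_nf

lemma hasDerivAt_deriv_y1 (h : g2 τ ≠ 0) (hz : z ∉ singular τ) :
    HasDerivAt (deriv (y1 τ)) (coeffI τ z * y1 τ z) z := by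
  have hz' := notMem_lattice_of_notMem_singular hz
  have hP := wpSnd_ne_zero hz
  have h1 := (((hasDerivAt_wp hz').const_mul 12).mul (hasDerivAt_wpDeriv hz')).neg.div
    ((hasDerivAt_wpSnd hz').pow 2) (pow_ne_zero 2 hP)
  refine (h1.congr_of_eventuallyEq ?_).congr_deriv ?_
  · filter_upwards [eventually_notMem_singular hz] with w hw
    rw [(hasDerivAt_y1 hw).deriv]
    rfl
  · have h2 := wp_sub_qValue_ne_zero hz 0
    have h3 := wp_sub_qValue_ne_zero hz 1
    have h4 := qValue_ne_zero h
    have h5 : g2 τ = 12 * qValue τ 0 ^ 2 := by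
      rw [qValue_sq]
      ring
    have h6 := wpDeriv_sq hz'
    rw [qValue_one, sub_neg_eq_add] at h3
    rw [coeffI_eq hz, y1_eq hz']
    simp only [Pi.pow_apply, Pi.neg_apply, Pi.mul_apply]
    rw [wpSnd_eq]
    rw [h5] at h6
    generalize wp τ z = p at *
    generalize wpDeriv τ z = p' at *
    generalize qValue τ 0 = c at *
    generalize g3 τ = g at *
    -- With `g₃` eliminated by the equation for `℘'²`, an identity of rational functions remains.
    have hg : g = 4 * p ^ 3 - 12 * c ^ 2 * p - p' ^ 2 := by linear_combination h6
    subst hg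
    field_simp
    ring

/-- `χ' = 7 ℘''²`. -/
lemma hasDerivAt_chi (hz : z ∉ (periods τ).lattice) :
    HasDerivAt (chi τ) (7 * wpSnd τ z ^ 2) z := by
  have hp := hasDerivAt_wp hz
  have hp' := hasDerivAt_wpDeriv hz
  have hζ : HasDerivAt (zeta τ) (-wp τ z) z := (periods τ).hasDerivAt_weierstrassZeta hz
  have h := ((((((hp.pow 2).const_mul 18).mul hp').add (hp'.const_mul (1 / 2 * g2 τ))).add
    ((hasDerivAt_id z).const_mul (2 * g2 τ ^ 2))).sub (hζ.const_mul (36 * g3 τ)))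
  refine h.congr_deriv ?_
  have h6 := wpDeriv_sq hz
  simp only [Pi.pow_apply]
  rw [wpSnd]
  push_cast
  linear_combination (36 * wp τ z) * h6

lemma hasDerivAt_y2 (hz : z ∉ singular τ) :
    HasDerivAt (y2 τ) (deriv (y1 τ) z * chi τ z + 7 * wpSnd τ z) z := by
  have hz' := notMem_lattice_of_notMem_singular hz
  have hP := wpSnd_ne_zero hz
  have h := ((hasDerivAt_y1 hz).mul (hasDerivAt_chi hz'))
  refine h.congr_deriv ?_
  rw [(hasDerivAt_y1 hz).deriv, y1_eq hz']
  field_simp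

lemma hasDerivAt_deriv_y2 (h : g2 τ ≠ 0) (hz : z ∉ singular τ) :
    HasDerivAt (deriv (y2 τ)) (coeffI τ z * y2 τ z) z := by
  have hz' := notMem_lattice_of_notMem_singular hz
  have hP := wpSnd_ne_zero hz
  have h1 := ((hasDerivAt_deriv_y1 h hz).mul (hasDerivAt_chi hz')).add
    ((hasDerivAt_wpSnd hz').const_mul 7)
  refine (h1.congr_of_eventuallyEq ?_).congr_deriv ?_
  · filter_upwards [eventually_notMem_singular hz] with w hw
    rw [(hasDerivAt_y2 hw).deriv]
    rfl
  · rw [(hasDerivAt_y1 hz).deriv, y2]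
    field_simp
    ring

lemma analyticAt_y1 (hz : z ∉ singular τ) : AnalyticAt ℂ (y1 τ) z := by
  have hd : DifferentiableOn ℂ (y1 τ) (singular τ)ᶜ := fun w hw ↦
    (hasDerivAt_y1 hw).differentiableAt.differentiableWithinAt
  exact hd.analyticAt ((isOpen_singular_compl τ).mem_nhds hz)

lemma analyticAt_y2 (hz : z ∉ singular τ) : AnalyticAt ℂ (y2 τ) z := by
  have hd : DifferentiableOn ℂ (y2 τ) (singular τ)ᶜ := fun w hw ↦
    (hasDerivAt_y2 hw).differentiableAt.differentiableWithinAt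
  exact hd.analyticAt ((isOpen_singular_compl τ).mem_nhds hz)

/-- The Wronskian of `y₁, y₂` is the constant `7`. -/
lemma wronskian_y1_y2 (hz : z ∉ singular τ) :
    y1 τ z * deriv (y2 τ) z - deriv (y1 τ) z * y2 τ z = 7 := by
  have hP := wpSnd_ne_zero hz
  rw [(hasDerivAt_y2 hz).deriv, y2, y1_eq (notMem_lattice_of_notMem_singular hz)]
  field_simp
  ring

lemma isSolutionAt_y1 (h : g2 τ ≠ 0) (hz : z ∉ singular τ) : IsSolutionAt τ z (y1 τ) := by
  refine ⟨analyticAt_y1 hz, ?_⟩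
  filter_upwards [eventually_notMem_singular hz] with w hw
  exact (hasDerivAt_deriv_y1 h hw).deriv

lemma isSolutionAt_y2 (h : g2 τ ≠ 0) (hz : z ∉ singular τ) : IsSolutionAt τ z (y2 τ) := by
  refine ⟨analyticAt_y2 hz, ?_⟩
  filter_upwards [eventually_notMem_singular hz] with w hw
  exact (hasDerivAt_deriv_y2 h hw).deriv

lemma eq_zero_of_eventually_y1_y2 (hz : z ∉ singular τ) {a b : ℂ}
    (h : ∀ᶠ w in 𝓝 z, a * y1 τ w + b * y2 τ w = 0) : a = 0 ∧ b = 0 := by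
  have h0 := h.self_of_nhds
  have hd : a * deriv (y1 τ) z + b * deriv (y2 τ) z = 0 := by
    have h1 := ((hasDerivAt_y1 hz).differentiableAt.hasDerivAt.const_mul a).add
      ((hasDerivAt_y2 hz).differentiableAt.hasDerivAt.const_mul b)
    rw [← h1.deriv]
    refine (EventuallyEq.deriv_eq (f := fun _ ↦ (0 : ℂ)) h).trans ?_
    simp
  have hw := wronskian_y1_y2 hz
  constructor
  · linear_combination (1 / 7) * (deriv (y2 τ) z * h0 - y2 τ z * hd - a * hw)
  · linear_combination (1 / 7) * (y1 τ z * hd - deriv (y1 τ) z * h0 - b * hw)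

/-- Every solution is a linear combination of `y₁` and `y₂`. -/
lemma IsSolutionAt.exists_eq (h : g2 τ ≠ 0) (hz : z ∉ singular τ) {u : ℂ → ℂ}
    (hu : IsSolutionAt τ z u) : ∃ a b : ℂ, u =ᶠ[𝓝 z] fun w ↦ a * y1 τ w + b * y2 τ w := by
  have hev := (hu.1.eventually_analyticAt.and hu.2).and (eventually_notMem_singular hz)
  obtain ⟨r, hr, hball⟩ := Metric.eventually_nhds_iff_ball.mp hev
  have hconst : ∀ y : ℂ → ℂ, (∀ w ∉ singular τ, AnalyticAt ℂ y w) →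
      (∀ w ∉ singular τ, HasDerivAt (deriv y) (coeffI τ w * y w) w) →
      ∃ a, ∀ w ∈ Metric.ball z r, u w * deriv y w - deriv u w * y w = a := by
    intro y hy hy'
    have hd : ∀ w ∈ Metric.ball z r,
        HasDerivAt (fun w ↦ u w * deriv y w - deriv u w * y w) 0 w := by
      intro w hw
      obtain ⟨⟨h1, h2⟩, h3⟩ := hball w hw
      have h4 := (h1.differentiableAt.hasDerivAt.mul (hy' w h3)).sub
        (h1.deriv.differentiableAt.hasDerivAt.mul (hy w h3).differentiableAt.hasDerivAt)
      refine h4.congr_deriv ?_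
      rw [h2]
      ring
    exact Metric.isOpen_ball.exists_is_const_of_deriv_eq_zero
      (convex_ball z r).isPreconnected
      (fun w hw ↦ (hd w hw).differentiableAt.differentiableWithinAt) fun w hw ↦ (hd w hw).deriv
  -- The Wronskians of `u` with `y₂` and `y₁` are constant; divided by the Wronskian `7`, they are
  -- the coefficients.
  obtain ⟨a, ha⟩ := hconst (y2 τ) (fun w hw ↦ analyticAt_y2 hw)
    (fun w hw ↦ hasDerivAt_deriv_y2 h hw)
  obtain ⟨b, hb⟩ := hconst (y1 τ) (fun w hw ↦ analyticAt_y1 hw)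
    (fun w hw ↦ hasDerivAt_deriv_y1 h hw)
  refine ⟨a / 7, -b / 7, ?_⟩
  filter_upwards [Metric.ball_mem_nhds z hr] with w hw
  rw [← ha w hw, ← hb w hw]
  linear_combination (-u w / 7) * wronskian_y1_y2 (hball w hw).2

lemma meromorphic_y1 (τ : UpperHalfPlane) : Meromorphic (y1 τ) := by
  have h : Meromorphic (wpDeriv τ) := (periods τ).meromorphic_derivWeierstrassP
  have h1 : Meromorphic (deriv (wpDeriv τ)) := h.deriv
  change Meromorphic fun z ↦ 1 / deriv (wpDeriv τ) z
  fun_prop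

lemma meromorphic_y2 (τ : UpperHalfPlane) : Meromorphic (y2 τ) := by
  have h : Meromorphic (wpDeriv τ) := (periods τ).meromorphic_derivWeierstrassP
  have h1 : Meromorphic (wp τ) := (periods τ).meromorphic_weierstrassP
  have h2 : Meromorphic (zeta τ) := (periods τ).meromorphic_weierstrassZeta
  have h3 := meromorphic_y1 τ
  have h4 : Meromorphic (chi τ) := by
    have h5 : Meromorphic fun z : ℂ ↦ 2 * g2 τ ^ 2 * z := fun z ↦
      AnalyticAt.meromorphicAt (by fun_prop)
    have h6 : Meromorphic fun z ↦ 18 * wp τ z ^ 2 * wpDeriv τ z + 1 / 2 * g2 τ * wpDeriv τ z := by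
      fun_prop
    have h7 : Meromorphic fun z ↦ 36 * g3 τ * zeta τ z := by fun_prop
    exact (h6.add h5).sub h7
  exact h3.mul h4

lemma isFundamentalSystem_y1_y2 (h : g2 τ ≠ 0) (hz : z ∉ singular τ) :
    IsFundamentalSystem τ z ![y1 τ, y2 τ] := by
  refine ⟨fun i ↦ ?_, fun c hc ↦ ?_⟩
  · fin_cases i
    · exact isSolutionAt_y1 h hz
    · exact isSolutionAt_y2 h hz
  · obtain ⟨h0, h1⟩ := eq_zero_of_eventually_y1_y2 hz (a := c 0) (b := c 1)
      (by simpa [Fin.sum_univ_two] using hc)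
    ext i
    fin_cases i
    · exact h0
    · exact h1

end

/-! ### The quasi-periods of `χ` -/

section

open scoped MatrixGroups

variable {τ : UpperHalfPlane} {z b : ℂ}

lemma wp_add (z : ℂ) (ω : (periods τ).lattice) : wp τ (z + ω) = wp τ z :=
  (periods τ).weierstrassP_add_coe z ω

lemma wpDeriv_add (z : ℂ) (ω : (periods τ).lattice) : wpDeriv τ (z + ω) = wpDeriv τ z :=
  (periods τ).derivWeierstrassP_add_coe z ω

lemma y1_add (z : ℂ) (ω : (periods τ).lattice) : y1 τ (z + ω) = y1 τ z := by
  have : deriv (wpDeriv τ) (z + ω) = deriv (wpDeriv τ) z := by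
    rw [← deriv_comp_add_const]
    congr 1
    ext w
    exact wpDeriv_add w ω
  rw [y1, y1, this]

lemma exists_chi_add (ω : (periods τ).lattice) :
    ∃ c, ∀ z ∉ (periods τ).lattice, chi τ (z + ω) = chi τ z + c := by
  obtain ⟨c, hc⟩ := (periods τ).exists_weierstrassZeta_add ω
  refine ⟨2 * g2 τ ^ 2 * ω - 36 * g3 τ * c, fun z hz ↦ ?_⟩
  have h : zeta τ (z + ω) = zeta τ z + c := hc z hz
  rw [chi, chi, wp_add, wpDeriv_add, h]
  ring

/-- The quasi-period `χ(z + ω) - χ(z)`. -/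
noncomputable def chiPeriod (τ : UpperHalfPlane) (ω : (periods τ).lattice) : ℂ :=
  (exists_chi_add ω).choose

lemma chi_add (hz : z ∉ (periods τ).lattice) (ω : (periods τ).lattice) :
    chi τ (z + ω) = chi τ z + chiPeriod τ ω :=
  (exists_chi_add ω).choose_spec z hz

lemma half_notMem : ((periods τ).ω₁ / 2) ∉ (periods τ).lattice :=
  (periods τ).ω₁_div_two_notMem_lattice

lemma add_notMem (hz : z ∉ (periods τ).lattice) (ω : (periods τ).lattice) :
    z + ω ∉ (periods τ).lattice := fun h ↦
  hz (((periods τ).lattice.add_mem_iff_left ω.2).mp h)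

lemma chiPeriod_add (ω ω' : (periods τ).lattice) :
    chiPeriod τ (ω + ω') = chiPeriod τ ω + chiPeriod τ ω' := by
  have h1 := chi_add (half_notMem (τ := τ)) (ω + ω')
  have h2 := chi_add (add_notMem (half_notMem (τ := τ)) ω) ω'
  rw [chi_add half_notMem ω] at h2
  rw [Submodule.coe_add, ← add_assoc, h2] at h1
  linear_combination -h1

lemma chiPeriod_of_half {ω : (periods τ).lattice} (h : (ω : ℂ) / 2 ∉ (periods τ).lattice) :
    chiPeriod τ ω = 2 * (g2 τ ^ 2 * ω - 18 * (2 * zeta τ (ω / 2)) * g3 τ) := by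
  have h1 := chi_add (half_notMem (τ := τ)) ω
  have h2 : zeta τ ((periods τ).ω₁ / 2 + ω) = zeta τ ((periods τ).ω₁ / 2) + 2 * zeta τ (ω / 2) :=
    (periods τ).weierstrassZeta_add_of_half ω.2 h half_notMem
  rw [chi, chi, wp_add, wpDeriv_add, h2] at h1
  linear_combination -h1

lemma chiPeriod_period1 : chiPeriod τ (period1 τ).toAdd = chi1 τ := by
  have h : (((period1 τ).toAdd : (periods τ).lattice) : ℂ) = 1 := rfl
  rw [chiPeriod_of_half (half_notMem (τ := τ)), h, chi1, eta1, mul_one]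

lemma chiPeriod_period2 : chiPeriod τ (period2 τ).toAdd = chi2 τ := by
  have h : (((period2 τ).toAdd : (periods τ).lattice) : ℂ) = τ := rfl
  rw [chiPeriod_of_half ((periods τ).ω₂_div_two_notMem_lattice), h, chi2, eta2]

/-! ### The monodromy representation -/

open Classical in
/-- The factor by which `y₁` is multiplied in the fundamental system `(χ₁ y₁, y₂)`, respectively
`(χ₂ y₁, y₂)`. -/
noncomputable def scale (τ : UpperHalfPlane) : ℂ := if chi1 τ = 0 then chi2 τ else chi1 τ

lemma scale_ne_zero (τ : UpperHalfPlane) : scale τ ≠ 0 := by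
  rw [scale]
  split_ifs with h
  · rw [chi1_eq, mul_eq_zero, or_iff_right (mul_ne_zero two_ne_zero phiConst_ne_zero)] at h
    rw [chi2_eq]
    exact mul_ne_zero (mul_ne_zero two_ne_zero phiConst_ne_zero)
      (phiNum_ne_zero_of_E6Deriv_eq_zero h)
  · exact h

lemma fundSystem_zero (τ : UpperHalfPlane) : fundSystem τ 0 = fun z ↦ scale τ * y1 τ z := rfl

lemma fundSystem_one (τ : UpperHalfPlane) : fundSystem τ 1 = y2 τ := rfl

lemma lower_add (x y : ℂ) : lower (x + y) = lower x * lower y := by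
  ext i j
  rw [Matrix.SpecialLinearGroup.coe_mul]
  fin_cases i <;> fin_cases j <;> simp [lower, Matrix.mul_apply, Fin.sum_univ_two]

lemma lower_zero : lower 0 = 1 := by
  ext i j
  fin_cases i <;> fin_cases j <;> simp [lower]

/-- The monodromy representation of the differential equation with respect to the fundamental
system `(χ₁ y₁, y₂)`, respectively `(χ₂ y₁, y₂)`. -/
noncomputable def monodromyRep (τ : UpperHalfPlane) :
    Multiplicative (periods τ).lattice →* SL(2, ℂ) where
  toFun ω := lower (chiPeriod τ ω.toAdd / scale τ)
  map_one' := by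
    have h := chiPeriod_add (τ := τ) 0 0
    rw [add_zero, left_eq_add] at h
    rw [toAdd_one, h, zero_div, lower_zero]
  map_mul' ω ω' := by rw [toAdd_mul, chiPeriod_add, add_div, lower_add]

lemma monodromyRep_apply (ω : Multiplicative (periods τ).lattice) :
    monodromyRep τ ω = lower (chiPeriod τ ω.toAdd / scale τ) := rfl

lemma monodromyRep_period1 : monodromyRep τ (period1 τ) = normalForm1 (phi τ) := by
  rw [monodromyRep_apply, chiPeriod_period1]
  by_cases h : E6Deriv τ = 0
  · rw [phi_of_eq_zero h, chi1_eq, h, mul_zero, zero_div, lower_zero]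
    rfl
  · have h1 : chi1 τ ≠ 0 := by
      rw [chi1_eq]
      exact mul_ne_zero (mul_ne_zero two_ne_zero phiConst_ne_zero) h
    rw [phi_of_ne_zero h, scale, if_neg h1, div_self h1]
    rfl

lemma monodromyRep_period2 : monodromyRep τ (period2 τ) = normalForm2 (phi τ) := by
  rw [monodromyRep_apply, chiPeriod_period2]
  by_cases h : E6Deriv τ = 0
  · have h1 : chi1 τ = 0 := by rw [chi1_eq, h, mul_zero]
    have h2 := scale_ne_zero τ
    rw [scale, if_pos h1] at *
    rw [phi_of_eq_zero h, div_self h2]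
    rfl
  · have h1 : chi1 τ ≠ 0 := by
      rw [chi1_eq]
      exact mul_ne_zero (mul_ne_zero two_ne_zero phiConst_ne_zero) h
    rw [phi_of_ne_zero h, scale, if_neg h1, chi2_eq, chi1_eq,
      mul_div_mul_left _ _ (mul_ne_zero two_ne_zero phiConst_ne_zero)]
    rfl

lemma analyticAt_fundSystem (hz : z ∉ singular τ) (i : Fin 2) :
    AnalyticAt ℂ (fundSystem τ i) z := by
  fin_cases i
  · exact analyticAt_const.mul (analyticAt_y1 hz)
  · exact analyticAt_y2 hz

lemma isSolutionAt_fundSystem (h : g2 τ ≠ 0) (hz : z ∉ singular τ) (i : Fin 2) :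
    IsSolutionAt τ z (fundSystem τ i) := by
  fin_cases i
  · refine ⟨analyticAt_fundSystem hz 0, ?_⟩
    filter_upwards [eventually_notMem_singular hz] with w hw
    have h1 : deriv (fundSystem τ 0) =ᶠ[𝓝 w] fun v ↦ scale τ * deriv (y1 τ) v := by
      filter_upwards [eventually_notMem_singular hw] with v hv
      exact ((hasDerivAt_y1 hv).differentiableAt.hasDerivAt.const_mul _).deriv
    change deriv (deriv (fundSystem τ 0)) w = coeffI τ w * (scale τ * y1 τ w)
    rw [h1.deriv_eq, ((hasDerivAt_deriv_y1 h hw).const_mul _).deriv]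
    ring
  · exact isSolutionAt_y2 h hz

lemma eq_zero_of_eventually_fundSystem (hz : z ∉ singular τ) {c : Fin 2 → ℂ}
    (h : ∀ᶠ w in 𝓝 z, ∑ i, c i * fundSystem τ i w = 0) : c = 0 := by
  obtain ⟨h0, h1⟩ := eq_zero_of_eventually_y1_y2 hz (a := c 0 * scale τ) (b := c 1) (by
    filter_upwards [h] with w hw
    rw [Fin.sum_univ_two, fundSystem_zero, fundSystem_one, ← mul_assoc] at hw
    exact hw)
  rw [mul_eq_zero, or_iff_left (scale_ne_zero τ)] at h0
  ext i
  fin_cases i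
  · exact h0
  · exact h1

lemma isFundamentalSystem_fundSystem (h : g2 τ ≠ 0) (hz : z ∉ singular τ) :
    IsFundamentalSystem τ z (fundSystem τ) :=
  ⟨isSolutionAt_fundSystem h hz, fun _ hc ↦ eq_zero_of_eventually_fundSystem hz hc⟩

lemma fundSystem_add (hz : z ∉ singular τ) (ω : (periods τ).lattice) (i : Fin 2) :
    fundSystem τ i (z + ω) =
      ∑ j, (monodromyRep τ (Multiplicative.ofAdd ω) : Matrix (Fin 2) (Fin 2) ℂ) i j *
        fundSystem τ j z := by
  have hs := scale_ne_zero τ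
  rw [monodromyRep_apply, toAdd_ofAdd, Fin.sum_univ_two, fundSystem_zero, fundSystem_one]
  fin_cases i
  · simp [lower, fundSystem_zero, y1_add]
  · simp [lower, fundSystem_one, y2, y1_add, chi_add (notMem_lattice_of_notMem_singular hz)]
    field_simp
    ring

/-- The functions of the fundamental system are analytic along every path that avoids the singular
points, so continuation along the path yields these functions themselves, and the monodromy matrix
comes from `fundSystem_add`. -/
lemma isMonodromyRep (h : g2 τ ≠ 0) (hb : b ∉ singular τ) :
    IsMonodromyRep τ b (fundSystem τ) (monodromyRep τ) := by
  refine ⟨isFundamentalSystem_fundSystem h hb, fun ω γ hγ ↦ ⟨fundSystem τ, fun i ↦ ?_, ?_⟩⟩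
  · exact ⟨fun _ ↦ fundSystem τ i, EventuallyEq.rfl, EventuallyEq.rfl, fun t ↦
      ⟨analyticAt_fundSystem (hγ t) i, Eventually.of_forall fun _ ↦ EventuallyEq.rfl⟩⟩
  · filter_upwards [eventually_notMem_singular hb] with w hw i
    exact fundSystem_add hw ω i

/-- The monodromy group is generated by the matrices of the periods `1` and `τ`. -/
lemma range_monodromyRep : (monodromyRep τ).range =
    Subgroup.closure {normalForm1 (phi τ), normalForm2 (phi τ)} := by
  rw [← monodromyRep_period1, ← monodromyRep_period2]
  apply le_antisymm
  · rintro _ ⟨ω, rfl⟩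
    obtain ⟨m, n, hmn⟩ := PeriodPair.mem_lattice.mp ω.toAdd.2
    have : ω = period1 τ ^ m * period2 τ ^ n := by
      apply Multiplicative.toAdd.injective
      apply Subtype.ext
      rw [← hmn]
      simp [period1, period2]
    have h1 : monodromyRep τ (period1 τ) ∈ Subgroup.closure
        {monodromyRep τ (period1 τ), monodromyRep τ (period2 τ)} :=
      Subgroup.subset_closure (Set.mem_insert _ _)
    have h2 : monodromyRep τ (period2 τ) ∈ Subgroup.closure
        {monodromyRep τ (period1 τ), monodromyRep τ (period2 τ)} :=
      Subgroup.subset_closure (Set.mem_insert_of_mem _ (Set.mem_singleton _))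
    rw [this, map_mul, map_zpow, map_zpow]
    exact Subgroup.mul_mem _ (Subgroup.zpow_mem _ h1 m) (Subgroup.zpow_mem _ h2 n)
  · rw [Subgroup.closure_le]
    rintro _ (rfl | rfl)
    · exact ⟨_, rfl⟩
    · exact ⟨_, rfl⟩

lemma lower_sub_one_sq (x : ℂ) : ((lower x : Matrix (Fin 2) (Fin 2) ℂ) - 1) ^ 2 = 0 := by
  ext i j
  fin_cases i <;> fin_cases j <;> simp [lower, sq, Matrix.mul_apply, Fin.sum_univ_two]

/-! ### Uniqueness of the monodromy data -/

/-- Analytic continuation of the germ of a function along a path on which this function is analytic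
leads back to the function. -/
lemma IsContinuation.eventuallyEq {a b : ℂ} {γ : Path a b} {f g u : ℂ → ℂ}
    (h : IsContinuation γ f g) (hu : ∀ t, AnalyticAt ℂ u (γ t)) (hf : f =ᶠ[𝓝 a] u) :
    g =ᶠ[𝓝 b] u := by
  obtain ⟨Y, h0, h1, hY⟩ := h
  have key : ∀ t, ∀ᶠ s in 𝓝 t, (Y s =ᶠ[𝓝 (γ s)] u ↔ Y t =ᶠ[𝓝 (γ t)] u) := by
    intro t
    obtain ⟨r, hr, hball⟩ := Metric.eventually_nhds_iff_ball.mp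
      ((hY t).1.eventually_analyticAt.and (hu t).eventually_analyticAt)
    have han1 : AnalyticOnNhd ℂ (Y t) (Metric.ball (γ t) r) := fun w hw ↦ (hball w hw).1
    have han2 : AnalyticOnNhd ℂ u (Metric.ball (γ t) r) := fun w hw ↦ (hball w hw).2
    have hpre := (convex_ball (γ t) r).isPreconnected
    filter_upwards [(hY t).2, γ.continuous.continuousAt.eventually
      (Metric.ball_mem_nhds (γ t) hr)] with s hs hs'
    constructor
    · intro h
      have h2 := han1.eqOn_of_preconnected_of_eventuallyEq han2 hpre hs' (hs.symm.trans h)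
      exact h2.eventuallyEq_of_mem (Metric.ball_mem_nhds _ hr)
    · intro h
      have h2 := han1.eqOn_of_preconnected_of_eventuallyEq han2 hpre (Metric.mem_ball_self hr) h
      exact hs.trans (h2.eventuallyEq_of_mem (Metric.isOpen_ball.mem_nhds hs'))
  -- The parameters at which the continued germ is the germ of `u` form an open and closed set.
  have hclopen : IsClopen {t | Y t =ᶠ[𝓝 (γ t)] u} := by
    constructor
    · rw [← isOpen_compl_iff, isOpen_iff_mem_nhds]
      intro t ht
      filter_upwards [key t] with s hs h
      exact ht (hs.mp h)
    · rw [isOpen_iff_mem_nhds]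
      intro t ht
      filter_upwards [key t] with s hs
      exact hs.mpr ht
  have huniv := hclopen.eq_univ ⟨0, by
    rw [Set.mem_ofPred_eq, γ.source]
    exact h0.trans hf⟩
  have h2 : (1 : unitInterval) ∈ {t | Y t =ᶠ[𝓝 (γ t)] u} := huniv ▸ Set.mem_univ _
  rw [Set.mem_ofPred_eq, γ.target] at h2
  exact h1.symm.trans h2

/-- The monodromy with respect to any fundamental system `y` is conjugate to that with respect to
`fundSystem τ`, by the matrix `P` that expresses `y` in `fundSystem τ`. That `P` is invertible is
stated as the linear independence of its rows. -/
lemma IsMonodromyRep.exists_mul_eq (h : g2 τ ≠ 0) (hb : b ∉ singular τ) {y : Fin 2 → ℂ → ℂ}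
    {ρ : Multiplicative (periods τ).lattice →* SL(2, ℂ)} (hρ : IsMonodromyRep τ b y ρ) :
    ∃ P : Matrix (Fin 2) (Fin 2) ℂ, (∀ c : Fin 2 → ℂ, Matrix.vecMul c P = 0 → c = 0) ∧
      ∀ ω, (ρ ω : Matrix (Fin 2) (Fin 2) ℂ) * P =
        P * (monodromyRep τ ω : Matrix (Fin 2) (Fin 2) ℂ) := by
  obtain ⟨⟨hsol, hind⟩, hmono⟩ := hρ
  have hP : ∀ i, ∃ p : Fin 2 → ℂ, y i =ᶠ[𝓝 b] fun w ↦ ∑ j, p j * fundSystem τ j w := by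
    intro i
    obtain ⟨α, β, hαβ⟩ := (hsol i).exists_eq h hb
    refine ⟨![α / scale τ, β], hαβ.trans (Eventually.of_forall fun w ↦ ?_)⟩
    have := scale_ne_zero τ
    simp only [Fin.sum_univ_two, fundSystem_zero, fundSystem_one, Matrix.cons_val_zero,
      Matrix.cons_val_one]
    field_simp
  choose P hP using hP
  refine ⟨Matrix.of P, fun c hc ↦ hind c ?_, fun ω ↦ ?_⟩
  · filter_upwards [hP 0, hP 1] with w h0 h1
    have e0 := congrFun hc 0
    have e1 := congrFun hc 1
    simp only [Matrix.vecMul, dotProduct, Fin.sum_univ_two, Matrix.of_apply, Pi.zero_apply] at e0 e1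
    rw [Fin.sum_univ_two, h0, h1, Fin.sum_univ_two, Fin.sum_univ_two]
    linear_combination fundSystem τ 0 w * e0 + fundSystem τ 1 w * e1
  · set v : (periods τ).lattice := ω.toAdd
    have hb' : b + v ∉ singular τ := fun hmem ↦ hb ((add_mem_singular_iff v.2).mp hmem)
    obtain ⟨γ, hγ⟩ := (isPathConnected_singular_compl τ).joinedIn b hb (b + v) hb'
    obtain ⟨g, hg, hgM⟩ := hmono v γ hγ
    set M : Matrix (Fin 2) (Fin 2) ℂ := (ρ (Multiplicative.ofAdd v)).1
    set N : Matrix (Fin 2) (Fin 2) ℂ := (monodromyRep τ (Multiplicative.ofAdd v)).1 with hN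
    change M * Matrix.of P = Matrix.of P * N
    have hcont : ∀ i, ∀ᶠ w in 𝓝 b, g i (w + v) = ∑ j, P i j * fundSystem τ j (w + v) := by
      intro i
      have h1 := (hg i).eventuallyEq (u := fun w ↦ ∑ j, P i j * fundSystem τ j w) (fun t ↦ by
        refine Finset.analyticAt_fun_sum _ fun j _ ↦ ?_
        exact analyticAt_const.mul (analyticAt_fundSystem (hγ t) j)) (hP i)
      exact (continuous_add_const (v : ℂ)).continuousAt.eventually h1
    ext i k
    have hzero : (fun j ↦ (M * Matrix.of P) i j - (Matrix.of P * N) i j) = 0 := by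
      refine eq_zero_of_eventually_fundSystem hb ?_
      filter_upwards [hgM, hcont i, hP 0, hP 1, eventually_notMem_singular hb]
        with w h1 h2 h3 h4 h5
      have h6 := h1 i
      rw [h2] at h6
      simp only [Fin.sum_univ_two, h3, h4, fundSystem_add h5, ← hN] at h6
      simp only [Fin.sum_univ_two, Matrix.mul_apply, Matrix.of_apply]
      linear_combination -h6
    exact sub_eq_zero.mp (congrFun hzero k)

lemma coe_lower (x : ℂ) : (lower x : Matrix (Fin 2) (Fin 2) ℂ) = !![1, 0; x, 1] := rfl

/-- A matrix that conjugates two unipotent lower triangular matrices, not both trivial, into two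
others scales the lower left entries by a common factor. -/
lemma exists_mul_eq_of_lower_mul {P : Matrix (Fin 2) (Fin 2) ℂ}
    (hP : ∀ c : Fin 2 → ℂ, Matrix.vecMul c P = 0 → c = 0) {m₁ m₂ n₁ n₂ : ℂ}
    (hn : n₁ ≠ 0 ∨ n₂ ≠ 0)
    (h1 : (lower m₁ : Matrix (Fin 2) (Fin 2) ℂ) * P = P * (lower n₁ : Matrix (Fin 2) (Fin 2) ℂ))
    (h2 : (lower m₂ : Matrix (Fin 2) (Fin 2) ℂ) * P = P * (lower n₂ : Matrix (Fin 2) (Fin 2) ℂ)) :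
    ∃ u v : ℂ, u ≠ 0 ∧ v ≠ 0 ∧ m₁ * u = n₁ * v ∧ m₂ * u = n₂ * v := by
  have key : ∀ m n : ℂ, (lower m : Matrix (Fin 2) (Fin 2) ℂ) * P =
      P * (lower n : Matrix (Fin 2) (Fin 2) ℂ) → P 0 1 * n = 0 ∧ m * P 0 0 = n * P 1 1 := by
    intro m n h
    have e00 := congrFun (congrFun h 0) 0
    have e10 := congrFun (congrFun h 1) 0
    rw [coe_lower, coe_lower] at e00 e10
    simp only [Matrix.mul_apply, Fin.sum_univ_two, Matrix.of_apply, Matrix.cons_val',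
      Matrix.cons_val_zero, Matrix.cons_val_one, Matrix.cons_val_fin_one] at e00 e10
    exact ⟨by linear_combination -e00, by linear_combination e10⟩
  obtain ⟨k1, k2⟩ := key _ _ h1
  obtain ⟨k3, k4⟩ := key _ _ h2
  have h01 : P 0 1 = 0 := by
    rcases hn with hn | hn
    · exact (mul_eq_zero.mp k1).resolve_right hn
    · exact (mul_eq_zero.mp k3).resolve_right hn
  have hvec : ∀ x y : ℂ, x * P 0 0 + y * P 1 0 = 0 → x * P 0 1 + y * P 1 1 = 0 →
      x = 0 ∧ y = 0 := by
    intro x y h h'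
    have := hP ![x, y] (by
      ext i
      fin_cases i
      · simpa [Matrix.vecMul, dotProduct, Fin.sum_univ_two] using h
      · simpa [Matrix.vecMul, dotProduct, Fin.sum_univ_two] using h')
    exact ⟨congrFun this 0, congrFun this 1⟩
  have h00 : P 0 0 ≠ 0 := fun h ↦ one_ne_zero (hvec 1 0 (by simp [h]) (by simp [h01])).1
  have h11 : P 1 1 ≠ 0 := fun h ↦
    h00 (neg_eq_zero.mp (hvec (P 1 0) (-P 0 0) (by ring) (by simp [h, h01])).2)
  exact ⟨_, _, h00, h11, k2, k4⟩

/-- The normal form of a pair of unipotent matrices determines the data. -/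
lemma normalForm_eq_of_conj {P : Matrix (Fin 2) (Fin 2) ℂ}
    (hP : ∀ c : Fin 2 → ℂ, Matrix.vecMul c P = 0 → c = 0) {D E : OnePoint ℂ}
    (h1 : (normalForm1 D : Matrix (Fin 2) (Fin 2) ℂ) * P =
      P * (normalForm1 E : Matrix (Fin 2) (Fin 2) ℂ))
    (h2 : (normalForm2 D : Matrix (Fin 2) (Fin 2) ℂ) * P =
      P * (normalForm2 E : Matrix (Fin 2) (Fin 2) ℂ)) : D = E := by
  have hinf1 : normalForm1 none = lower 0 := lower_zero.symm
  rcases D with - | d <;> rcases E with - | e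
  · rfl
  · rw [hinf1] at h1
    obtain ⟨u, v, -, hv, k1, -⟩ := exists_mul_eq_of_lower_mul hP (Or.inl one_ne_zero) h1 h2
    exact absurd (by linear_combination -k1) hv
  · rw [hinf1] at h1
    obtain ⟨u, v, hu, -, k1, -⟩ := exists_mul_eq_of_lower_mul hP (Or.inr one_ne_zero) h1 h2
    exact absurd (by linear_combination k1) hu
  · obtain ⟨u, v, hu, -, k1, k2⟩ := exists_mul_eq_of_lower_mul hP (Or.inl one_ne_zero) h1 h2
    have : d = e := mul_right_cancel₀ hu (by linear_combination k2 - e * k1)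
    rw [this]

/-- The differential equation has exactly one monodromy data, the value of `φ`. -/
lemma isMonodromyData_iff (h : g2 τ ≠ 0) (D : OnePoint ℂ) :
    IsMonodromyData τ D ↔ D = phi τ := by
  constructor
  · rintro ⟨b, hb, y, ρ, hρ, h1, h2⟩
    obtain ⟨P, hP, hPρ⟩ := hρ.exists_mul_eq h hb
    refine normalForm_eq_of_conj hP ?_ ?_
    · rw [← h1, ← monodromyRep_period1]
      exact hPρ _
    · rw [← h2, ← monodromyRep_period2]
      exact hPρ _
  · rintro rfl
    obtain ⟨b, hb⟩ := (isPathConnected_singular_compl τ).nonempty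
    exact ⟨b, hb, fundSystem τ, monodromyRep τ, isMonodromyRep h hb, monodromyRep_period1,
      monodromyRep_period2⟩

end

end E6Monodromy

theorem theorem5p1 :
    -- the points that define the curves exist and are unique
    (∃! τ, τ ∈ F0 ∧ E6Deriv τ = 0) ∧
    (∀ C : ℝ, C ≠ 0 → C ≠ 1 →
      (∃! τ, τ ∈ F0Left ∧ fC C τ = 0) ∧ (∃! τ, τ ∈ F0Right ∧ fC C τ = 0)) ∧
    -- the differential equation, its solutions and its monodromy
    (∀ τ ∈ F0Punctured,
      (∀ j, q τ j ∉ (periods τ).lattice ∧ wp τ (q τ j) = qValue τ j) ∧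
      Meromorphic (y1 τ) ∧ Meromorphic (y2 τ) ∧
      (∀ b ∉ singular τ, IsFundamentalSystem τ b ![y1 τ, y2 τ]) ∧
      (∀ b ∉ singular τ, ∃ ρ, IsMonodromyRep τ b (fundSystem τ) ρ ∧
        ρ (period1 τ) = normalForm1 (phi τ) ∧ ρ (period2 τ) = normalForm2 (phi τ) ∧
        ρ.range = Subgroup.closure {normalForm1 (phi τ), normalForm2 (phi τ)} ∧
        ∀ ω, ((ρ ω : Matrix (Fin 2) (Fin 2) ℂ) - 1) ^ 2 = 0) ∧
      (∀ D : OnePoint ℂ, IsMonodromyData τ D ↔ D = phi τ)) ∧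
    -- real or infinite monodromy data
    setL = curve1 ∪ curve2 ∪ curve3 ∧
    setL ∩ F = curveLess ∪ curveGreater ∧
    -- zeros of the derivative of the Eisenstein series
    (∀ γ ∈ CongruenceSubgroup.Gamma0 2, ∀ τ ∈ F0, E6Deriv (γ • τ) = 0 →
      τ ∈ F0Punctured ∧ ∀ D : OnePoint ℂ, IsMonodromyData τ D ↔ D = negDivLower γ) := by
  have hL : setL = realPhi := by
    ext τ
    constructor
    · rintro ⟨h1, D, hD, h2⟩
      rw [isMonodromyData_iff (g2_ne_zero h1)] at h2
      exact ⟨h1, h2 ▸ hD⟩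
    · rintro ⟨h1, h2⟩
      exact ⟨h1, _, h2, (isMonodromyData_iff (g2_ne_zero h1) _).mpr rfl⟩
  refine ⟨existsUnique_tauInfty, fun C h0 h1 ↦ ⟨existsUnique_F0Left h0, existsUnique_F0Right h1⟩,
    fun τ hτ ↦ ?_, hL.trans realPhi_eq, hL ▸ realPhi_inter_F, fun γ _ τ hτ hγ ↦ ?_⟩
  · have hg := g2_ne_zero hτ
    exact ⟨q_spec τ, meromorphic_y1 τ, meromorphic_y2 τ,
      fun b hb ↦ isFundamentalSystem_y1_y2 hg hb,
      fun b hb ↦ ⟨monodromyRep τ, isMonodromyRep hg hb, monodromyRep_period1,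
        monodromyRep_period2, range_monodromyRep, fun ω ↦ lower_sub_one_sq _⟩,
      isMonodromyData_iff hg⟩
  · obtain ⟨h1, h2⟩ := phi_eq_negDivLower hγ
    have hp : τ ∈ F0Punctured := mem_F0Punctured_iff.mpr ⟨hτ, ne_corner_of_phi_mem h2⟩
    exact ⟨hp, fun D ↦ by rw [isMonodromyData_iff (g2_ne_zero hp), h1]⟩
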